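/- **Setting.** Let $J\ge 1$, let $g^{(0)},\dots,g^{(2J-1)}$ be real polynomials, and consider on $\mathbb T=\mathbb R/2\pi\mathbb Z$ the equation $$\partial_t u=(-1)^{J+1}\partial_x^{2J}u+\sum_{j=0}^{2J-1}\partial_x^{j}\,g^{(j)}(u),\qquad t>\tau,\qquad (1)$$ with right-hand side $F(u)$. Let $\nu\ge1$. Functions are identified with their Fourier coefficients, $u=\sum_n u_ne^{inx}$, and $\ell^1_\nu$ is the space of $a\in\mathbb C^{\mathbb Z}$ with $\|a\|=\sum_n|a_n|\nu^{|n|}<\infty$; operator norms are those of $B(\ell^1_\nu,\ell^1_\nu)$ and balls are closed. Write $\mathcal D=\partial_x$, and $|\cdot|$ for component-wise (entry-wise) absolute values of sequences (infinite matrices); for a polynomial $p=\sum p_kx^k$ put $|p|=\sum|p_k|x^k$; $\Pi^{\le N}$ is the projection on the modes $|n|\le N$ and $\Pi^{>N}=I-\Pi^{\le N}$. Let $\bar u\in\ell^1_\nu$, and let $N_L\in\mathbb N$. For $|n|>N_L$ put $\lambda_n=-n^{2J}+\sum_{j}(in)^j\,\bar v^{(j)}_0$, where $\bar v^{(j)}_0$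 is the mean value of $(g^{(j)})'(\bar u)$; choose arbitrary complex numbers $\lambda_n$ for $|n|\le N_L$, and an invertible matrix $Q_N$ on the modes $|n|\le N_L$. Let $Q=Q_N+\Pi^{>N_L}$, $\Lambda=\mathrm{diag}(\lambda_n)$, $L=Q\Lambda Q^{-1}$, $\gamma=F-L$ and $B=|Q|\,|\mathrm{Re}(\Lambda)^{-1}|$. Let $\beta^{(j)}=|(g^{(j)})'(\bar u)-\bar v^{(j)}_0|$ (sequence of moduli of Fourier coefficients), assume that $\bar N\in\mathbb N$ is such that $\beta^{(j)}_n=0$ for all $|n|>\bar N$ and all $j$ (such $\bar N$ exists if $\bar u$ is a trigonometric polynomial), and let $\Gamma$ be a matrix that dominates $|Q^{-1}D\gamma(\bar u)|$ entry-wise on the columns of index at most $\bar N+N_L$ in absolute value. Let $\chi^{(j)}=\sup_{|n|>N_L}|n|^j/|\mathrm{Re}\,\lambda_n|$. For $u^{\mathrm{in}}\in\ell^1_\nu$ and $r_*>0$ define $$Y=\Big\|\,|Q|\,\big|Q^{-1}(u^{\mathrm{in}}+L^{-1}\gamma(\bar u))\big|+\big|\bar u+L^{-1}\gamma(\bar u)\big|\,\Big\|,$$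 $$Z=\max\Big(\big\|B\,\Gamma\,\Pi^{\le\bar N+N_L}\big\|,\ \sum_{j=0}^{2J-1}\|\beta^{(j)}\|\,\chi^{(j)}\Big),\qquad W=\sum_{j=0}^{2J-1}\big\|B\,|Q^{-1}|\,|\mathcal D^j|\big\|\;\big|(g^{(j)})''\big|\big(\|\bar u\|+r_*\big).$$ **Theorem.** Assume that all $\lambda_n$ (the eigenvalues of $L$) have negative real part, that $Z<\infty$, and that some $r_{\min}\in(0,r_*)$ satisfies $$Y+Zr_{\min}+\tfrac12Wr_{\min}^2<r_{\min},\qquad Z+Wr_{\min}<1 .$$ Let $r_{\max}\in(r_{\min},r_*]$ satisfy $Y+Zr_{\max}+\tfrac12Wr_{\max}^2\le r_{\max}$ and $Z+Wr_{\max}<1$. With $\kappa=\big\||Q|\,|Q^{-1}|\big\|$, let $\varepsilon>0$ be such that $$\big(1-(Z+Wr_{\min})\big)^2-4W\kappa\varepsilon>0,$$ $$\frac{1-(Z+Wr_{\min})-\sqrt{\big(1-(Z+Wr_{\min})\big)^2-4W\kappa\varepsilon}}{2W}\le r_{\max}-r_{\min}$$ (if $W=0$, i.e. all $g^{(j)}$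 are affine, the last condition is void). Then there is a steady state $u^{\mathrm{stat}}\in\ell^1_\nu$ of (1) in the ball of radius $r_{\min}$ around $\bar u$; it is the only steady state in the ball of radius $r_{\max}$ around $\bar u$; and for every $v^{\mathrm{in}}\in\ell^1_\nu$ with $\|v^{\mathrm{in}}-u^{\mathrm{stat}}\|\le\varepsilon$ the solution $v$ of (1) with $v(\tau)=v^{\mathrm{in}}$ exists for all $t\ge\tau$, is unique (every solution on an interval $[\tau,T)$ with the same initial value coincides with it there), and satisfies $\|v(t)-u^{\mathrm{stat}}\|\to0$ as $t\to\infty$. Here a steady state is an $a\in\ell^1_\nu$ all of whose Fourier coefficients satisfy $F(a)_n=0$, and a solution is a function of time that is continuous with values in $\ell^1_\nu$, and that for every $t>\tau$ satisfies $\mathcal D^{2J}v(t)\in\ell^1_\nu$ and is differentiable in $\ell^1_\nu$ with derivative $F(v(t))$. -/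

import Mathlib

open Filter Topology
open scoped ENNReal NNReal

noncomputable section

namespace FourierPDE

/-! ### Sequences of Fourier coefficients and the spaces `ℓ¹_ν` -/

/-- Bi-infinite complex sequences; `a` is identified with `x ↦ ∑ n, a n * exp (i n x)`. -/
abbrev Seq := ℤ → ℂ

/-- The norm of `ℓ¹_ν`, as an extended non-negative number:
`∑ n, |a n| ν ^ |n|`, infinite exactly when `a` is not in `ℓ¹_ν`. -/
def l1norm (ν : ℝ) (a : Seq) : ℝ≥0∞ :=
  ∑' n : ℤ, ENNReal.ofReal (‖a n‖ * ν ^ n.natAbs)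

/-- Membership in `ℓ¹_ν`. -/
def MemL1 (ν : ℝ) (a : Seq) : Prop := l1norm ν a < ⊤

/-- The operator norm on `B(ℓ¹_ν, ℓ¹_ν)`: the least `C` with `‖T a‖ ≤ C ‖a‖` for all `a ∈ ℓ¹_ν`
(infinite if there is none). -/
def opNorm (ν : ℝ) (T : Seq → Seq) : ℝ≥0∞ :=
  sInf {C : ℝ≥0∞ | ∀ a : Seq, MemL1 ν a → l1norm ν (T a) ≤ C * l1norm ν a}

/-- Discrete convolution. -/
def conv (a b : Seq) : Seq := fun n => ∑' m : ℤ, a m * b (n - m)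

/-- Convolution powers; the zeroth one is the sequence of the constant function `1`. -/
def convPow (a : Seq) : ℕ → Seq
  | 0 => Pi.single 0 1
  | k + 1 => conv a (convPow a k)

/-- The Fourier coefficients `p(a)` of the function `x ↦ p (a x)`. -/
def polySeq (p : Polynomial ℝ) (a : Seq) : Seq :=
  fun n => ∑ k ∈ p.support, (p.coeff k : ℂ) * convPow a k n

/-- The polynomial `|p|`, whose coefficients are the absolute values of those of `p`. -/
def absPoly (p : Polynomial ℝ) : Polynomial ℝ :=
  ∑ k ∈ p.support, Polynomial.monomial k |p.coeff k|

/-- Component-wise absolute value. -/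
def absSeq (a : Seq) : Seq := fun n => (‖a n‖ : ℂ)

/-- `𝒟 ^ j`, where `𝒟` is the spatial derivative in Fourier space. -/
def Dpow (j : ℕ) (a : Seq) : Seq := fun n => (Complex.I * (n : ℂ)) ^ j * a n

/-- `|𝒟 ^ j|`. -/
def absDpow (j : ℕ) (a : Seq) : Seq := fun n => ((n.natAbs : ℂ)) ^ j * a n

/-- The modes `|n| ≤ N`. -/
abbrev Modes (N : ℕ) : Type := ↥(Finset.Icc (-(N : ℤ)) (N : ℤ))

/-- The operator that acts as the matrix `M` on the modes `|n| ≤ N` and as the identity on the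
modes `|n| > N`. -/
def blockOp (N : ℕ) (M : Matrix (Modes N) (Modes N) ℂ) (a : Seq) : Seq := fun n =>
  if h : n ∈ Finset.Icc (-(N : ℤ)) (N : ℤ) then ∑ k : Modes N, M ⟨n, h⟩ k * a k else a n

/-- Entry-wise absolute value of a matrix. -/
def absMat {N : ℕ} (M : Matrix (Modes N) (Modes N) ℂ) : Matrix (Modes N) (Modes N) ℂ :=
  M.map fun z => (‖z‖ : ℂ)

/-! ### The equation -/

/-- The right-hand side, in Fourier space, of
`∂ₜ u = (-1)^(J+1) ∂ₓ^(2J) u + ∑_{j < 2J} ∂ₓ^j (g j (u))`. -/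
def rhs (J : ℕ) (g : ℕ → Polynomial ℝ) (u : Seq) : Seq := fun n =>
  (-1) ^ (J + 1) * Dpow (2 * J) u n + ∑ j ∈ Finset.range (2 * J), Dpow j (polySeq (g j) u) n

/-- `a ∈ ℓ¹_ν` is a steady state of the equation. -/
def IsSteadyState (J : ℕ) (g : ℕ → Polynomial ℝ) (ν : ℝ) (a : Seq) : Prop :=
  MemL1 ν a ∧ rhs J g a = 0

/-- `u` is a classical solution in `ℓ¹_ν` of the equation on the time interval `I`
(used for `I = [τ, T)` and `I = [τ, ∞)`), with value `uin` at time `τ`: it is continuous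
from `I` to `ℓ¹_ν`, and at each time `t > τ` of `I` the sequence `𝒟^(2J) u(t)` is in `ℓ¹_ν` and `u`
is differentiable in `ℓ¹_ν` with derivative `rhs (u t)`. -/
structure IsSolutionOn (J : ℕ) (g : ℕ → Polynomial ℝ) (ν τ : ℝ) (I : Set ℝ) (uin : Seq)
    (u : ℝ → Seq) : Prop where
  initial : u τ = uin
  mem : ∀ t ∈ I, MemL1 ν (u t)
  cont : ∀ t ∈ I, Tendsto (fun s => l1norm ν (u s - u t)) (𝓝[I] t) (𝓝 0)
  reg : ∀ t ∈ I, τ < t → MemL1 ν (Dpow (2 * J) (u t))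
  deriv : ∀ t ∈ I, τ < t →
    Tendsto (fun s => l1norm ν ((((s - t)⁻¹ : ℝ) : ℂ) • (u s - u t) - rhs J g (u t)))
      (𝓝[I \ {t}] t) (𝓝 0)

/-! ### The operator `L`, and the bounds `Y`, `Z`, `W` for one infinitely long time step -/

/-- The data from which the approximate linearization and the bounds are built. -/
structure Setup where
  /-- half the order of the leading derivative -/
  J : ℕ
  /-- the nonlinearities; only `g j` with `j < 2 * J` are used -/
  g : ℕ → Polynomial ℝ
  /-- decay rate of the Fourier coefficients -/
  ν : ℝ
  /-- approximate steady state -/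
  ubar : Seq
  /-- number of modes in the finite part of `L` -/
  NL : ℕ
  /-- the chosen approximate eigenvalues; only those with `|n| ≤ NL` are used -/
  lamLow : ℤ → ℂ
  /-- the chosen matrix of approximate eigenvectors -/
  QN : Matrix (Modes NL) (Modes NL) ℂ
  /-- bound on the number of modes in the sequences `β j` -/
  Nbar : ℕ
  /-- entries of `Γ` in the columns `|k| ≤ Nbar + NL` -/
  G : ℤ → ℤ → ℝ

namespace Setup

variable (S : Setup)

/-- The Fourier coefficients of `(g j)' (ubar)`. -/
def gPrime (j : ℕ) : Seq := polySeq (Polynomial.derivative (S.g j)) S.ubar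

/-- The diagonal entries of `Λ`, which are the eigenvalues of `L`. Beyond `NL` they are
`-n^(2J) + ∑_{j < 2J} (i n)^j v_j`, with `v_j` the mean value of `(g j)' (ubar)`. -/
def lam (n : ℤ) : ℂ :=
  if n.natAbs ≤ S.NL then S.lamLow n
  else -(n : ℂ) ^ (2 * S.J) +
    ∑ j ∈ Finset.range (2 * S.J), (Complex.I * (n : ℂ)) ^ j * S.gPrime j 0

/-- `Q = Q_N + Π^{>N}`. -/
def Q (a : Seq) : Seq := blockOp S.NL S.QN a

/-- `Q⁻¹`. -/
def Qinv (a : Seq) : Seq := blockOp S.NL S.QN⁻¹ a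

/-- `|Q|`. -/
def absQ (a : Seq) : Seq := blockOp S.NL (absMat S.QN) a

/-- `|Q⁻¹|`. -/
def absQinv (a : Seq) : Seq := blockOp S.NL (absMat S.QN⁻¹) a

/-- `L = Q Λ Q⁻¹`. -/
def L (a : Seq) : Seq := S.Q fun n => S.lam n * S.Qinv a n

/-- `L⁻¹ = Q Λ⁻¹ Q⁻¹`. -/
def Linv (a : Seq) : Seq := S.Q fun n => (S.lam n)⁻¹ * S.Qinv a n

/-- `γ = F - L`, with `F` the right-hand side of the equation. -/
def gam (u : Seq) : Seq := rhs S.J S.g u - S.L u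

/-- `Dγ(ubar) h = DF(ubar) h - L h`. -/
def dgam (h : Seq) : Seq := (fun n =>
    (-1) ^ (S.J + 1) * Dpow (2 * S.J) h n +
      ∑ j ∈ Finset.range (2 * S.J), Dpow j (conv (S.gPrime j) h) n) - S.L h

/-- `B = |Q| |Re(Λ)⁻¹|`. -/
def B (a : Seq) : Seq := S.absQ fun n => (|((S.lam n).re)⁻¹| : ℝ) * a n

/-- `β j = |(g j)' (ubar) - v_j|`, with `v_j` the mean value of `(g j)' (ubar)`. -/
def beta (j : ℕ) : Seq :=
  absSeq (S.gPrime j - Pi.single 0 (S.gPrime j 0))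

/-- `χ j = sup_{|n| > NL} |n|^j / |Re λ_n|`. -/
def chi (j : ℕ) : ℝ≥0∞ :=
  ⨆ (n : ℤ) (_ : S.NL < n.natAbs), ENNReal.ofReal ((n.natAbs : ℝ) ^ j / |(S.lam n).re|)

/-- `Γ Π^{≤ Nbar + NL}`. -/
def GamLow (a : Seq) : Seq := fun n =>
  ∑ k ∈ Finset.Icc (-((S.Nbar + S.NL : ℕ) : ℤ)) ((S.Nbar + S.NL : ℕ) : ℤ), (S.G n k : ℂ) * a k

/-- `Γ Π^{≤ Nbar + NL}` dominates `|Q⁻¹ Dγ(ubar)| Π^{≤ Nbar + NL}` entry by entry. -/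
def GamDominates : Prop :=
  ∀ n k : ℤ, k.natAbs ≤ S.Nbar + S.NL → ‖S.Qinv (S.dgam (Pi.single k 1)) n‖ ≤ S.G n k

/-- The residual bound, for the initial condition `uin`. -/
def Ybound (uin : Seq) : ℝ≥0∞ :=
  l1norm S.ν (S.absQ (absSeq (S.Qinv (uin + S.Linv (S.gam S.ubar)))) +
    absSeq (S.ubar + S.Linv (S.gam S.ubar)))

/-- The bound on the derivative at `ubar`. -/
def Zbound : ℝ≥0∞ :=
  max (opNorm S.ν fun a => S.B (S.GamLow a))
    (∑ j ∈ Finset.range (2 * S.J), l1norm S.ν (S.beta j) * S.chi j)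

/-- The Lipschitz bound on the derivative in the ball of radius `rstar`, that is
`∑_{j < 2J} ‖|Q| |Re(Λ)⁻¹| |Q⁻¹| |𝒟^j|‖ * |(g j)''| (‖ubar‖ + rstar)`. -/
def Wbound (rstar : ℝ) : ℝ≥0∞ :=
  ∑ j ∈ Finset.range (2 * S.J),
    opNorm S.ν (fun a => S.B (S.absQinv (absDpow j a))) *
      ENNReal.ofReal ((absPoly (Polynomial.derivative (Polynomial.derivative (S.g j)))).eval
        ((l1norm S.ν S.ubar).toReal + rstar))

/-- `‖|Q| |Q⁻¹|‖`. -/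
def condQ : ℝ≥0∞ := opNorm S.ν fun a => S.absQ (S.absQinv a)

end Setup

end FourierPDE

end

noncomputable section

namespace FourierPDE

/-! ### Weighted `ℓ¹` algebras -/

/-! Writing F = L + γ with L invertible, F(u) = 0 is equivalent to u = -L⁻¹γ(u)
(`isSteadyState_iff`). If a and b have distance at most ra and rb from ubar, then L⁻¹γ has Lipschitz
constant Z + W(ra + rb)/2 between them, so the conditions on rmin and rmax make the map a
contraction; its fixed point is the steady state.

For stability put w = v - ustat. Then w(t) = Q e^{Λt} Q⁻¹ w(0) + Q ∫ e^{Λ(t-s)} Q⁻¹(γ(ustat + w(s))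
- γ(ustat)) ds. If component n of the integrand is bounded by m_n at all times, its scalar Duhamel
integral is at most m_n / |Re λ_n|, so the operator B controls the formula on [0, ∞) just as it
controls L⁻¹. This requires the supremum in time to be taken before the sum over modes. Hence the
sequences have coefficients in a general algebra A: with A the bounded continuous functions of time
they still form a Banach algebra under convolution, and a single estimate (`Bounds.exists_majorant`)
serves both the stationary and the evolution problem. The fixed point w is sought among small
sequences whose components tend to zero in time; this set is closed and invariant, so convergence is
built into the space and no decay rate is needed (`Bounds.exists_mild`).

The fixed point solves the equation component by component. Parabolic smoothing gains one power of
|n| at a time (`RegularOfOrder.succ`), and 2J gains make it a classical solution. Uniqueness has to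
hold among all solutions, including those whose time suprema are not summable over the modes; it
follows from an estimate integrated in time against e^{-μt} (`eq_of_solve_components`). -/

/-- A submultiplicative weight on `ℤ`, bounded below by one. -/
structure Weight where
  /-- the weight function -/
  w : ℤ → ℝ
  one_le : ∀ n, 1 ≤ w n
  zero : w 0 = 1
  add_le : ∀ m n, w (m + n) ≤ w m * w n

lemma Weight.pos (ω : Weight) (n : ℤ) : 0 < ω.w n := zero_lt_one.trans_le (ω.one_le n)

lemma Weight.nonneg (ω : Weight) (n : ℤ) : 0 ≤ ω.w n := (ω.pos n).le

/-- The submodule of sequences with `∑ n, ‖a n‖ ω n < ∞`. -/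
def wl1 (ω : Weight) (A : Type*) [NormedCommRing A] [NormedAlgebra ℂ A] :
    Submodule ℂ (ℤ → A) where
  carrier := {a | Summable fun n => ‖a n‖ * ω.w n}
  zero_mem' := by simp [summable_zero]
  add_mem' {a b} ha hb := by
    refine Summable.of_nonneg_of_le (fun n => mul_nonneg (norm_nonneg _) (ω.nonneg n))
      (fun n => ?_) (Summable.add ha hb)
    rw [← add_mul]
    exact mul_le_mul_of_nonneg_right (norm_add_le _ _) (ω.nonneg n)
  smul_mem' c a ha := by
    refine (Summable.mul_left ‖c‖ ha).congr fun n => ?_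
    simp [norm_smul, mul_assoc]

/-- The weighted `ℓ¹` space with coefficients in `A`. -/
def WL (ω : Weight) (A : Type*) [NormedCommRing A] [NormedAlgebra ℂ A] : Type _ := ↥(wl1 ω A)

namespace WL

variable {ω : Weight} {A : Type*} [NormedCommRing A] [NormedAlgebra ℂ A]

instance : AddCommGroup (WL ω A) := inferInstanceAs (AddCommGroup ↥(wl1 ω A))
instance : Module ℂ (WL ω A) := inferInstanceAs (Module ℂ ↥(wl1 ω A))
instance : CoeFun (WL ω A) (fun _ => ℤ → A) := ⟨fun a => a.1⟩

/-- The element of the weighted `ℓ¹` space with the given coefficients. -/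
def mk (a : ℤ → A) (h : Summable fun n => ‖a n‖ * ω.w n) : WL ω A := ⟨a, h⟩

@[ext] lemma ext {a b : WL ω A} (h : ∀ n, a n = b n) : a = b := Subtype.ext (funext h)

@[simp] lemma add_apply (a b : WL ω A) (n : ℤ) : (a + b) n = a n + b n := rfl
@[simp] lemma sub_apply (a b : WL ω A) (n : ℤ) : (a - b) n = a n - b n := rfl
@[simp] lemma neg_apply (a : WL ω A) (n : ℤ) : (-a) n = -a n := rfl
@[simp] lemma zero_apply (n : ℤ) : (0 : WL ω A) n = 0 := rfl
@[simp] lemma smul_apply (c : ℂ) (a : WL ω A) (n : ℤ) : (c • a) n = c • a n := rfl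

/-- Coefficients, as a linear map. -/
def coeffL (n : ℤ) : WL ω A →ₗ[ℂ] A where
  toFun a := a n
  map_add' _ _ := rfl
  map_smul' _ _ := rfl

@[simp] lemma sum_apply {ι : Type*} (s : Finset ι) (f : ι → WL ω A) (n : ℤ) :
    (∑ i ∈ s, f i) n = ∑ i ∈ s, f i n := map_sum (coeffL n) f s

lemma summable (a : WL ω A) : Summable fun n => ‖a n‖ * ω.w n := a.2

instance : Norm (WL ω A) := ⟨fun a => ∑' n, ‖a n‖ * ω.w n⟩

lemma norm_def (a : WL ω A) : ‖a‖ = ∑' n, ‖a n‖ * ω.w n := rfl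

lemma term_nonneg (a : WL ω A) (n : ℤ) : 0 ≤ ‖a n‖ * ω.w n :=
  mul_nonneg (norm_nonneg _) (ω.nonneg n)

lemma term_le_norm (a : WL ω A) (n : ℤ) : ‖a n‖ * ω.w n ≤ ‖a‖ :=
  a.summable.le_tsum n fun _ _ => a.term_nonneg _

lemma norm_apply_le (a : WL ω A) (n : ℤ) : ‖a n‖ ≤ ‖a‖ :=
  (le_mul_of_one_le_right (norm_nonneg _) (ω.one_le n)).trans (a.term_le_norm n)

lemma normedSpaceCore : NormedSpace.Core ℂ (WL ω A) where
  norm_nonneg a := tsum_nonneg a.term_nonneg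
  norm_smul c a := by
    rw [norm_def, norm_def, ← tsum_mul_left]
    simp [norm_smul, mul_assoc]
  norm_triangle a b := by
    rw [norm_def, norm_def, norm_def, ← a.summable.tsum_add b.summable]
    refine (a + b).summable.tsum_le_tsum (fun n => ?_) (a.summable.add b.summable)
    rw [← add_mul]
    exact mul_le_mul_of_nonneg_right (norm_add_le _ _) (ω.nonneg n)
  norm_eq_zero_iff a := by
    constructor
    · intro h
      ext n
      have := a.term_le_norm n
      rw [h] at this
      have h2 : ‖a n‖ * ω.w n = 0 := le_antisymm this (a.term_nonneg n)
      simpa [(ω.pos n).ne'] using h2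
    · rintro rfl
      simp [norm_def]

instance : NormedAddCommGroup (WL ω A) := .ofCore normedSpaceCore
instance : NormedSpace ℂ (WL ω A) := .ofCore normedSpaceCore

/-- The isometry onto the unweighted `ℓ¹` space. -/
def toLp (a : WL ω A) : lp (fun _ : ℤ => A) 1 :=
  ⟨fun n => (ω.w n : ℂ) • a n, by
    refine memℓp_gen ?_
    simpa [norm_smul, abs_of_pos (ω.pos _), mul_comm] using a.summable⟩

lemma isometry_toLp : Isometry (toLp : WL ω A → lp (fun _ : ℤ => A) 1) := by
  refine Isometry.of_dist_eq fun a b => ?_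
  rw [dist_eq_norm, dist_eq_norm, lp.norm_eq_tsum_rpow (by simp)]
  simp only [ENNReal.toReal_one, Real.rpow_one, ne_eq, one_ne_zero, not_false_eq_true, div_self,
    norm_def]
  congr 1 with n
  change ‖(ω.w n : ℂ) • a n - (ω.w n : ℂ) • b n‖ = _
  rw [← smul_sub, norm_smul]
  simp [abs_of_pos (ω.pos _), mul_comm]

instance [CompleteSpace A] : CompleteSpace (WL ω A) := by
  have hs : Function.Surjective (toLp : WL ω A → lp (fun _ : ℤ => A) 1) := by
    intro f
    have hf := (lp.memℓp f).summable (by simp)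
    refine ⟨⟨fun n => ((ω.w n : ℂ)⁻¹) • f n, ?_⟩, ?_⟩
    · change Summable _
      refine hf.congr fun n => ?_
      have := (ω.pos n).ne'
      simp [norm_smul, abs_of_pos (ω.pos _)]
      field_simp
    · apply lp.ext
      funext n
      change (ω.w n : ℂ) • ((ω.w n : ℂ)⁻¹) • f n = f n
      rw [smul_inv_smul₀]
      exact_mod_cast (ω.pos n).ne'
  exact (completeSpace_congr (e := Equiv.ofBijective _ ⟨isometry_toLp.injective, hs⟩)
    isometry_toLp.isUniformEmbedding).2 inferInstance

/-! ### Convolution -/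

lemma summable_weight_prod (a b : WL ω A) :
    Summable fun x : ℤ × ℤ => (‖a x.2‖ * ω.w x.2) * (‖b (x.1 - x.2)‖ * ω.w (x.1 - x.2)) := by
  have h := a.summable.mul_of_nonneg b.summable a.term_nonneg b.term_nonneg
  -- The shear (n, m) ↦ (m, n - m) turns a product family into the convolution family.
  let e : ℤ × ℤ ≃ ℤ × ℤ :=
    { toFun := fun x => (x.2, x.1 - x.2)
      invFun := fun y => (y.1 + y.2, y.1)
      left_inv := fun x => by ext <;> simp
      right_inv := fun y => by ext <;> simp }
  exact (e.summable_iff.2 h :)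

lemma norm_mul_term_le (a b : WL ω A) (n m : ℤ) :
    ‖a m * b (n - m)‖ * ω.w n ≤ (‖a m‖ * ω.w m) * (‖b (n - m)‖ * ω.w (n - m)) := by
  have h := ω.add_le m (n - m)
  rw [add_sub_cancel] at h
  calc ‖a m * b (n - m)‖ * ω.w n
      ≤ (‖a m‖ * ‖b (n - m)‖) * (ω.w m * ω.w (n - m)) :=
        mul_le_mul (norm_mul_le _ _) h (ω.nonneg n) (by positivity)
    _ = _ := by ring

lemma summable_norm_conv (a b : WL ω A) (n : ℤ) : Summable fun m => ‖a m * b (n - m)‖ := by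
  refine Summable.of_nonneg_of_le (fun m => norm_nonneg _) (fun m => ?_)
    ((summable_weight_prod a b).prod_factor n)
  exact (le_mul_of_one_le_right (norm_nonneg _) (ω.one_le n)).trans (norm_mul_term_le a b n m)

lemma norm_conv_mul_le (a b : WL ω A) (n : ℤ) :
    ‖∑' m, a m * b (n - m)‖ * ω.w n
      ≤ ∑' m, (‖a m‖ * ω.w m) * (‖b (n - m)‖ * ω.w (n - m)) := by
  calc ‖∑' m, a m * b (n - m)‖ * ω.w n ≤ (∑' m, ‖a m * b (n - m)‖) * ω.w n :=
        mul_le_mul_of_nonneg_right (norm_tsum_le_tsum_norm (summable_norm_conv a b n)) (ω.nonneg n)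
    _ = ∑' m, ‖a m * b (n - m)‖ * ω.w n := tsum_mul_right.symm
    _ ≤ _ := ((summable_norm_conv a b n).mul_right _).tsum_le_tsum (norm_mul_term_le a b n)
        ((summable_weight_prod a b).prod_factor n)

instance : Mul (WL ω A) :=
  ⟨fun a b => ⟨fun n => ∑' m, a m * b (n - m),
    Summable.of_nonneg_of_le (fun n => mul_nonneg (norm_nonneg _) (ω.nonneg n))
      (norm_conv_mul_le a b) (summable_weight_prod a b).prod⟩⟩

lemma mul_apply (a b : WL ω A) (n : ℤ) : (a * b) n = ∑' m, a m * b (n - m) := rfl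

lemma norm_mul_le' (a b : WL ω A) : ‖a * b‖ ≤ ‖a‖ * ‖b‖ := by
  calc ‖a * b‖ ≤ ∑' n, ∑' m, (‖a m‖ * ω.w m) * (‖b (n - m)‖ * ω.w (n - m)) :=
        (a * b).summable.tsum_le_tsum (norm_conv_mul_le a b) (summable_weight_prod a b).prod
    _ = ∑' m, ∑' n, (‖a m‖ * ω.w m) * (‖b (n - m)‖ * ω.w (n - m)) :=
        (Summable.tsum_comm (f := fun n m => (‖a m‖ * ω.w m) * (‖b (n - m)‖ * ω.w (n - m)))
          (summable_weight_prod a b)).symm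
    _ = ∑' m, (‖a m‖ * ω.w m) * ‖b‖ := by
        congr 1 with m
        rw [tsum_mul_left, norm_def]
        congr 1
        exact (Equiv.subRight m).tsum_eq fun n => ‖b n‖ * ω.w n
    _ = ‖a‖ * ‖b‖ := tsum_mul_right

/-- The sequence with the single nonzero coefficient `x` at `k`. -/
def single (k : ℤ) (x : A) : WL ω A :=
  ⟨Pi.single k x, summable_of_ne_finset_zero (s := {k}) fun n hn => by
    simp [Finset.notMem_singleton.1 hn]⟩

lemma coe_single (k : ℤ) (x : A) : ((single k x : WL ω A) : ℤ → A) = Pi.single k x := rfl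

instance : One (WL ω A) := ⟨single 0 1⟩

lemma coe_one : ((1 : WL ω A) : ℤ → A) = Pi.single 0 1 := rfl

lemma single_mul_apply (k : ℤ) (x : A) (b : WL ω A) (n : ℤ) :
    ((single k x : WL ω A) * b) n = x * b (n - k) := by
  rw [mul_apply, tsum_eq_single k]
  · simp [coe_single]
  · intro m hm
    simp [coe_single, hm]

lemma mul_comm' (a b : WL ω A) : a * b = b * a := by
  ext n
  rw [mul_apply, mul_apply, ← (Equiv.subLeft n).tsum_eq]
  congr 1 with m
  simp [mul_comm]

lemma one_mul' (a : WL ω A) : 1 * a = a := by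
  ext n
  change ((single 0 1 : WL ω A) * a) n = _
  rw [single_mul_apply]
  simp

variable [CompleteSpace A]

lemma add_mul' (a b c : WL ω A) : (a + b) * c = a * c + b * c := by
  ext n
  simp only [mul_apply, add_apply, add_mul]
  exact (summable_norm_conv a c n).of_norm.tsum_add (summable_norm_conv b c n).of_norm

lemma mul_assoc' (a b c : WL ω A) : a * b * c = a * (b * c) := by
  ext n
  have h1 : (a * b * c) n = ∑' m, ∑' k, a k * b (m - k) * c (n - m) := by
    rw [mul_apply]
    congr 1 with m
    rw [mul_apply, (summable_norm_conv a b m).of_norm.tsum_mul_right]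
  have h2 : (a * (b * c)) n = ∑' k, ∑' m, a k * b (m - k) * c (n - m) := by
    rw [mul_apply]
    congr 1 with k
    rw [mul_apply, ← (summable_norm_conv b c _).of_norm.tsum_mul_left,
      ← (Equiv.subRight k).tsum_eq]
    congr 1 with m
    simp [mul_assoc]
  rw [h1, h2]
  refine (Summable.tsum_comm (f := fun m k => a k * b (m - k) * c (n - m)) ?_).symm
  refine Summable.of_norm_bounded ((summable_weight_prod a b).mul_right ‖c‖) fun x => ?_
  refine (norm_mul_le _ _).trans ?_
  refine mul_le_mul ?_ (norm_apply_le c _) (norm_nonneg _) (by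
    exact mul_nonneg (a.term_nonneg _) (b.term_nonneg _))
  exact (le_mul_of_one_le_right (norm_nonneg _) (ω.one_le x.1)).trans
    (norm_mul_term_le a b x.1 x.2)

instance : CommRing (WL ω A) :=
  { (inferInstance : AddCommGroup (WL ω A)) with
    mul := (· * ·)
    one := 1
    left_distrib := fun a b c => by
      rw [mul_comm', add_mul', mul_comm' b, mul_comm' c]
    right_distrib := add_mul'
    zero_mul := fun a => by ext n; simp [mul_apply]
    mul_zero := fun a => by ext n; simp [mul_apply]
    mul_assoc := mul_assoc'
    one_mul := one_mul'
    mul_one := fun a => by rw [mul_comm', one_mul']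
    mul_comm := mul_comm' }

instance : NormedCommRing (WL ω A) :=
  { (inferInstance : NormedAddCommGroup (WL ω A)), (inferInstance : CommRing (WL ω A)) with
    norm_mul_le := norm_mul_le' }

lemma smul_mul' (c : ℂ) (a b : WL ω A) : c • a * b = c • (a * b) := by
  ext n
  simp only [mul_apply, smul_apply, smul_mul_assoc]
  exact (summable_norm_conv a b n).of_norm.tsum_const_smul c

instance : Algebra ℂ (WL ω A) :=
  Algebra.ofModule smul_mul' fun c a b => by rw [mul_comm', smul_mul', mul_comm']

instance : NormedAlgebra ℂ (WL ω A) where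
  norm_smul_le c a := (norm_smul c a).le

/-- This is where ω 0 = 1 matters; the bounds on powers below include the zeroth power. -/
instance [NormOneClass A] : NormOneClass (WL ω A) where
  norm_one := by
    rw [norm_def, tsum_eq_single 0]
    · simp [coe_one, ω.zero]
    · intro n hn
      simp [coe_one, hn]

/-! ### Change of coefficients -/

section map

variable {A' : Type*} [NormedCommRing A'] [NormedAlgebra ℂ A'] [CompleteSpace A']

/-- The map of weighted `ℓ¹` algebras induced by a contractive map of coefficients. -/
def map (φ : A →ₐ[ℂ] A') (hφ : ∀ x, ‖φ x‖ ≤ ‖x‖) : WL ω A →ₐ[ℂ] WL ω A' :=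
  AlgHom.ofLinearMap
    { toFun := fun a => ⟨fun n => φ (a n),
        Summable.of_nonneg_of_le (fun n => mul_nonneg (norm_nonneg _) (ω.nonneg n))
          (fun n => mul_le_mul_of_nonneg_right (hφ _) (ω.nonneg n)) a.summable⟩
      map_add' := fun a b => by ext n; exact map_add φ _ _
      map_smul' := fun c a => by ext n; exact map_smul φ _ _ }
    (by
      ext n
      change φ ((Pi.single 0 1 : ℤ → A) n) = (Pi.single 0 1 : ℤ → A') n
      by_cases h : n = 0 <;> simp [h])
    (fun a b => by
      ext n
      have hc : Continuous φ :=
        AddMonoidHomClass.continuous_of_bound φ 1 (by simpa using hφ)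
      change φ (∑' m, a m * b (n - m)) = ∑' m, φ (a m) * φ (b (n - m))
      rw [(summable_norm_conv a b n).of_norm.map_tsum φ hc]
      simp)

end map

end WL

/-! ### Polynomials in normed algebras -/

section Taylor

variable {R : Type*} [NormedCommRing R] [NormedAlgebra ℂ R]

/-- Evaluation of a real polynomial in a complex algebra. -/
def papp (p : Polynomial ℝ) (a : R) : R := Polynomial.aeval a (p.map (algebraMap ℝ ℂ))

lemma papp_eq_sum (p : Polynomial ℝ) (a : R) :
    papp p a = ∑ k ∈ p.support, (p.coeff k : ℂ) • a ^ k := by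
  rw [papp, Polynomial.aeval_def, Polynomial.eval₂_map, Polynomial.eval₂_eq_sum,
    Polynomial.sum_def]
  refine Finset.sum_congr rfl fun k _ => ?_
  rw [RingHom.comp_apply, Algebra.smul_def]
  rfl

lemma papp_derivative (p : Polynomial ℝ) (a : R) :
    papp (Polynomial.derivative p) a =
      ∑ k ∈ p.support, (p.coeff k : ℂ) • ((k : ℂ) • a ^ (k - 1)) := by
  rw [papp, Polynomial.derivative_apply, Polynomial.sum_def, Polynomial.map_sum, map_sum]
  refine Finset.sum_congr rfl fun k _ => ?_
  simp [Algebra.smul_def, mul_assoc]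

lemma map_papp {R' : Type*} [NormedCommRing R'] [NormedAlgebra ℂ R'] (φ : R →ₐ[ℂ] R')
    (p : Polynomial ℝ) (a : R) : φ (papp p a) = papp p (φ a) :=
  (Polynomial.aeval_algHom_apply φ a _).symm

lemma continuous_papp (p : Polynomial ℝ) : Continuous (papp p : R → R) :=
  Polynomial.continuous_aeval _

/-- The factor in the remainder of the first-order expansion of `p` with slope taken at `c`. -/
def taylorFactor (p : Polynomial ℝ) (a b c : R) : R :=
  ∑ k ∈ p.support, (p.coeff k : ℂ) •
    ∑ i ∈ Finset.range k, (a ^ i * b ^ (k - 1 - i) - c ^ (k - 1))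

/-- The slope is taken at a third point c, since the linearization is available only at ubar. The
identity is a^k - b^k = (∑ a^i b^(k-1-i)) (a - b), with k c^(k-1) split off from the sum. -/
lemma papp_sub_papp (p : Polynomial ℝ) (a b c : R) :
    papp p a - papp p b =
      papp (Polynomial.derivative p) c * (a - b) + taylorFactor p a b c * (a - b) := by
  rw [papp_eq_sum, papp_eq_sum, papp_derivative, taylorFactor, ← add_mul, ← Finset.sum_add_distrib,
    ← Finset.sum_sub_distrib, Finset.sum_mul]
  refine Finset.sum_congr rfl fun k _ => ?_
  rw [← smul_add, ← smul_sub, Finset.sum_sub_distrib, smul_mul_assoc, ← geom_sum₂_mul]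
  congr 2
  simp [Algebra.smul_def]

variable [NormOneClass R]

omit [NormedAlgebra ℂ R] in
lemma norm_pow_sub_pow_le {a c : R} {M r : ℝ} (ha : ‖a‖ ≤ M) (hc : ‖c‖ ≤ M)
    (hr : ‖a - c‖ ≤ r) (i : ℕ) : ‖a ^ i - c ^ i‖ ≤ i * M ^ (i - 1) * r := by
  have hM : 0 ≤ M := (norm_nonneg a).trans ha
  rw [← geom_sum₂_mul]
  refine (norm_mul_le _ _).trans (mul_le_mul ?_ hr (norm_nonneg _) (by positivity))
  calc _ ≤ ∑ j ∈ Finset.range i, M ^ (i - 1) := by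
        refine (norm_sum_le _ _).trans (Finset.sum_le_sum fun j hj => ?_)
        have hj' : j + (i - 1 - j) = i - 1 := by have := Finset.mem_range.1 hj; omega
        calc ‖a ^ j * c ^ (i - 1 - j)‖ ≤ ‖a‖ ^ j * ‖c‖ ^ (i - 1 - j) :=
              (norm_mul_le _ _).trans (mul_le_mul (norm_pow_le _ _) (norm_pow_le _ _)
                (norm_nonneg _) (by positivity))
          _ ≤ M ^ j * M ^ (i - 1 - j) := by gcongr
          _ = M ^ (i - 1) := by rw [← pow_add, hj']
    _ = _ := by simp

omit [NormedAlgebra ℂ R] in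
lemma norm_pow_mul_pow_sub_le {a b c : R} {M ra rb : ℝ} (ha : ‖a‖ ≤ M) (hb : ‖b‖ ≤ M)
    (hc : ‖c‖ ≤ M) (hra : ‖a - c‖ ≤ ra) (hrb : ‖b - c‖ ≤ rb) (i j : ℕ) :
    ‖a ^ i * b ^ j - c ^ (i + j)‖ ≤ (i * ra + j * rb) * M ^ (i + j - 1) := by
  have hM : 0 ≤ M := (norm_nonneg a).trans ha
  have hra0 : 0 ≤ ra := (norm_nonneg _).trans hra
  have hrb0 : 0 ≤ rb := (norm_nonneg _).trans hrb
  have e : a ^ i * b ^ j - c ^ (i + j) = (a ^ i - c ^ i) * b ^ j + c ^ i * (b ^ j - c ^ j) := by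
    ring
  have h1 : ‖(a ^ i - c ^ i) * b ^ j‖ ≤ (i * M ^ (i - 1) * ra) * M ^ j :=
    (norm_mul_le _ _).trans (mul_le_mul (norm_pow_sub_pow_le ha hc hra i)
      ((norm_pow_le _ _).trans (by gcongr)) (norm_nonneg _) (by positivity))
  have h2 : ‖c ^ i * (b ^ j - c ^ j)‖ ≤ M ^ i * (j * M ^ (j - 1) * rb) :=
    (norm_mul_le _ _).trans (mul_le_mul ((norm_pow_le _ _).trans (by gcongr))
      (norm_pow_sub_pow_le hb hc hrb j) (norm_nonneg _) (by positivity))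
  rw [e]
  refine (norm_add_le _ _).trans ((add_le_add h1 h2).trans_eq ?_)
  -- The truncated exponents i - 1 and j - 1 occur only next to the factors i and j, so the zero
  -- cases are harmless.
  rcases i with _ | i <;> rcases j with _ | j
  · simp
  · simp; ring
  · simp; ring
  · have : i + 1 + (j + 1) - 1 = i + j + 1 := by omega
    rw [this]
    simp only [add_tsub_cancel_right]
    ring

lemma absPoly_eval (q : Polynomial ℝ) (x : ℝ) {N : ℕ} (hN : q.natDegree < N) :
    (absPoly q).eval x = ∑ k ∈ Finset.range N, |q.coeff k| * x ^ k := by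
  rw [absPoly, Polynomial.eval_finsetSum]
  simp only [Polynomial.eval_monomial]
  refine Finset.sum_subset (fun k hk => ?_) fun k _ hk => ?_
  · exact Finset.mem_range.2 ((Polynomial.le_natDegree_of_mem_supp k hk).trans_lt hN)
  · simp [Polynomial.notMem_support_iff.1 hk]

lemma absPoly_derivative_derivative_eval (p : Polynomial ℝ) (x : ℝ) :
    (absPoly (Polynomial.derivative (Polynomial.derivative p))).eval x =
      ∑ k ∈ p.support, |p.coeff k| * (k * (k - 1 : ℕ)) * x ^ (k - 2) := by
  have hN : (Polynomial.derivative (Polynomial.derivative p)).natDegree < p.natDegree + 1 := by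
    have h1 := Polynomial.natDegree_derivative_le p
    have h2 := Polynomial.natDegree_derivative_le (Polynomial.derivative p)
    omega
  obtain ⟨N, hN'⟩ : ∃ N, N = p.natDegree + 1 := ⟨_, rfl⟩
  rw [← hN'] at hN
  rw [absPoly_eval _ _ hN]
  have h : ∑ k ∈ p.support, |p.coeff k| * ((k : ℝ) * (k - 1 : ℕ)) * x ^ (k - 2) =
      ∑ k ∈ Finset.range (N + 2),
        |p.coeff k| * ((k : ℝ) * (k - 1 : ℕ)) * x ^ (k - 2) := by
    refine Finset.sum_subset (fun k hk => ?_) fun k _ hk => ?_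
    · have := Polynomial.le_natDegree_of_mem_supp k hk
      exact Finset.mem_range.2 (by omega)
    · simp [Polynomial.notMem_support_iff.1 hk]
  -- The terms k = 0, 1 contain k(k-1) = 0, which makes the truncated exponent k - 2 harmless; the
  -- others are shifted by two.
  rw [h, Finset.sum_range_succ', Finset.sum_range_succ', add_assoc]
  refine ((Finset.sum_congr rfl fun k _ => ?_).trans (add_zero _).symm).trans
    (congrArg₂ (· + ·) rfl (by simp))
  rw [Polynomial.coeff_derivative, Polynomial.coeff_derivative, abs_mul, abs_mul]
  have e1 : k + 1 + 1 - 1 = k + 1 := by omega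
  have e2 : k + 1 + 1 - 2 = k := by omega
  rw [e1, e2, abs_of_nonneg (by positivity : (0 : ℝ) ≤ ((k + 1 : ℕ) : ℝ) + 1),
    abs_of_nonneg (by positivity : (0 : ℝ) ≤ (k : ℝ) + 1)]
  push_cast
  ring

lemma sum_range_mul_add (k : ℕ) (x y : ℝ) :
    ∑ i ∈ Finset.range k, (i * x + (k - 1 - i : ℕ) * y) = k * (k - 1 : ℕ) / 2 * (x + y) := by
  have h1 : ∑ i ∈ Finset.range k, (i : ℝ) = k * (k - 1 : ℕ) / 2 := by
    have := Finset.sum_range_id_mul_two k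
    have h : ((∑ i ∈ Finset.range k, i : ℕ) : ℝ) * 2 = (k * (k - 1 : ℕ) : ℝ) := by
      exact_mod_cast this
    push_cast at h ⊢
    linarith
  have h2 : ∑ i ∈ Finset.range k, ((k - 1 - i : ℕ) : ℝ) = k * (k - 1 : ℕ) / 2 := by
    rw [← h1]
    exact Finset.sum_range_reflect (fun i => (i : ℝ)) k
  rw [Finset.sum_add_distrib, ← Finset.sum_mul, ← Finset.sum_mul, h1, h2]
  ring

/-- The k summands deviate by at most (i ra + (k-1-i) rb) M^(k-2), and their sum produces k(k-1),
the second derivative, times the mean of the radii. With rb = 0 this is the source of the factor 1/2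
before W r² in the existence condition; with ra = rb = r it gives the contraction constant. -/
lemma norm_taylorFactor_le (p : Polynomial ℝ) {a b c : R} {M ra rb : ℝ} (ha : ‖a‖ ≤ M)
    (hb : ‖b‖ ≤ M) (hc : ‖c‖ ≤ M) (hra : ‖a - c‖ ≤ ra) (hrb : ‖b - c‖ ≤ rb) :
    ‖taylorFactor p a b c‖ ≤
      (absPoly (Polynomial.derivative (Polynomial.derivative p))).eval M * ((ra + rb) / 2) := by
  rw [taylorFactor, absPoly_derivative_derivative_eval, Finset.sum_mul]
  refine (norm_sum_le _ _).trans (Finset.sum_le_sum fun k _ => ?_)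
  rw [norm_smul, Complex.norm_real, Real.norm_eq_abs, mul_assoc, mul_assoc]
  refine mul_le_mul_of_nonneg_left ?_ (abs_nonneg _)
  calc _ ≤ ∑ i ∈ Finset.range k, (i * ra + (k - 1 - i : ℕ) * rb) * M ^ (k - 2) := by
        refine (norm_sum_le _ _).trans (Finset.sum_le_sum fun i hi => ?_)
        have e : i + (k - 1 - i) = k - 1 := by have := Finset.mem_range.1 hi; omega
        have := norm_pow_mul_pow_sub_le ha hb hc hra hrb i (k - 1 - i)
        rwa [e, show k - 1 - 1 = k - 2 by omega] at this
    _ = _ := by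
        rw [← Finset.sum_mul, sum_range_mul_add]
        ring

end Taylor

/-! ### Fourier coefficients of polynomial expressions, evaluation and constants -/

namespace WL

variable {ω : Weight}

lemma coe_pow_eq_convPow (a : WL ω ℂ) (k : ℕ) : ((a ^ k : WL ω ℂ) : ℤ → ℂ) = convPow a k := by
  induction k with
  | zero => rw [pow_zero]; rfl
  | succ k ih => rw [pow_succ', convPow, ← ih]; rfl

lemma coe_papp (p : Polynomial ℝ) (a : WL ω ℂ) : ((papp p a : WL ω ℂ) : ℤ → ℂ) = polySeq p a := by
  funext n
  rw [papp_eq_sum, sum_apply, polySeq]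
  simp only [smul_apply, smul_eq_mul, coe_pow_eq_convPow]

variable {X : Type*} [TopologicalSpace X]

/-- Evaluation at a point of sequences of bounded continuous functions. -/
def at' (t : X) : WL ω (BoundedContinuousFunction X ℂ) →ₐ[ℂ] WL ω ℂ :=
  map
    { toFun := fun f => f t
      map_one' := rfl
      map_mul' := fun _ _ => rfl
      map_zero' := rfl
      map_add' := fun _ _ => rfl
      commutes' := fun _ => rfl } fun f => f.norm_coe_le_norm t

@[simp] lemma at'_apply (t : X) (a : WL ω (BoundedContinuousFunction X ℂ)) (n : ℤ) :
    at' t a n = a n t := rfl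

variable [Nonempty X]

/-- Sequences of constant functions. -/
def const (X : Type*) [TopologicalSpace X] [Nonempty X] (a : WL ω ℂ) :
    WL ω (BoundedContinuousFunction X ℂ) :=
  map (Algebra.ofId ℂ _) (fun x => (norm_algebraMap' _ x).le) a

@[simp] lemma const_apply (a : WL ω ℂ) (n : ℤ) (t : X) : const X a n t = a n := by
  change (algebraMap ℂ (BoundedContinuousFunction X ℂ) (a n)) t = _
  simp

@[simp] lemma at'_const (t : X) (a : WL ω ℂ) : at' t (const X a) = a := by
  ext n
  simp

lemma norm_const (a : WL ω ℂ) : ‖const X a‖ = ‖a‖ := by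
  rw [norm_def, norm_def]
  congr 1 with n
  congr 1
  exact norm_algebraMap' _ (a n)

lemma const_sub (a b : WL ω ℂ) : const X a - const X b = const X (a - b) := (map_sub _ a b).symm

end WL

/-! ### The norm of `ℓ¹_ν` -/

/-- The weight `ν ^ |n|`. -/
def geomWeight (ν : ℝ) (hν : 1 ≤ ν) : Weight where
  w n := ν ^ n.natAbs
  one_le n := one_le_pow₀ hν
  zero := by simp
  add_le m n := by
    rw [← pow_add]
    exact pow_le_pow_right₀ hν (Int.natAbs_add_le m n)

section l1

variable {ν : ℝ}

lemma l1norm_mono {a b : Seq} (hν : 0 ≤ ν) (h : ∀ n, ‖a n‖ ≤ ‖b n‖) :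
    l1norm ν a ≤ l1norm ν b :=
  ENNReal.tsum_le_tsum fun n => ENNReal.ofReal_le_ofReal
    (mul_le_mul_of_nonneg_right (h n) (pow_nonneg hν _))

lemma l1norm_add_le (hν : 0 ≤ ν) (a b : Seq) : l1norm ν (a + b) ≤ l1norm ν a + l1norm ν b := by
  rw [l1norm, l1norm, l1norm, ← ENNReal.tsum_add]
  refine ENNReal.tsum_le_tsum fun n => ?_
  rw [← ENNReal.ofReal_add (by positivity) (by positivity), ← add_mul]
  exact ENNReal.ofReal_le_ofReal
    (mul_le_mul_of_nonneg_right (norm_add_le _ _) (pow_nonneg hν _))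

@[simp] lemma l1norm_zero : l1norm ν 0 = 0 := by simp [l1norm]

lemma l1norm_sum_le (hν : 0 ≤ ν) {ι : Type*} (s : Finset ι) (f : ι → Seq) :
    l1norm ν (∑ i ∈ s, f i) ≤ ∑ i ∈ s, l1norm ν (f i) := by
  classical
  induction s using Finset.induction_on with
  | empty => simp
  | insert i s hi ih =>
    rw [Finset.sum_insert hi, Finset.sum_insert hi]
    exact (l1norm_add_le hν _ _).trans (add_le_add le_rfl ih)

lemma l1norm_absSeq (a : Seq) : l1norm ν (absSeq a) = l1norm ν a := by
  simp [l1norm, absSeq]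

lemma l1norm_sub_comm (a b : Seq) : l1norm ν (a - b) = l1norm ν (b - a) := by
  simp only [l1norm, Pi.sub_apply, norm_sub_rev]

lemma eq_zero_of_l1norm_eq_zero (hν : 0 < ν) {a : Seq} (h : l1norm ν a = 0) : a = 0 := by
  funext n
  have h1 := ENNReal.tsum_eq_zero.1 h n
  have h2 : ‖a n‖ * ν ^ n.natAbs ≤ 0 := ENNReal.ofReal_eq_zero.1 h1
  have h3 : 0 < ν ^ n.natAbs := pow_pos hν _
  have h4 : ‖a n‖ ≤ 0 := by
    by_contra hc
    push Not at hc
    exact absurd (mul_pos hc h3) (not_lt.2 h2)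
  simpa using h4

/-- The condition `T 0 = 0` handles a = 0, where the right-hand side is 0 even if the operator norm
is infinite. For a ≠ 0, division reduces the claim to the defining property of the infimum. -/
lemma l1norm_le_opNorm {T : Seq → Seq} (hT : T 0 = 0) (hν : 0 < ν) {a : Seq} (ha : MemL1 ν a) :
    l1norm ν (T a) ≤ opNorm ν T * l1norm ν a := by
  by_cases h0 : l1norm ν a = 0
  · rw [eq_zero_of_l1norm_eq_zero hν h0, hT]
    simp
  · rw [← ENNReal.div_le_iff h0 ha.ne]
    refine le_sInf fun C hC => ?_
    rw [ENNReal.div_le_iff h0 ha.ne]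
    exact hC a ha

variable {hν : 1 ≤ ν}

/-- An element of the weighted `ℓ¹` space has norm `l1norm` of any sequence of moduli. -/
lemma l1norm_norm_coe {A : Type*} [NormedCommRing A] [NormedAlgebra ℂ A]
    (a : WL (geomWeight ν hν) A) : l1norm ν (fun n => ((‖a n‖ : ℝ) : ℂ)) = ENNReal.ofReal ‖a‖ := by
  rw [WL.norm_def, ENNReal.ofReal_tsum_of_nonneg a.term_nonneg a.summable]
  simp [l1norm, geomWeight]

lemma l1norm_coe (a : WL (geomWeight ν hν) ℂ) : l1norm ν a = ENNReal.ofReal ‖a‖ := by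
  rw [← l1norm_norm_coe, ← l1norm_absSeq]
  rfl

lemma memL1_coe (a : WL (geomWeight ν hν) ℂ) : MemL1 ν a := by
  rw [MemL1, l1norm_coe]
  exact ENNReal.ofReal_lt_top

lemma MemL1.summable (hν : 0 ≤ ν) {a : Seq} (h : MemL1 ν a) :
    Summable fun n => ‖a n‖ * ν ^ n.natAbs := by
  have := ENNReal.summable_toReal h.ne
  refine this.congr fun n => ?_
  exact ENNReal.toReal_ofReal (by positivity)

/-- A sequence in `ℓ¹_ν` as an element of the Banach algebra. -/
def ofMem (hν : 1 ≤ ν) (a : Seq) (h : MemL1 ν a) : WL (geomWeight ν hν) ℂ :=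
  WL.mk a (h.summable (zero_le_one.trans hν))

@[simp] lemma coe_ofMem (a : Seq) (h : MemL1 ν a) :
    ((ofMem hν a h : WL (geomWeight ν hν) ℂ) : Seq) = a := rfl

end l1

/-! ### Block operators -/

section block

variable {N : ℕ} (M : Matrix (Modes N) (Modes N) ℂ)

lemma mem_Icc_iff_natAbs {N : ℕ} {n : ℤ} :
    n ∈ Finset.Icc (-(N : ℤ)) (N : ℤ) ↔ n.natAbs ≤ N := by
  rw [Finset.mem_Icc]
  omega

/-- `blockOp` as a linear map. -/
def blockOpL : Seq →ₗ[ℂ] Seq where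
  toFun := blockOp N M
  map_add' a b := by
    funext n
    by_cases h : n ∈ Finset.Icc (-(N : ℤ)) (N : ℤ)
    · simp only [blockOp, h, dif_pos, Pi.add_apply, mul_add, Finset.sum_add_distrib]
    · simp only [blockOp, h, dif_neg, Pi.add_apply, not_false_eq_true]
  map_smul' c a := by
    funext n
    by_cases h : n ∈ Finset.Icc (-(N : ℤ)) (N : ℤ)
    · simp only [blockOp, h, dif_pos, Pi.smul_apply, smul_eq_mul, Finset.mul_sum, RingHom.id_apply]
      exact Finset.sum_congr rfl fun _ _ => by ring
    · simp only [blockOp, h, dif_neg, Pi.smul_apply, not_false_eq_true, RingHom.id_apply]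

lemma blockOp_eq_self {a : Seq} (h : ∀ n : ℤ, n.natAbs ≤ N → a n = 0) : blockOp N M a = a := by
  funext n
  by_cases hn : n ∈ Finset.Icc (-(N : ℤ)) (N : ℤ)
  · simp only [blockOp, hn, dif_pos]
    rw [h n (mem_Icc_iff_natAbs.1 hn)]
    exact Finset.sum_eq_zero fun k _ => by rw [h k (mem_Icc_iff_natAbs.1 k.2), mul_zero]
  · simp only [blockOp, hn, dif_neg, not_false_eq_true]

lemma blockOp_blockOp (M' : Matrix (Modes N) (Modes N) ℂ) (a : Seq) :
    blockOp N M (blockOp N M' a) = blockOp N (M * M') a := by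
  funext n
  by_cases hn : n ∈ Finset.Icc (-(N : ℤ)) (N : ℤ)
  · simp only [blockOp, hn, dif_pos, Matrix.mul_apply, Finset.sum_mul]
    rw [Finset.sum_comm]
    refine Finset.sum_congr rfl fun k _ => ?_
    rw [dif_pos k.2, Finset.mul_sum]
    exact Finset.sum_congr rfl fun _ _ => by ring
  · simp only [blockOp, hn, dif_neg, not_false_eq_true]

lemma blockOp_one (a : Seq) : blockOp N (1 : Matrix (Modes N) (Modes N) ℂ) a = a := by
  funext n
  by_cases hn : n ∈ Finset.Icc (-(N : ℤ)) (N : ℤ)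
  · simp [blockOp, hn, Matrix.one_apply]
  · simp only [blockOp, hn, dif_neg, not_false_eq_true]

open scoped ComplexOrder

lemma blockOp_absMat_nonneg {a : Seq} (h : 0 ≤ a) : 0 ≤ blockOp N (absMat M) a := by
  intro n
  by_cases hn : n ∈ Finset.Icc (-(N : ℤ)) (N : ℤ)
  · simp only [blockOp, hn, dif_pos, absMat, Matrix.map_apply, Pi.zero_apply]
    exact Finset.sum_nonneg fun k _ => mul_nonneg (by simp) (h k)
  · simp only [blockOp, hn, dif_neg, not_false_eq_true]
    exact h n

lemma absSeq_eq_self {a : Seq} (h : 0 ≤ a) : absSeq a = a :=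
  funext fun n => RCLike.norm_of_nonneg' (h n)

/-- The triangle inequality in each row; this is the passage from Q and Q⁻¹ to their entry-wise
absolute values. -/
lemma norm_blockOp_le {a : Seq} {c : ℤ → ℝ} (h : ∀ n, ‖a n‖ ≤ c n) (n : ℤ) :
    ‖blockOp N M a n‖ ≤ ‖blockOp N (absMat M) (fun n => (c n : ℂ)) n‖ := by
  by_cases hn : n ∈ Finset.Icc (-(N : ℤ)) (N : ℤ)
  · simp only [blockOp, hn, dif_pos, absMat, Matrix.map_apply]
    have e : ∑ k : Modes N, ((‖M ⟨n, hn⟩ k‖ : ℝ) : ℂ) * (c k : ℂ)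
        = ((∑ k : Modes N, ‖M ⟨n, hn⟩ k‖ * c k : ℝ) : ℂ) := by push_cast; rfl
    rw [e, Complex.norm_real]
    refine (norm_sum_le _ _).trans (le_trans (Finset.sum_le_sum fun k _ => ?_) (le_abs_self _))
    rw [norm_mul]
    exact mul_le_mul_of_nonneg_left (h k) (norm_nonneg _)
  · simp only [blockOp, hn, dif_neg, not_false_eq_true]
    rw [Complex.norm_real]
    exact (h n).trans (le_abs_self _)

end block

lemma rhs_apply {ω : Weight} {J : ℕ} {g : ℕ → Polynomial ℝ} (a : WL ω ℂ) (n : ℤ) :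
    rhs J g a n = (-1) ^ (J + 1) * ((Complex.I * n) ^ (2 * J) * a n) +
      ∑ j ∈ Finset.range (2 * J), (Complex.I * n) ^ j * papp (g j) a n := by
  simp only [rhs, Dpow, WL.coe_papp]

/-! ### Linearity of the operators of a `Setup` -/

namespace Setup

variable (S : Setup)

/-- `Q` as a linear map. -/
def QL : Seq →ₗ[ℂ] Seq := blockOpL S.QN

/-- `Q⁻¹` as a linear map. -/
def QinvL : Seq →ₗ[ℂ] Seq := blockOpL S.QN⁻¹

/-- Multiplication by a sequence, as a linear map. -/
def diagL (d : Seq) : Seq →ₗ[ℂ] Seq where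
  toFun a := fun n => d n * a n
  map_add' a b := by funext n; exact mul_add _ _ _
  map_smul' c a := by funext n; simp only [Pi.smul_apply, smul_eq_mul, RingHom.id_apply]; ring

/-- `L` as a linear map. -/
def LL : Seq →ₗ[ℂ] Seq := S.QL ∘ₗ diagL S.lam ∘ₗ S.QinvL

/-- `L⁻¹` as a linear map. -/
def LinvL : Seq →ₗ[ℂ] Seq := S.QL ∘ₗ diagL (fun n => (S.lam n)⁻¹) ∘ₗ S.QinvL

/-- `B` as a linear map. -/
def BL : Seq →ₗ[ℂ] Seq :=
  blockOpL (absMat S.QN) ∘ₗ diagL fun n => ((|((S.lam n).re)⁻¹| : ℝ) : ℂ)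

lemma QL_apply (a : Seq) : S.QL a = S.Q a := rfl
lemma LinvL_apply (a : Seq) : S.LinvL a = S.Linv a := rfl
variable {S}

lemma Q_Qinv (hQ : IsUnit S.QN) (a : Seq) : S.Q (S.Qinv a) = a := by
  rw [Q, Qinv, blockOp_blockOp, Matrix.mul_nonsing_inv _ ((Matrix.isUnit_iff_isUnit_det _).1 hQ),
    blockOp_one]

lemma Qinv_Q (hQ : IsUnit S.QN) (a : Seq) : S.Qinv (S.Q a) = a := by
  rw [Q, Qinv, blockOp_blockOp, Matrix.nonsing_inv_mul _ ((Matrix.isUnit_iff_isUnit_det _).1 hQ),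
    blockOp_one]

lemma L_Linv (hQ : IsUnit S.QN) (hlam : ∀ n, S.lam n ≠ 0) (a : Seq) : S.L (S.Linv a) = a := by
  rw [L, Linv, Qinv_Q hQ]
  simp only [mul_inv_cancel_left₀ (hlam _)]
  exact Q_Qinv hQ a

lemma Linv_L (hQ : IsUnit S.QN) (hlam : ∀ n, S.lam n ≠ 0) (a : Seq) : S.Linv (S.L a) = a := by
  rw [L, Linv, Qinv_Q hQ]
  simp only [inv_mul_cancel_left₀ (hlam _)]
  exact Q_Qinv hQ a

open scoped ComplexOrder

/-! ### Expansion of the nonlinearity -/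

section expansion

variable {hν : 1 ≤ S.ν}

lemma dgam_apply (hubar : MemL1 S.ν S.ubar) (h : WL (geomWeight S.ν hν) ℂ) (n : ℤ) :
    S.dgam h n = (-1) ^ (S.J + 1) * ((Complex.I * n) ^ (2 * S.J) * h n) +
      ∑ j ∈ Finset.range (2 * S.J), (Complex.I * n) ^ j *
        (papp (Polynomial.derivative (S.g j)) (ofMem hν S.ubar hubar) * h) n - S.L h n := by
  simp only [dgam, Pi.sub_apply, Dpow, gPrime]
  congr 2
  refine Finset.sum_congr rfl fun j _ => ?_
  congr 1
  change conv _ _ n = conv _ _ n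
  rw [WL.coe_papp, coe_ofMem]

/-- The linear terms of γ enter Dγ(ubar) unchanged, so only the polynomials leave a remainder, and
it remains a product in the algebra. -/
lemma gam_sub_gam (hubar : MemL1 S.ν S.ubar) (a b : WL (geomWeight S.ν hν) ℂ) :
    S.gam a - S.gam b = S.dgam (a - b : WL (geomWeight S.ν hν) ℂ) +
      ∑ j ∈ Finset.range (2 * S.J),
        Dpow j (taylorFactor (S.g j) a b (ofMem hν S.ubar hubar) * (a - b) :
          WL (geomWeight S.ν hν) ℂ) := by
  have hL : S.L (a - b : WL (geomWeight S.ν hν) ℂ) = S.L a - S.L b := map_sub S.LL _ _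
  funext n
  simp only [gam, Pi.sub_apply, Pi.add_apply, Finset.sum_apply, dgam_apply hubar, rhs_apply, hL,
    Dpow, WL.sub_apply]
  have e : ∑ j ∈ Finset.range (2 * S.J), (Complex.I * n) ^ j * papp (S.g j) a n =
      ∑ j ∈ Finset.range (2 * S.J), (Complex.I * n) ^ j * papp (S.g j) b n +
      ∑ j ∈ Finset.range (2 * S.J), (Complex.I * n) ^ j *
        (papp (Polynomial.derivative (S.g j)) (ofMem hν S.ubar hubar) * (a - b)) n +
      ∑ j ∈ Finset.range (2 * S.J), (Complex.I * n) ^ j *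
        (taylorFactor (S.g j) a b (ofMem hν S.ubar hubar) * (a - b)) n := by
    rw [← Finset.sum_add_distrib, ← Finset.sum_add_distrib]
    refine Finset.sum_congr rfl fun j _ => ?_
    have := congrArg (fun x : WL (geomWeight S.ν hν) ℂ => x n)
      (papp_sub_papp (S.g j) a b (ofMem hν S.ubar hubar))
    simp only [WL.sub_apply, WL.add_apply] at this
    rw [← mul_add, ← mul_add, add_assoc, ← this]
    ring
  rw [e]
  ring

/-- `Q⁻¹ Dγ(ubar)` as a linear map on the Banach algebra. -/
def QinvDgamL (hν : 1 ≤ S.ν) (hubar : MemL1 S.ν S.ubar) : WL (geomWeight S.ν hν) ℂ →ₗ[ℂ] Seq :=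
  S.QinvL ∘ₗ
  { toFun := fun h => S.dgam h
    map_add' := fun a b => by
      have hL : S.L (a + b : WL (geomWeight S.ν hν) ℂ) = S.L a + S.L b := map_add S.LL _ _
      funext n
      simp only [Pi.add_apply, dgam_apply hubar, hL, mul_add, WL.add_apply,
        Finset.sum_add_distrib]
      ring
    map_smul' := fun c a => by
      have hL : S.L (c • a : WL (geomWeight S.ν hν) ℂ) = c • S.L a := map_smul S.LL _ _
      funext n
      simp only [dgam_apply hubar, hL, mul_smul_comm, WL.smul_apply, smul_eq_mul,
        Pi.smul_apply, RingHom.id_apply, mul_sub, mul_add, Finset.mul_sum]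
      congr 1
      congr 1
      · ring
      · exact Finset.sum_congr rfl fun _ _ => by ring }

lemma QinvDgamL_apply (hubar : MemL1 S.ν S.ubar) (h : WL (geomWeight S.ν hν) ℂ) :
    QinvDgamL hν hubar h = S.Qinv (S.dgam h) := rfl

end expansion

end Setup

lemma absPoly_eval_mono (q : Polynomial ℝ) {x y : ℝ} (hx : 0 ≤ x) (hxy : x ≤ y) :
    (absPoly q).eval x ≤ (absPoly q).eval y := by
  rw [absPoly_eval q x (Nat.lt_succ_self _), absPoly_eval q y (Nat.lt_succ_self _)]
  gcongr

lemma absPoly_eval_nonneg (q : Polynomial ℝ) {x : ℝ} (hx : 0 ≤ x) : 0 ≤ (absPoly q).eval x := by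
  rw [absPoly_eval q x (Nat.lt_succ_self _)]
  exact Finset.sum_nonneg fun _ _ => by positivity

lemma eq_zero_of_absPoly_eval_eq_zero {q : Polynomial ℝ} {x : ℝ} (hx : 0 < x)
    (h : (absPoly q).eval x = 0) : q = 0 := by
  rw [absPoly_eval q x (Nat.lt_succ_self _),
    Finset.sum_eq_zero_iff_of_nonneg fun _ _ => by positivity] at h
  by_contra hq
  have := h q.natDegree (Finset.self_mem_range_succ _)
  simp [hx.ne', hq] at this

lemma absPoly_zero_eval (x : ℝ) : (absPoly 0).eval x = 0 := by simp [absPoly]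

lemma leading_coeff (J : ℕ) (n : ℤ) :
    (-1 : ℂ) ^ (J + 1) * (Complex.I * n) ^ (2 * J) = -(n : ℂ) ^ (2 * J) := by
  rw [mul_pow, pow_mul Complex.I, Complex.I_sq, ← mul_assoc, ← pow_add]
  have : (-1 : ℂ) ^ (J + 1 + J) = -1 := by
    rw [show J + 1 + J = 2 * J + 1 by ring, pow_succ, pow_mul]
    simp
  rw [this, neg_one_mul]

/-! ### The bounds `Z` and `W`, mode by mode -/

namespace Setup

variable {S : Setup}

open scoped ComplexOrder

/-- The operators whose norms enter `W` are not zero, as they act diagonally beyond the finite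
block. -/
lemma opNorm_ne_zero (hν : 1 ≤ S.ν) (hlam : ∀ n : ℤ, (S.lam n).re < 0) (j : ℕ) :
    opNorm S.ν (fun a => S.B (S.absQinv (absDpow j a))) ≠ 0 := by
  intro h0
  -- The first mode outside the block: Q and Q⁻¹ act on it as the identity, and k ≠ 0 keeps |k|^j
  -- nonzero.
  set k : ℤ := (S.NL : ℤ) + 1 with hk
  have hkN : ¬ k.natAbs ≤ S.NL := by omega
  have hkn : ∀ n : ℤ, n.natAbs ≤ S.NL → n ≠ k := by rintro n hn rfl; exact hkN hn
  have h := l1norm_le_opNorm (T := fun a => S.B (S.absQinv (absDpow j a))) (ν := S.ν) ?_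
    (zero_lt_one.trans_le hν) (memL1_coe (hν := hν) (WL.single k 1))
  · rw [h0, zero_mul, nonpos_iff_eq_zero] at h
    have h1 := congrFun (eq_zero_of_l1norm_eq_zero (zero_lt_one.trans_le hν) h) k
    rw [WL.coe_single] at h1
    have e1 : S.absQinv (absDpow j (Pi.single k 1)) = absDpow j (Pi.single k 1) :=
      blockOp_eq_self _ fun n hn => by simp [absDpow, hkn n hn]
    have e2 : S.B (absDpow j (Pi.single k 1)) = fun n =>
        ((|((S.lam n).re)⁻¹| : ℝ) : ℂ) * absDpow j (Pi.single k 1) n :=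
      blockOp_eq_self _ fun n hn => by simp [absDpow, hkn n hn]
    rw [e1, e2] at h1
    have h2 : (S.lam k).re ≠ 0 := (hlam k).ne
    have h3 : k ≠ 0 := by omega
    simp [absDpow, h2, h3] at h1
  · have : absDpow j 0 = 0 := by funext n; simp [absDpow]
    rw [this]
    have : S.absQinv 0 = 0 := map_zero (blockOpL _)
    rw [this]
    exact map_zero S.BL

/-- For W = 0 any radius is allowed: the operator norms are nonzero and ‖ubar‖ + rstar > 0, so W = 0
forces every second derivative to vanish identically. -/
lemma sum_opNorm_mul_le {rstar M : ℝ} {W : ℝ≥0} (hν : 1 ≤ S.ν)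
    (hlam : ∀ n : ℤ, (S.lam n).re < 0) (hr : 0 < rstar) (hM : 0 ≤ M)
    (hW : (W : ℝ≥0∞) = S.Wbound rstar)
    (hMW : M ≤ (l1norm S.ν S.ubar).toReal + rstar ∨ W = 0) :
    ∑ j ∈ Finset.range (2 * S.J),
      opNorm S.ν (fun a => S.B (S.absQinv (absDpow j a))) *
      ENNReal.ofReal ((absPoly (Polynomial.derivative (Polynomial.derivative (S.g j)))).eval M)
      ≤ W := by
  rcases hMW with h | h
  · rw [hW, Wbound]
    gcongr with j hj
    exact absPoly_eval_mono _ hM h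
  · rw [h] at hW
    have hW' := hW.symm
    rw [ENNReal.coe_zero, Wbound, Finset.sum_eq_zero_iff] at hW'
    rw [Finset.sum_eq_zero]
    · exact zero_le
    · intro j hj
      have h1 := (mul_eq_zero.1 (hW' j hj)).resolve_left (opNorm_ne_zero hν hlam j)
      have hpos : 0 < (l1norm S.ν S.ubar).toReal + rstar :=
        add_pos_of_nonneg_of_pos ENNReal.toReal_nonneg hr
      have h2 := eq_zero_of_absPoly_eval_eq_zero hpos
        (le_antisymm (ENNReal.ofReal_eq_zero.1 h1) (absPoly_eval_nonneg _ hpos.le))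
      rw [h2, absPoly_zero_eval]
      simp

section linear

variable {hν : 1 ≤ S.ν}

/-- The components of `h` beyond the first `P` modes. -/
def highPart {ω : Weight} {A : Type*} [NormedCommRing A] [NormedAlgebra ℂ A] (P : ℕ)
    (h : WL ω A) : WL ω A :=
  WL.mk (fun n => if n.natAbs ≤ P then 0 else h n)
    (Summable.of_nonneg_of_le (fun n => mul_nonneg (norm_nonneg _) (ω.nonneg n))
      (fun n => by
        refine mul_le_mul_of_nonneg_right ?_ (ω.nonneg n)
        split_ifs <;> simp) h.summable)

lemma highPart_apply {ω : Weight} {A : Type*} [NormedCommRing A] [NormedAlgebra ℂ A] (P : ℕ)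
    (h : WL ω A) (n : ℤ) : highPart P h n = if n.natAbs ≤ P then 0 else h n := rfl

/-- The remainder of `(g j)' (ubar)` after its mean value is removed. -/
def oscPart (hν : 1 ≤ S.ν) (hubar : MemL1 S.ν S.ubar) (j : ℕ) : WL (geomWeight S.ν hν) ℂ :=
  papp (Polynomial.derivative (S.g j)) (ofMem hν S.ubar hubar) - WL.single 0 (S.gPrime j 0)

lemma coe_gPrime (hubar : MemL1 S.ν S.ubar) (j : ℕ) :
    ((papp (Polynomial.derivative (S.g j)) (ofMem hν S.ubar hubar) :
      WL (geomWeight S.ν hν) ℂ) : Seq) = S.gPrime j := WL.coe_papp _ _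

lemma norm_oscPart (hubar : MemL1 S.ν S.ubar) (j : ℕ) (n : ℤ) :
    ((‖oscPart hν hubar j n‖ : ℝ) : ℂ) = S.beta j n := by
  rw [beta, absSeq, oscPart, WL.sub_apply, coe_gPrime, WL.coe_single]
  rfl

lemma lam_high {n : ℤ} (hn : ¬ n.natAbs ≤ S.NL) :
    S.lam n = -(n : ℂ) ^ (2 * S.J) +
      ∑ j ∈ Finset.range (2 * S.J), (Complex.I * (n : ℂ)) ^ j * S.gPrime j 0 := by
  rw [lam, if_neg hn]

/-- If |n| ≤ NL and |n - m| > Nbar + NL, then |m| > Nbar, where β vanishes. This is why the columns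
of Γ extend to Nbar + NL: modes beyond that do not feed the block. -/
lemma oscPart_mul_eq_zero (hubar : MemL1 S.ν S.ubar)
    (hNbar : ∀ j < 2 * S.J, ∀ n : ℤ, S.Nbar < n.natAbs → S.beta j n = 0)
    {h : WL (geomWeight S.ν hν) ℂ} (hh : ∀ n : ℤ, n.natAbs ≤ S.Nbar + S.NL → h n = 0)
    {j : ℕ} (hj : j < 2 * S.J) {n : ℤ} (hn : n.natAbs ≤ S.NL) :
    (oscPart hν hubar j * h) n = 0 := by
  rw [WL.mul_apply]
  refine (tsum_congr fun m => ?_).trans tsum_zero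
  by_cases hm : (n - m).natAbs ≤ S.Nbar + S.NL
  · rw [hh _ hm, mul_zero]
  · have h1 : S.Nbar < m.natAbs := by omega
    have h2 := hNbar j hj m h1
    rw [← norm_oscPart (hν := hν) hubar] at h2
    have h3 : oscPart hν hubar j m = 0 := by simpa using h2
    rw [h3, zero_mul]

/-- Away from the block L is diagonal, and λ_n was chosen to cancel the leading term and the mean
values exactly, so only the oscillating parts remain. -/
lemma dgam_high (hubar : MemL1 S.ν S.ubar)
    {h : WL (geomWeight S.ν hν) ℂ} (hh : ∀ n : ℤ, n.natAbs ≤ S.NL → h n = 0) :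
    S.dgam h = ∑ j ∈ Finset.range (2 * S.J), Dpow j (oscPart hν hubar j * h :
      WL (geomWeight S.ν hν) ℂ) := by
  have hL : S.L h = fun n => S.lam n * h n := by
    have e : S.Qinv h = h := blockOp_eq_self _ hh
    rw [L, e]
    exact blockOp_eq_self _ fun n hn => by rw [hh n hn, mul_zero]
  funext n
  rw [dgam_apply (hν := hν) hubar, hL, Finset.sum_apply]
  have e : ∀ j, (papp (Polynomial.derivative (S.g j)) (ofMem hν S.ubar hubar) * h) n =
      S.gPrime j 0 * h n + (oscPart hν hubar j * h) n := by
    intro j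
    have : papp (Polynomial.derivative (S.g j)) (ofMem hν S.ubar hubar) * h =
        WL.single 0 (S.gPrime j 0) * h + oscPart hν hubar j * h := by
      rw [oscPart]; ring
    rw [this, WL.add_apply, WL.single_mul_apply, sub_zero]
  simp only [e, mul_add, Finset.sum_add_distrib, Dpow]
  by_cases hn : n.natAbs ≤ S.NL
  · simp [hh n hn]
  · rw [lam_high hn, ← mul_assoc, leading_coeff, add_mul, Finset.sum_mul]
    have : ∑ j ∈ Finset.range (2 * S.J), (Complex.I * (n : ℂ)) ^ j * S.gPrime j 0 * h n =
      ∑ j ∈ Finset.range (2 * S.J), (Complex.I * (n : ℂ)) ^ j * (S.gPrime j 0 * h n) :=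
        Finset.sum_congr rfl fun _ _ => mul_assoc _ _ _
    rw [this]
    ring

/-- Splitting off finitely many basis vectors exposes the columns dominated by Γ using linearity
alone, without a series of columns. -/
lemma Qinv_dgam_split (hubar : MemL1 S.ν S.ubar) (h : WL (geomWeight S.ν hν) ℂ) (P : ℕ) (n : ℤ) :
    S.Qinv (S.dgam h) n =
      (∑ k ∈ Finset.Icc (-(P : ℤ)) (P : ℤ), h k * S.Qinv (S.dgam (Pi.single k 1)) n) +
      S.Qinv (S.dgam (highPart P h)) n := by
  have e : h = (∑ k ∈ Finset.Icc (-(P : ℤ)) (P : ℤ), h k • WL.single k 1) + highPart P h := by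
    ext m
    simp only [WL.add_apply, WL.sum_apply, WL.smul_apply, WL.coe_single, highPart_apply,
      Pi.single_apply, smul_eq_mul, mul_ite, mul_one, mul_zero, Finset.sum_ite_eq,
      mem_Icc_iff_natAbs]
    split_ifs <;> simp
  have h1 : QinvDgamL hν hubar h n = _ := congrFun (congrArg (QinvDgamL hν hubar) e) n
  rw [map_add, map_sum] at h1
  simp only [map_smul, Pi.add_apply, Finset.sum_apply, Pi.smul_apply, smul_eq_mul,
    QinvDgamL_apply, WL.coe_single] at h1
  exact h1

/-- The majorant of the action of `Dγ(ubar)` on the high modes. -/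
def highMajorant (β m : WL (geomWeight S.ν hν) ℂ) (j : ℕ) : Seq := fun n =>
  if n.natAbs ≤ S.NL then 0 else (n.natAbs : ℂ) ^ j * (β * m) n

/-- The moduli of the coefficients. -/
def modulus {ω : Weight} {A : Type*} [NormedCommRing A] [NormedAlgebra ℂ A] (a : WL ω A) :
    WL ω ℂ :=
  WL.mk (fun n => ((‖a n‖ : ℝ) : ℂ)) (by simpa using a.summable)

lemma modulus_apply {ω : Weight} {A : Type*} [NormedCommRing A] [NormedAlgebra ℂ A]
    (a : WL ω A) (n : ℤ) : modulus a n = ((‖a n‖ : ℝ) : ℂ) := rfl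

lemma norm_modulus {ω : Weight} {A : Type*} [NormedCommRing A] [NormedAlgebra ℂ A]
    (a : WL ω A) : ‖modulus a‖ = ‖a‖ := by
  simp [WL.norm_def, modulus_apply]

lemma modulus_nonneg {ω : Weight} {A : Type*} [NormedCommRing A] [NormedAlgebra ℂ A]
    (a : WL ω A) : 0 ≤ (modulus a : Seq) := fun n => by
  rw [modulus_apply]
  exact Complex.zero_le_real.2 (norm_nonneg _)

lemma norm_mul_apply_le {ω : Weight} (a b : WL ω ℂ) {b' : WL ω ℂ} (hb : ∀ n, ‖b n‖ ≤ ‖b' n‖)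
    (n : ℤ) : ‖(a * b) n‖ ≤ ‖(modulus a * modulus b') n‖ := by
  have hs := WL.summable_norm_conv a b' n
  have e : (modulus a * modulus b') n = ((∑' m, ‖a m * b' (n - m)‖ : ℝ) : ℂ) := by
    rw [WL.mul_apply, Complex.ofReal_tsum]
    simp [modulus_apply]
  rw [e, Complex.norm_real, Real.norm_eq_abs]
  refine (norm_tsum_le_tsum_norm (WL.summable_norm_conv a b n)).trans
    (le_trans ?_ (le_abs_self _))
  refine (WL.summable_norm_conv a b n).tsum_le_tsum (fun m => ?_) hs
  rw [norm_mul, norm_mul]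
  exact mul_le_mul_of_nonneg_left (hb _) (norm_nonneg _)

/-- The majorant vanishes on the block, so |Q| acts as the identity and B multiplies mode n by 1/|Re
λ_n|; together with |n|^j this is at most χ_j. -/
lemma l1norm_B_highMajorant_le (β m : WL (geomWeight S.ν hν) ℂ) (j : ℕ) :
    l1norm S.ν (S.B (highMajorant β m j)) ≤ ENNReal.ofReal ‖β‖ * S.chi j * ENNReal.ofReal ‖m‖ := by
  have hν0 : 0 ≤ S.ν := zero_le_one.trans hν
  have e : S.B (highMajorant β m j) = fun n =>
      ((|((S.lam n).re)⁻¹| : ℝ) : ℂ) * highMajorant β m j n :=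
    blockOp_eq_self _ fun n hn => by simp [highMajorant, hn]
  have h1 : l1norm S.ν (S.B (highMajorant β m j)) ≤ S.chi j * l1norm S.ν (β * m :
      WL (geomWeight S.ν hν) ℂ) := by
    rw [e, l1norm, l1norm, ← ENNReal.tsum_mul_left]
    refine ENNReal.tsum_le_tsum fun n => ?_
    by_cases hn : n.natAbs ≤ S.NL
    · simp [highMajorant, hn]
    · have h2 : ENNReal.ofReal ((n.natAbs : ℝ) ^ j / |(S.lam n).re|) ≤ S.chi j :=
        le_iSup₂ (f := fun (n : ℤ) (_ : S.NL < n.natAbs) =>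
          ENNReal.ofReal ((n.natAbs : ℝ) ^ j / |(S.lam n).re|)) n (not_le.1 hn)
      refine le_trans ?_ (mul_le_mul' h2 le_rfl)
      rw [← ENNReal.ofReal_mul (by positivity)]
      refine ENNReal.ofReal_le_ofReal (le_of_eq ?_)
      simp only [highMajorant, hn, if_false, norm_mul, Complex.norm_real, norm_pow,
        Complex.norm_natCast, Real.norm_eq_abs, abs_abs, abs_inv]
      ring
  refine h1.trans ?_
  rw [l1norm_coe, mul_comm (ENNReal.ofReal ‖β‖), mul_assoc, ← ENNReal.ofReal_mul (norm_nonneg _)]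
  gcongr
  exact norm_mul_le _ _

end linear

end Setup

/-! ### The Lipschitz estimate for `Q⁻¹ γ` -/

namespace Setup

variable {S : Setup} {hν : 1 ≤ S.ν}

open scoped ComplexOrder

lemma modulus_mul_modulus_nonneg {ω : Weight} (a b : WL ω ℂ) :
    0 ≤ (modulus a * modulus b : WL ω ℂ).1 := fun n => by
  have e : (modulus a * modulus b) n = ((∑' m, ‖a m‖ * ‖b (n - m)‖ : ℝ) : ℂ) := by
    rw [WL.mul_apply, Complex.ofReal_tsum]
    simp [modulus_apply]
  rw [e]
  exact Complex.zero_le_real.2 (tsum_nonneg fun m => by positivity)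

lemma highMajorant_nonneg (β m : WL (geomWeight S.ν hν) ℂ) (j : ℕ) :
    0 ≤ highMajorant (modulus β) (modulus m) j := fun n => by
  rw [highMajorant]
  split_ifs
  · exact le_rfl
  · have h : (0 : ℂ) ≤ (n.natAbs : ℂ) ^ j := by
      rw [← Nat.cast_pow]
      exact Nat.cast_nonneg _
    exact mul_nonneg h (modulus_mul_modulus_nonneg β m n)

/-- Exact additivity of the ℓ¹ norm over disjoint sets of modes is the reason why Z can be a
maximum, not a sum, of the low-mode and high-mode bounds. -/
lemma norm_highPart_add {ω : Weight} (P : ℕ) (h : WL ω ℂ) :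
    ‖h - highPart P h‖ + ‖highPart P h‖ = ‖h‖ := by
  rw [WL.norm_def, WL.norm_def, WL.norm_def,
    ← (h - highPart P h).summable.tsum_add (highPart P h).summable]
  congr 1 with n
  rw [WL.sub_apply, highPart_apply]
  split_ifs <;> simp

/-- In the application h is the value at one time and m collects the suprema over all times, so the
bound is uniform in time. The image of the high modes vanishes on the block, hence Q⁻¹ leaves it
unchanged. -/
lemma norm_Qinv_dgam_le (hubar : MemL1 S.ν S.ubar)
    (hNbar : ∀ j < 2 * S.J, ∀ n : ℤ, S.Nbar < n.natAbs → S.beta j n = 0)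
    (hG : S.GamDominates) (h m : WL (geomWeight S.ν hν) ℂ) (hm : ∀ n, ‖h n‖ ≤ ‖m n‖) (n : ℤ) :
    ‖S.Qinv (S.dgam h) n‖ ≤ ‖S.GamLow (modulus m) n‖ +
      ∑ j ∈ Finset.range (2 * S.J), ‖highMajorant (modulus (oscPart hν hubar j))
        (modulus (highPart (S.Nbar + S.NL) m)) j n‖ := by
  set P := S.Nbar + S.NL with hP
  rw [Qinv_dgam_split hubar h P]
  refine (norm_add_le _ _).trans (add_le_add ?_ ?_)
  · have e : S.GamLow (modulus m) n =
        ((∑ k ∈ Finset.Icc (-(P : ℤ)) (P : ℤ), S.G n k * ‖m k‖ : ℝ) : ℂ) := by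
      rw [GamLow]
      push_cast
      rfl
    rw [e, Complex.norm_real]
    refine (norm_sum_le _ _).trans (le_trans (Finset.sum_le_sum fun k hk => ?_) (le_abs_self _))
    rw [norm_mul, mul_comm]
    have := hG n k (mem_Icc_iff_natAbs.1 hk)
    exact mul_le_mul this (hm k) (norm_nonneg _) ((norm_nonneg _).trans this)
  · have hh : ∀ k : ℤ, k.natAbs ≤ P → highPart P h k = 0 := fun k hk => by
      rw [highPart_apply, if_pos hk]
    have hm' : ∀ k, ‖highPart P h k‖ ≤ ‖highPart P m k‖ := fun k => by
      rw [highPart_apply, highPart_apply]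
      split_ifs
      · simp
      · exact hm k
    rw [dgam_high hubar fun k hk => hh k (by omega)]
    have e : S.Qinv (∑ j ∈ Finset.range (2 * S.J), Dpow j (oscPart hν hubar j * highPart P h :
        WL (geomWeight S.ν hν) ℂ)) = ∑ j ∈ Finset.range (2 * S.J),
        Dpow j (oscPart hν hubar j * highPart P h : WL (geomWeight S.ν hν) ℂ) := by
      refine blockOp_eq_self _ fun k hk => ?_
      rw [Finset.sum_apply]
      refine Finset.sum_eq_zero fun j hj => ?_
      rw [Dpow, oscPart_mul_eq_zero hubar hNbar hh (Finset.mem_range.1 hj) hk, mul_zero]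
    rw [e, Finset.sum_apply]
    refine (norm_sum_le _ _).trans (Finset.sum_le_sum fun j hj => ?_)
    rw [Dpow, highMajorant]
    split_ifs with hn
    · rw [oscPart_mul_eq_zero hubar hNbar hh (Finset.mem_range.1 hj) hn]
      simp
    · rw [norm_mul, norm_mul]
      refine mul_le_mul (le_of_eq ?_) (norm_mul_apply_le _ _ hm' n) (norm_nonneg _)
        (norm_nonneg _)
      simp only [norm_pow, norm_mul, Complex.norm_I, one_mul, Complex.norm_natCast]
      congr 1
      rw [Complex.norm_intCast, Nat.cast_natAbs, Int.cast_abs]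

lemma l1norm_B_GamLow_le {Z : ℝ≥0} (hZ : (Z : ℝ≥0∞) = S.Zbound)
    (m : WL (geomWeight S.ν hν) ℂ) (P : ℕ) (hP : P = S.Nbar + S.NL) :
    l1norm S.ν (S.B (S.GamLow m)) ≤ Z * ENNReal.ofReal ‖m - highPart P m‖ := by
  have e : S.GamLow m = S.GamLow (m - highPart P m : WL (geomWeight S.ν hν) ℂ) := by
    funext n
    refine Finset.sum_congr rfl fun k hk => ?_
    rw [WL.sub_apply, highPart_apply, if_pos, sub_zero]
    rw [hP]
    exact mem_Icc_iff_natAbs.1 hk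
  rw [e]
  refine (l1norm_le_opNorm (T := fun a => S.B (S.GamLow a)) ?_ (zero_lt_one.trans_le hν)
    (memL1_coe _)).trans ?_
  · have : S.GamLow 0 = 0 := by funext n; simp [GamLow]
    rw [this]
    exact map_zero S.BL
  · rw [hZ, l1norm_coe]
    gcongr
    exact le_max_left _ _

lemma sum_l1norm_B_highMajorant_le {Z : ℝ≥0} (hubar : MemL1 S.ν S.ubar)
    (hZ : (Z : ℝ≥0∞) = S.Zbound) (m : WL (geomWeight S.ν hν) ℂ) :
    ∑ j ∈ Finset.range (2 * S.J),
      l1norm S.ν (S.B (highMajorant (modulus (oscPart hν hubar j)) (modulus m) j))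
      ≤ Z * ENNReal.ofReal ‖m‖ := by
  calc _ ≤ ∑ j ∈ Finset.range (2 * S.J), l1norm S.ν (S.beta j) * S.chi j *
        ENNReal.ofReal ‖m‖ := by
        refine Finset.sum_le_sum fun j _ => (l1norm_B_highMajorant_le _ _ j).trans_eq ?_
        have : S.beta j = (modulus (oscPart hν hubar j) : Seq) :=
          funext fun n => (norm_oscPart hubar j n).symm
        rw [this, l1norm_coe, norm_modulus, norm_modulus]
    _ ≤ _ := by
        rw [← Finset.sum_mul, hZ]
        gcongr
        exact le_max_right _ _

lemma l1norm_B_absQinv_le (x : WL (geomWeight S.ν hν) ℂ) (j : ℕ) :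
    l1norm S.ν (S.B (S.absQinv (absDpow j x))) ≤
      opNorm S.ν (fun a => S.B (S.absQinv (absDpow j a))) * ENNReal.ofReal ‖x‖ := by
  refine (l1norm_le_opNorm (T := fun a => S.B (S.absQinv (absDpow j a))) ?_
    (zero_lt_one.trans_le hν) (memL1_coe x)).trans_eq (by rw [l1norm_coe])
  have : absDpow j 0 = 0 := by funext n; simp [absDpow]
  rw [this]
  have : S.absQinv 0 = 0 := map_zero (blockOpL _)
  rw [this]
  exact map_zero S.BL

lemma norm_Qinv_Dpow_le {h : Seq} {x : WL (geomWeight S.ν hν) ℂ} (hx : ∀ n, ‖h n‖ ≤ ‖x n‖)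
    (j : ℕ) (n : ℤ) :
    ‖S.Qinv (Dpow j h) n‖ ≤ ‖S.absQinv (absDpow j (modulus x)) n‖ := by
  have e : absDpow j (modulus x) = fun n => (((n.natAbs : ℝ) ^ j * ‖x n‖ : ℝ) : ℂ) := by
    funext n
    simp only [absDpow, modulus_apply]
    push_cast
    rfl
  rw [e]
  refine norm_blockOp_le _ (fun k => ?_) n
  rw [Dpow, norm_mul]
  refine mul_le_mul (le_of_eq ?_) (hx k) (norm_nonneg _) (by positivity)
  simp only [norm_pow, norm_mul, Complex.norm_I, one_mul]
  congr 1
  rw [Complex.norm_intCast, Nat.cast_natAbs, Int.cast_abs]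

lemma absQinv_absDpow_modulus_nonneg {A : Type*} [NormedCommRing A] [NormedAlgebra ℂ A]
    (x : WL (geomWeight S.ν hν) A) (j : ℕ) :
    0 ≤ S.absQinv (absDpow j (modulus x)) := by
  refine blockOp_absMat_nonneg _ fun n => ?_
  have h : (0 : ℂ) ≤ (n.natAbs : ℂ) ^ j := by
    rw [← Nat.cast_pow]
    exact Nat.cast_nonneg _
  exact mul_nonneg h (modulus_nonneg x n)

lemma GamLow_modulus_nonneg (hG : S.GamDominates) (m : WL (geomWeight S.ν hν) ℂ) :
    0 ≤ S.GamLow (modulus m) := fun n =>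
  Finset.sum_nonneg fun k hk => mul_nonneg
    (Complex.zero_le_real.2 ((norm_nonneg _).trans (hG n k (mem_Icc_iff_natAbs.1 hk))))
    (modulus_nonneg m k)

/-- The hypotheses of the theorem on the approximate steady state and on the bounds `Z` and `W`. -/
structure Bounds (S : Setup) (hν : 1 ≤ S.ν) (rstar : ℝ) (Z W : ℝ≥0) : Prop where
  hubar : MemL1 S.ν S.ubar
  hQ : IsUnit S.QN
  hNbar : ∀ j < 2 * S.J, ∀ n : ℤ, S.Nbar < n.natAbs → S.beta j n = 0
  hG : S.GamDominates
  hlam : ∀ n : ℤ, (S.lam n).re < 0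
  hr : 0 < rstar
  hZ : (Z : ℝ≥0∞) = S.Zbound
  hW : (W : ℝ≥0∞) = S.Wbound rstar

variable {rstar : ℝ} {Z W : ℝ≥0} {X : Type*} [TopologicalSpace X] [Nonempty X]

/-- The key Lipschitz estimate: the increments of `Q⁻¹ γ` are dominated component by component,
uniformly in time, by a sequence that `B` maps to a sequence of controlled norm. -/
lemma Bounds.exists_majorant (H : Bounds S hν rstar Z W)
    (a b : WL (geomWeight S.ν hν) (BoundedContinuousFunction X ℂ)) {ra rb : ℝ}
    (ha : ‖a - WL.const X (ofMem hν S.ubar H.hubar)‖ ≤ ra)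
    (hb : ‖b - WL.const X (ofMem hν S.ubar H.hubar)‖ ≤ rb)
    (hR : (ra ≤ rstar ∧ rb ≤ rstar) ∨ W = 0) :
    ∃ m : ℤ → ℝ, (∀ t n, ‖S.Qinv (S.gam (WL.at' t a) - S.gam (WL.at' t b)) n‖ ≤ m n) ∧
      l1norm S.ν (S.B fun n => (m n : ℂ)) ≤
        ENNReal.ofReal ((Z + W * ((ra + rb) / 2)) * ‖a - b‖) := by
  have hν0 : 0 ≤ S.ν := zero_le_one.trans hν
  have hra0 : 0 ≤ ra := (norm_nonneg _).trans ha
  have hrb0 : 0 ≤ rb := (norm_nonneg _).trans hb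
  set ū := ofMem hν S.ubar H.hubar with hū
  set c := WL.const X ū with hc
  set P := S.Nbar + S.NL with hP
  set d := modulus (a - b) with hd
  have hcn : ‖c‖ = ‖ū‖ := WL.norm_const ū
  let x : ℕ → WL (geomWeight S.ν hν) (BoundedContinuousFunction X ℂ) := fun j =>
    taylorFactor (S.g j) a b c * (a - b)
  let V : ℕ → Seq := fun j => S.absQinv (absDpow j (modulus (x j)))
  let U : ℕ → Seq := fun j => highMajorant (modulus (oscPart hν H.hubar j))
    (modulus (highPart P d)) j
  -- Because of the derivatives in γ this majorant need not lie in ℓ¹_ν; only its image under B is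
  -- estimated in norm.
  let m : ℤ → ℝ := fun n => ‖S.GamLow (modulus d) n‖ +
    ∑ j ∈ Finset.range (2 * S.J), ‖U j n‖ + ∑ j ∈ Finset.range (2 * S.J), ‖V j n‖
  refine ⟨m, fun t n => ?_, ?_⟩
  · have hdt : ∀ k, ‖(WL.at' t a - WL.at' t b) k‖ ≤ ‖d k‖ := fun k => by
      rw [← map_sub, WL.at'_apply, hd, modulus_apply, Complex.norm_real, norm_norm]
      exact BoundedContinuousFunction.norm_coe_le_norm _ t
    -- Evaluation at a time is an algebra homomorphism, so it commutes with the Taylor factor.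
    have hxt : ∀ j, taylorFactor (S.g j) (WL.at' t a) (WL.at' t b) ū *
        (WL.at' t a - WL.at' t b) = WL.at' t (x j) := by
      intro j
      simp only [x, taylorFactor, map_mul, map_sum, map_smul, map_sub, map_pow, hc, WL.at'_const]
    rw [gam_sub_gam H.hubar]
    have e : S.Qinv (S.dgam (WL.at' t a - WL.at' t b : WL (geomWeight S.ν hν) ℂ) +
        ∑ j ∈ Finset.range (2 * S.J),
          Dpow j (taylorFactor (S.g j) (WL.at' t a) (WL.at' t b) ū *
            (WL.at' t a - WL.at' t b) : WL (geomWeight S.ν hν) ℂ)) =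
        S.Qinv (S.dgam (WL.at' t a - WL.at' t b : WL (geomWeight S.ν hν) ℂ)) +
        ∑ j ∈ Finset.range (2 * S.J), S.Qinv (Dpow j (WL.at' t (x j))) := by
      simp only [hxt]
      exact (map_add S.QinvL _ _).trans (congrArg _ (map_sum S.QinvL _ _))
    rw [e, Pi.add_apply, Finset.sum_apply]
    refine (norm_add_le _ _).trans (add_le_add (norm_Qinv_dgam_le H.hubar H.hNbar H.hG _ d hdt n)
      ((norm_sum_le _ _).trans (Finset.sum_le_sum fun j _ => ?_)))
    have e2 : V j = S.absQinv (absDpow j (modulus (modulus (x j)))) := by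
      have : modulus (modulus (x j)) = modulus (x j) := by ext n; simp [modulus_apply]
      rw [this]
    rw [e2]
    refine norm_Qinv_Dpow_le (fun k => ?_) j n
    rw [WL.at'_apply, modulus_apply, Complex.norm_real, norm_norm]
    exact BoundedContinuousFunction.norm_coe_le_norm _ t
  · have e : (fun n => (m n : ℂ)) = S.GamLow (modulus d) +
        ∑ j ∈ Finset.range (2 * S.J), U j + ∑ j ∈ Finset.range (2 * S.J), V j := by
      have h1 := absSeq_eq_self (GamLow_modulus_nonneg H.hG d)
      have h2 := fun j => absSeq_eq_self (highMajorant_nonneg (oscPart hν H.hubar j)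
        (highPart P d) j)
      have h3 := fun j => absSeq_eq_self (absQinv_absDpow_modulus_nonneg (x j) j)
      funext n
      simp only [m, Pi.add_apply, Finset.sum_apply]
      push_cast
      refine congrArg₂ _ (congrArg₂ _ (congrFun h1 n)
        (Finset.sum_congr rfl fun j _ => congrFun (h2 j) n))
        (Finset.sum_congr rfl fun j _ => congrFun (h3 j) n)
    have e' : S.B (fun n => (m n : ℂ)) = S.B (S.GamLow (modulus d)) +
        ∑ j ∈ Finset.range (2 * S.J), S.B (U j) + ∑ j ∈ Finset.range (2 * S.J), S.B (V j) := by
      rw [e]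
      change S.BL _ = _
      rw [map_add, map_add, map_sum, map_sum]
      rfl
    have hmd : modulus d = d := by ext n; simp [hd, modulus_apply]
    have b1 : l1norm S.ν (S.B (S.GamLow (modulus d))) ≤
        Z * ENNReal.ofReal ‖d - highPart P d‖ := by
      rw [hmd]
      exact l1norm_B_GamLow_le H.hZ d P hP
    have b2 : l1norm S.ν (∑ j ∈ Finset.range (2 * S.J), S.B (U j)) ≤
        Z * ENNReal.ofReal ‖highPart P d‖ :=
      (l1norm_sum_le hν0 _ _).trans (sum_l1norm_B_highMajorant_le H.hubar H.hZ _)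
    have b3 : l1norm S.ν (∑ j ∈ Finset.range (2 * S.J), S.B (V j)) ≤
        W * ENNReal.ofReal ((ra + rb) / 2 * ‖a - b‖) := by
      refine (l1norm_sum_le hν0 _ _).trans ?_
      -- This radius bounds the norms of a, b and c at once.
      have hM0 : 0 ≤ ‖c‖ + max ra rb := by positivity
      refine le_trans ?_ (mul_le_mul_left (sum_opNorm_mul_le (M := ‖c‖ + max ra rb) hν H.hlam
        H.hr hM0 H.hW ?_) _)
      · rw [Finset.sum_mul]
        refine Finset.sum_le_sum fun j _ => (l1norm_B_absQinv_le _ _).trans ?_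
        rw [mul_assoc, ← ENNReal.ofReal_mul (absPoly_eval_nonneg _ hM0), norm_modulus]
        gcongr
        refine (norm_mul_le _ _).trans ?_
        rw [← mul_assoc]
        refine mul_le_mul_of_nonneg_right ?_ (norm_nonneg _)
        refine norm_taylorFactor_le (S.g j) ?_ ?_ ?_ ha hb
        · have := norm_le_norm_add_norm_sub' a c
          linarith [le_max_left ra rb]
        · have := norm_le_norm_add_norm_sub' b c
          linarith [le_max_right ra rb]
        · linarith [le_max_left ra rb]
      · refine hR.imp (fun h => ?_) id
        have : (l1norm S.ν S.ubar).toReal = ‖ū‖ := by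
          rw [← coe_ofMem (hν := hν) S.ubar H.hubar, l1norm_coe,
            ENNReal.toReal_ofReal (norm_nonneg _)]
        rw [this, hcn]
        exact add_le_add le_rfl (max_le h.1 h.2)
    rw [e']
    refine (l1norm_add_le hν0 _ _).trans (le_trans (add_le_add ((l1norm_add_le hν0 _ _).trans
      (add_le_add b1 b2)) b3) ?_)
    rw [← mul_add, ← ENNReal.ofReal_add (norm_nonneg _) (norm_nonneg _), norm_highPart_add, hd,
      norm_modulus, ← ENNReal.ofReal_coe_nnreal, ← ENNReal.ofReal_coe_nnreal,
      ← ENNReal.ofReal_mul (by positivity), ← ENNReal.ofReal_mul (by positivity),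
      ← ENNReal.ofReal_add (by positivity) (by positivity)]
    refine ENNReal.ofReal_le_ofReal (le_of_eq ?_)
    ring

end Setup

/-- The contraction mapping principle on a closed set. -/
lemma exists_fixedPoint_of_dist_le {E : Type*} [MetricSpace E] [CompleteSpace E] {s : Set E}
    (hs : IsClosed s) (hne : s.Nonempty) {f : E → E} (hf : Set.MapsTo f s s) {K : ℝ}
    (hK0 : 0 ≤ K) (hK : K < 1) (h : ∀ x ∈ s, ∀ y ∈ s, dist (f x) (f y) ≤ K * dist x y) :
    ∃ x ∈ s, f x = x := by
  obtain ⟨x0, hx0⟩ := hne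
  have hc : ContractingWith ⟨K, hK0⟩ (hf.restrict f s s) :=
    ⟨by exact_mod_cast hK, LipschitzWith.of_dist_le_mul fun x y => h x x.2 y y.2⟩
  obtain ⟨y, hy, hfix, -⟩ := hc.exists_fixedPoint' hs.isComplete hf hx0 (edist_ne_top _ _)
  exact ⟨y, hy, hfix⟩

/-! ### Existence and local uniqueness of the steady state -/

namespace Setup

variable {S : Setup} {hν : 1 ≤ S.ν} {rstar : ℝ} {Z W : ℝ≥0}

/-- Since |λ_n|⁻¹ ≤ |Re λ_n|⁻¹, the operator B designed for the evolution also bounds L⁻¹, and the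
same Z and W serve the stationary problem. -/
lemma norm_Linv_le {x : Seq} {m : ℤ → ℝ} (hm : ∀ n, ‖S.Qinv x n‖ ≤ m n)
    (hlam : ∀ n : ℤ, (S.lam n).re < 0) (n : ℤ) :
    ‖S.Linv x n‖ ≤ ‖S.B (fun n => (m n : ℂ)) n‖ := by
  have e : S.B (fun n => (m n : ℂ)) = S.absQ fun n => ((|((S.lam n).re)⁻¹| * m n : ℝ) : ℂ) := by
    rw [B]
    push_cast
    rfl
  rw [e]
  refine norm_blockOp_le _ (fun k => ?_) n
  rw [norm_mul, norm_inv, abs_inv]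
  refine mul_le_mul (inv_anti₀ (abs_pos.2 (hlam k).ne) (Complex.abs_re_le_norm _)) (hm k)
    (norm_nonneg _) (by positivity)

lemma Bounds.l1norm_Linv_gam_sub_le (H : Bounds S hν rstar Z W)
    (a b : WL (geomWeight S.ν hν) ℂ) {ra rb : ℝ}
    (ha : ‖a - ofMem hν S.ubar H.hubar‖ ≤ ra) (hb : ‖b - ofMem hν S.ubar H.hubar‖ ≤ rb)
    (hra : ra ≤ rstar) (hrb : rb ≤ rstar) :
    l1norm S.ν (S.Linv (S.gam a) - S.Linv (S.gam b)) ≤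
      ENNReal.ofReal ((Z + W * ((ra + rb) / 2)) * ‖a - b‖) := by
  -- A one-point set of times reduces the estimate to the stationary case.
  obtain ⟨m, hm, hB⟩ := H.exists_majorant (X := Unit) (WL.const Unit a) (WL.const Unit b)
    (by rwa [WL.const_sub, WL.norm_const]) (by rwa [WL.const_sub, WL.norm_const])
    (Or.inl ⟨hra, hrb⟩)
  rw [WL.const_sub, WL.norm_const] at hB
  have e : S.Linv (S.gam a) - S.Linv (S.gam b) = S.Linv (S.gam a - S.gam b) :=
    (map_sub S.LinvL _ _).symm
  rw [e]
  refine (l1norm_mono (zero_le_one.trans hν) (norm_Linv_le (fun n => ?_) H.hlam)).trans hB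
  simpa using hm () n

lemma isSteadyState_iff (hQ : IsUnit S.QN) (hlam : ∀ n, S.lam n ≠ 0) (a : Seq) :
    rhs S.J S.g a = 0 ↔ S.Linv (S.gam a) = -a := by
  have hneg : S.Linv (-S.L a) = -a := by
    have := map_neg S.LinvL (S.L a)
    rw [LinvL_apply, LinvL_apply, Linv_L hQ hlam] at this
    exact this
  constructor
  · intro h
    rw [gam, h, zero_sub, hneg]
  · intro h
    have h1 := congrArg S.L (h.trans hneg.symm)
    rw [L_Linv hQ hlam, L_Linv hQ hlam, gam] at h1
    simpa using h1

open scoped ComplexOrder in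
lemma l1norm_residual_le_Ybound (hν : 1 ≤ S.ν) (uin : Seq) :
    l1norm S.ν (S.ubar + S.Linv (S.gam S.ubar)) ≤ S.Ybound uin := by
  refine l1norm_mono (zero_le_one.trans hν) fun n => ?_
  set b := S.ubar + S.Linv (S.gam S.ubar)
  set p := S.absQ (absSeq (S.Qinv (uin + S.Linv (S.gam S.ubar))))
  have hp : 0 ≤ p := blockOp_absMat_nonneg _ fun n => Complex.zero_le_real.2 (norm_nonneg _)
  have e : (p + absSeq b) n = ((‖p n‖ + ‖b n‖ : ℝ) : ℂ) := by
    rw [Pi.add_apply]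
    push_cast
    exact congrArg (· + ((‖b n‖ : ℝ) : ℂ)) (congrFun (absSeq_eq_self hp) n).symm
  rw [e, Complex.norm_real]
  exact le_trans (by linarith [norm_nonneg (p n)]) (le_abs_self _)

lemma Bounds.lam_ne_zero (H : Bounds S hν rstar Z W) (n : ℤ) : S.lam n ≠ 0 := fun h => by
  have := H.hlam n
  simp [h] at this

/-- Both are fixed points of -L⁻¹γ, whose Lipschitz constant on the ball is Z + W R < 1. -/
lemma Bounds.eq_of_steadyState (H : Bounds S hν rstar Z W) {a b : WL (geomWeight S.ν hν) ℂ}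
    {R : ℝ} (hR : R ≤ rstar) (hlt : (Z : ℝ) + W * R < 1)
    (ha : ‖a - ofMem hν S.ubar H.hubar‖ ≤ R) (hb : ‖b - ofMem hν S.ubar H.hubar‖ ≤ R)
    (hsa : rhs S.J S.g a = 0) (hsb : rhs S.J S.g b = 0) : a = b := by
  have h := H.l1norm_Linv_gam_sub_le a b ha hb hR hR
  rw [(isSteadyState_iff H.hQ H.lam_ne_zero _).1 hsa,
    (isSteadyState_iff H.hQ H.lam_ne_zero _).1 hsb] at h
  have e : -(a : Seq) - -(b : Seq) = (b - a : WL (geomWeight S.ν hν) ℂ).1 := by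
    funext n
    change -(a n) - -(b n) = b n - a n
    ring
  have hR0 : 0 ≤ R := (norm_nonneg _).trans ha
  rw [e, l1norm_coe, norm_sub_rev, add_self_div_two,
    ENNReal.ofReal_le_ofReal_iff (by positivity)] at h
  have h0 : ‖a - b‖ = 0 := by
    by_contra hne
    have : 0 < ‖a - b‖ := lt_of_le_of_ne (norm_nonneg _) (Ne.symm hne)
    nlinarith
  exact sub_eq_zero.1 (norm_eq_zero.1 h0)

lemma Bounds.exists_steadyState (H : Bounds S hν rstar Z W) {uin : Seq} {Y : ℝ≥0}
    (hY : (Y : ℝ≥0∞) = S.Ybound uin) {r : ℝ} (hr0 : 0 < r) (hr : r ≤ rstar)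
    (h1 : (Y : ℝ) + Z * r + 1 / 2 * W * r ^ 2 < r) (h2 : (Z : ℝ) + W * r < 1) :
    ∃ a : WL (geomWeight S.ν hν) ℂ, ‖a - ofMem hν S.ubar H.hubar‖ ≤ r ∧ rhs S.J S.g a = 0 := by
  classical
  set ū := ofMem hν S.ubar H.hubar with hū
  have hν0 : 0 ≤ S.ν := zero_le_one.trans hν
  have hYū : l1norm S.ν ((ū : Seq) + S.Linv (S.gam ū)) ≤ Y := by
    rw [hY]
    exact l1norm_residual_le_Ybound hν uin
  have hu0 : ‖ū - ū‖ ≤ 0 := by simp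
  have hmem : ∀ a : WL (geomWeight S.ν hν) ℂ, ‖a - ū‖ ≤ r → MemL1 S.ν (-S.Linv (S.gam a)) := by
    intro a ha
    have hd := H.l1norm_Linv_gam_sub_le a ū ha hu0 hr (hr0.le.trans hr)
    -- Membership in ℓ¹_ν is not clear from γ(a) itself; it is obtained from ubar, the finite
    -- residual at ubar and the Lipschitz increment.
    have e : -S.Linv (S.gam a) = ((ū : Seq) + -((ū : Seq) + S.Linv (S.gam ū))) +
        (S.Linv (S.gam ū) - S.Linv (S.gam a)) := by
      funext n
      simp only [Pi.neg_apply, Pi.add_apply, Pi.sub_apply]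
      ring
    have hn : l1norm S.ν (-((ū : Seq) + S.Linv (S.gam ū))) ≤ Y := by
      refine le_trans (le_of_eq ?_) hYū
      simp only [l1norm, Pi.neg_apply, norm_neg]
    rw [e, MemL1]
    refine ((l1norm_add_le hν0 _ _).trans (add_le_add (l1norm_add_le hν0 _ _) le_rfl)).trans_lt ?_
    refine ENNReal.add_lt_top.2 ⟨ENNReal.add_lt_top.2 ⟨memL1_coe ū,
      hn.trans_lt ENNReal.coe_lt_top⟩, ?_⟩
    rw [l1norm_sub_comm]
    exact hd.trans_lt ENNReal.ofReal_lt_top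
  -- The value 0 is a filler that is never taken on the ball, by `hmem`.
  let T : WL (geomWeight S.ν hν) ℂ → WL (geomWeight S.ν hν) ℂ := fun a =>
    if h : MemL1 S.ν (-S.Linv (S.gam a)) then ofMem hν _ h else 0
  have hT : ∀ a : WL (geomWeight S.ν hν) ℂ, ‖a - ū‖ ≤ r → (T a : Seq) = -S.Linv (S.gam a) := by
    intro a ha
    simp only [T, hmem a ha, dif_pos]
    rfl
  have hlip : ∀ a b : WL (geomWeight S.ν hν) ℂ, ∀ ra rb : ℝ, ‖a - ū‖ ≤ ra → ‖b - ū‖ ≤ rb →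
      ra ≤ r → rb ≤ r → ‖T a - T b‖ ≤ (Z + W * ((ra + rb) / 2)) * ‖a - b‖ := by
    intro a b ra rb ha hb hra hrb
    have h := H.l1norm_Linv_gam_sub_le a b ha hb (hra.trans hr) (hrb.trans hr)
    have e : S.Linv (S.gam a) - S.Linv (S.gam b) = (T b - T a : WL (geomWeight S.ν hν) ℂ).1 := by
      funext n
      change _ = T b n - T a n
      rw [hT a (ha.trans hra), hT b (hb.trans hrb)]
      simp only [Pi.sub_apply, Pi.neg_apply]
      ring
    have hra0 : 0 ≤ ra := (norm_nonneg _).trans ha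
    have hrb0 : 0 ≤ rb := (norm_nonneg _).trans hb
    rwa [e, l1norm_coe, norm_sub_rev, ENNReal.ofReal_le_ofReal_iff (by positivity)] at h
  have hTū : ‖T ū - ū‖ ≤ Y := by
    have e : (ū : Seq) + S.Linv (S.gam ū) = (ū - T ū : WL (geomWeight S.ν hν) ℂ).1 := by
      funext n
      change _ = ū n - T ū n
      rw [hT ū (hu0.trans hr0.le)]
      simp only [Pi.add_apply, Pi.neg_apply]
      ring
    rw [e, l1norm_coe, norm_sub_rev, ← ENNReal.ofReal_coe_nnreal,
      ENNReal.ofReal_le_ofReal_iff Y.coe_nonneg] at hYū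
    exact hYū
  obtain ⟨a, ha, hfix⟩ := exists_fixedPoint_of_dist_le (s := Metric.closedBall ū r) (f := T)
    Metric.isClosed_closedBall ⟨ū, Metric.mem_closedBall_self hr0.le⟩ (fun a ha => by
      rw [mem_closedBall_iff_norm] at ha ⊢
      -- Comparison with the centre uses the radii r and 0, giving Z + W r / 2; hence Y + Z r + W r²
      -- / 2 bounds the distance of T a from the centre.
      have h3 := hlip a ū r 0 ha hu0 le_rfl hr0.le
      have h4 := norm_add_le (T a - T ū) (T ū - ū)
      rw [sub_add_sub_cancel] at h4
      have h5 : (Z + W * ((r + 0) / 2)) * ‖a - ū‖ ≤ (Z + W * ((r + 0) / 2)) * r :=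
        mul_le_mul_of_nonneg_left ha (by positivity)
      nlinarith) (K := Z + W * r) (by positivity) h2 (fun a ha b hb => by
      rw [mem_closedBall_iff_norm] at ha hb
      have := hlip a b r r ha hb le_rfl le_rfl
      rwa [add_self_div_two, ← dist_eq_norm, ← dist_eq_norm] at this)
  rw [mem_closedBall_iff_norm] at ha
  refine ⟨a, ha, (isSteadyState_iff H.hQ H.lam_ne_zero _).2 ?_⟩
  have := hT a ha
  rw [hfix] at this
  rw [this, neg_neg]
  rw [← this]

end Setup

/-! ### Dominated convergence in the weighted `ℓ¹` spaces -/

namespace WL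

variable {ω : Weight} {A : Type*} [NormedCommRing A] [NormedAlgebra ℂ A]

lemma tendsto_of_dominated {α : Type*} {l : Filter α} {f : α → WL ω A} {g : WL ω A} {b : ℤ → ℝ}
    (hb : Summable fun n => b n * ω.w n) (hf : ∀ᶠ s in l, ∀ n, ‖f s n‖ ≤ b n)
    (h : ∀ n, Tendsto (fun s => f s n) l (𝓝 (g n))) : Tendsto f l (𝓝 g) := by
  rw [tendsto_iff_norm_sub_tendsto_zero]
  have h0 : (0 : ℝ) = ∑' n : ℤ, ‖(0 : A)‖ * ω.w n := by simp
  rw [h0]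
  simp only [norm_def]
  refine tendsto_tsum_of_dominated_convergence (hb.add g.summable) (fun n => ?_) ?_
  · have : Tendsto (fun s => f s n - g n) l (𝓝 0) := by
      simpa using (h n).sub_const (g n)
    exact this.norm.mul_const _
  · filter_upwards [hf] with s hs n
    rw [Real.norm_of_nonneg (term_nonneg _ n), ← add_mul]
    exact mul_le_mul_of_nonneg_right
      ((norm_sub_le _ _).trans (add_le_add (hs n) le_rfl)) (ω.nonneg n)

lemma continuous_apply (n : ℤ) : Continuous fun a : WL ω A => a n :=
  AddMonoidHomClass.continuous_of_bound (coeffL n : WL ω A →ₗ[ℂ] A) 1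
    fun a => by rw [one_mul]; exact norm_apply_le a n

variable {X : Type*} [TopologicalSpace X]

/-- Continuity of each coefficient becomes continuity in norm because the suprema ‖x n‖ are summable
against the weight. -/
lemma continuous_at' (x : WL ω (BoundedContinuousFunction X ℂ)) : Continuous fun t => at' t x :=
  continuous_iff_continuousAt.2 fun t => tendsto_of_dominated x.summable
    (Eventually.of_forall fun s n => (x n).norm_coe_le_norm s)
    fun n => (x n).continuous.tendsto t

lemma exists_of_bound {f : ℤ → X → ℂ} {c : ℤ → ℝ} (hf : ∀ n, Continuous (f n))
    (hc : ∀ n t, ‖f n t‖ ≤ c n) (hc0 : ∀ n, 0 ≤ c n) (hs : Summable fun n => c n * ω.w n) :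
    ∃ x : WL ω (BoundedContinuousFunction X ℂ), (∀ n t, x n t = f n t) ∧ ∀ n, ‖x n‖ ≤ c n := by
  let y : ℤ → BoundedContinuousFunction X ℂ := fun n =>
    BoundedContinuousFunction.ofNormedAddCommGroup (f n) (hf n) (c n) (hc n)
  have hy : ∀ n, ‖y n‖ ≤ c n := fun n => BoundedContinuousFunction.norm_ofNormedAddCommGroup_le
    (hf n) (hc0 n) (hc n)
  exact ⟨mk y (Summable.of_nonneg_of_le (fun n => mul_nonneg (norm_nonneg _) (ω.nonneg n))
    (fun n => mul_le_mul_of_nonneg_right (hy n) (ω.nonneg n)) hs), fun n t => rfl, hy⟩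

end WL

lemma norm_le_of_l1norm_le {ν : ℝ} {hν : 1 ≤ ν} {X : Type*} [TopologicalSpace X]
    {x : WL (geomWeight ν hν) (BoundedContinuousFunction X ℂ)} {c : Seq} {C : ℝ} (hC : 0 ≤ C)
    (h : ∀ n t, ‖x n t‖ ≤ ‖c n‖) (hc : l1norm ν c ≤ ENNReal.ofReal C) : ‖x‖ ≤ C := by
  rw [← ENNReal.ofReal_le_ofReal_iff hC, ← l1norm_norm_coe]
  refine le_trans (l1norm_mono (zero_le_one.trans hν) fun n => ?_) hc
  rw [Complex.norm_real, norm_norm]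
  exact (BoundedContinuousFunction.norm_le (norm_nonneg _)).2 (h n)

/-! ### The scalar Duhamel formula -/

/-- The solution of `y' = l y + f`, `y 0 = 0`. -/
def duhamel (l : ℂ) (f : ℝ → ℂ) (t : ℝ) : ℂ :=
  Complex.exp (l * t) * ∫ s in (0 : ℝ)..t, Complex.exp (-(l * s)) * f s

section duhamel

variable {l : ℂ} {f g : ℝ → ℂ}

lemma continuous_exp_mul (l : ℂ) (hf : Continuous f) :
    Continuous fun s : ℝ => Complex.exp (-(l * s)) * f s := by fun_prop

lemma hasDerivAt_exp_mul (l : ℂ) (t : ℝ) :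
    HasDerivAt (fun t : ℝ => Complex.exp (l * t)) (l * Complex.exp (l * t)) t := by
  have h : HasDerivAt (fun t : ℝ => l * (t : ℂ)) l t := by
    simpa using (Complex.ofRealCLM.hasDerivAt (x := t)).const_mul l
  simpa [mul_comm] using h.cexp

lemma hasDerivAt_duhamel (l : ℂ) (hf : Continuous f) (t : ℝ) :
    HasDerivAt (duhamel l f) (l * duhamel l f t + f t) t := by
  have h1 := hasDerivAt_exp_mul l t
  have h2 := (continuous_exp_mul l hf).integral_hasStrictDerivAt 0 t
  have h3 := h1.mul h2.hasDerivAt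
  refine h3.congr_deriv ?_
  rw [duhamel, ← mul_assoc (Complex.exp (l * t)), ← Complex.exp_add, add_neg_cancel,
    Complex.exp_zero]
  ring

lemma continuous_duhamel (l : ℂ) (hf : Continuous f) : Continuous (duhamel l f) :=
  continuous_iff_continuousAt.2 fun t => (hasDerivAt_duhamel l hf t).continuousAt

@[simp] lemma duhamel_zero_time : duhamel l f 0 = 0 := by simp [duhamel]

lemma duhamel_sub (hf : Continuous f) (hg : Continuous g) (t : ℝ) :
    duhamel l f t - duhamel l g t = duhamel l (fun s => f s - g s) t := by
  rw [duhamel, duhamel, duhamel, ← mul_sub, ← intervalIntegral.integral_sub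
    ((continuous_exp_mul l hf).intervalIntegrable _ _)
    ((continuous_exp_mul l hg).intervalIntegrable _ _)]
  simp only [mul_sub]

lemma integral_exp_neg_mul {a : ℝ} (ha : a ≠ 0) (T t : ℝ) :
    ∫ s in T..t, Real.exp (-(a * s)) = (Real.exp (-(a * T)) - Real.exp (-(a * t))) / a := by
  have h : ∀ s ∈ Set.uIcc T t, HasDerivAt (fun s => -(Real.exp (-(a * s)) / a))
      (Real.exp (-(a * s))) s := by
    intro s _
    have h1 : HasDerivAt (fun s : ℝ => -(a * s)) (-a) s := by
      simpa using ((hasDerivAt_id s).const_mul a).fun_neg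
    refine (h1.exp.div_const a).neg.congr_deriv ?_
    field_simp
  rw [intervalIntegral.integral_eq_sub_of_hasDerivAt h
    (Continuous.intervalIntegrable (by fun_prop) _ _)]
  ring

/-- The integral of e^{Re l (t-s)} over [T, t] is at most 1/|Re l|, however long the interval. A
general lower limit T is kept for the tail estimate in `tendsto_duhamel`. -/
lemma norm_exp_mul_integral_le (hl : l.re < 0) {M T t : ℝ} (hT : T ≤ t)
    (hM : ∀ s ∈ Set.Icc T t, ‖f s‖ ≤ M) (hM0 : 0 ≤ M) :
    ‖Complex.exp (l * t) * ∫ s in T..t, Complex.exp (-(l * s)) * f s‖ ≤ |(l.re)⁻¹| * M := by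
  have h1 : ‖∫ s in T..t, Complex.exp (-(l * s)) * f s‖ ≤
      ∫ s in T..t, Real.exp (-(l.re * s)) * M := by
    refine intervalIntegral.norm_integral_le_of_norm_le hT ?_
      (Continuous.intervalIntegrable (by fun_prop) _ _)
    refine Eventually.of_forall fun s hs => ?_
    rw [norm_mul, Complex.norm_exp]
    refine mul_le_mul (le_of_eq ?_) (hM s ⟨hs.1.le, hs.2⟩) (norm_nonneg _) (Real.exp_nonneg _)
    simp
  rw [intervalIntegral.integral_mul_const, integral_exp_neg_mul hl.ne] at h1
  rw [norm_mul, Complex.norm_exp]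
  have h2 : (l * (t : ℂ)).re = l.re * t := by simp
  rw [h2, abs_inv, abs_of_neg hl]
  refine (mul_le_mul_of_nonneg_left h1 (Real.exp_nonneg _)).trans ?_
  have e : Real.exp (l.re * t) * ((Real.exp (-(l.re * T)) - Real.exp (-(l.re * t))) / l.re * M) =
      (-l.re)⁻¹ * ((1 - Real.exp (l.re * t) * Real.exp (-(l.re * T))) * M) := by
    have h3 : Real.exp (l.re * t) * Real.exp (-(l.re * t)) = 1 := by
      rw [← Real.exp_add, add_neg_cancel, Real.exp_zero]
    have h4 := hl.ne
    rw [← h3]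
    field_simp
    ring
  rw [e]
  have h5 : 0 < -l.re := by linarith
  have h6 : 0 < Real.exp (l.re * t) * Real.exp (-(l.re * T)) := by positivity
  refine mul_le_mul_of_nonneg_left ?_ (by positivity)
  nlinarith

lemma norm_duhamel_le (hl : l.re < 0) {M t : ℝ} (ht : 0 ≤ t) (hM : ∀ s, 0 ≤ s → ‖f s‖ ≤ M) :
    ‖duhamel l f t‖ ≤ |(l.re)⁻¹| * M :=
  norm_exp_mul_integral_le hl ht (fun s hs => hM s hs.1) ((norm_nonneg _).trans (hM 0 le_rfl))

lemma tendsto_exp_mul (hl : l.re < 0) :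
    Tendsto (fun t : ℝ => Complex.exp (l * t)) atTop (𝓝 0) := by
  rw [tendsto_zero_iff_norm_tendsto_zero]
  have e : ∀ t : ℝ, ‖Complex.exp (l * t)‖ = Real.exp (l.re * t) := fun t => by
    rw [Complex.norm_exp]
    simp
  simp only [e]
  exact Real.tendsto_exp_atBot.comp (tendsto_id.const_mul_atTop_of_neg hl)

/-- Split at a time T after which f is small: the factor e^{lt} kills the fixed integral up to T,
and the remainder is uniformly small. -/
lemma tendsto_duhamel (hl : l.re < 0) (hf : Continuous f) (h0 : Tendsto f atTop (𝓝 0)) :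
    Tendsto (duhamel l f) atTop (𝓝 0) := by
  rw [Metric.tendsto_nhds]
  intro ε hε
  have hl' : 0 < |(l.re)⁻¹| := abs_pos.2 (inv_ne_zero hl.ne)
  obtain ⟨η, hη, hηε⟩ : ∃ η > 0, |(l.re)⁻¹| * η < ε / 2 := by
    refine ⟨ε / 4 / |(l.re)⁻¹|, by positivity, ?_⟩
    rw [mul_div_cancel₀ _ hl'.ne']
    linarith
  have h1 : ∀ᶠ s in atTop, ‖f s‖ < η := by
    simpa using (Metric.tendsto_nhds.1 h0 η hη)
  obtain ⟨T, hT⟩ := eventually_atTop.1 h1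
  have h2 : Tendsto (fun t : ℝ => Complex.exp (l * t) *
      ∫ s in (0 : ℝ)..T, Complex.exp (-(l * s)) * f s) atTop (𝓝 0) := by
    simpa using (tendsto_exp_mul hl).mul_const _
  filter_upwards [Metric.tendsto_nhds.1 h2 (ε / 2) (half_pos hε), eventually_ge_atTop T]
    with t ht htT
  have hi := continuous_exp_mul l hf
  have e : duhamel l f t = Complex.exp (l * t) *
      (∫ s in (0 : ℝ)..T, Complex.exp (-(l * s)) * f s) +
      Complex.exp (l * t) * ∫ s in T..t, Complex.exp (-(l * s)) * f s := by
    rw [duhamel, ← mul_add, intervalIntegral.integral_add_adjacent_intervals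
      (hi.intervalIntegrable _ _) (hi.intervalIntegrable _ _)]
  rw [dist_zero_right] at ht ⊢
  rw [e]
  have h3 := norm_exp_mul_integral_le (f := f) hl htT (fun s hs => (hT s hs.1).le) hη.le
  exact (norm_add_le _ _).trans_lt (by linarith)

end duhamel

/-! ### Continuity of the block operators -/

section blockcont

variable {N : ℕ} (M : Matrix (Modes N) (Modes N) ℂ)

lemma continuous_blockOp {E : Type*} [TopologicalSpace E] {f : E → Seq}
    (hf : ∀ n, Continuous fun x => f x n) (n : ℤ) : Continuous fun x => blockOp N M (f x) n := by
  by_cases hn : n ∈ Finset.Icc (-(N : ℤ)) (N : ℤ)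
  · simp only [blockOp, hn, dif_pos]
    exact continuous_finsetSum _ fun k _ => continuous_const.mul (hf k)
  · simp only [blockOp, hn, dif_neg, not_false_eq_true]
    exact hf n

lemma tendsto_blockOp_zero {α : Type*} {l : Filter α} {f : α → Seq}
    (hf : ∀ n, Tendsto (fun x => f x n) l (𝓝 0)) (n : ℤ) :
    Tendsto (fun x => blockOp N M (f x) n) l (𝓝 0) := by
  by_cases hn : n ∈ Finset.Icc (-(N : ℤ)) (N : ℤ)
  · simp only [blockOp, hn, dif_pos]
    have := tendsto_finsetSum (Finset.univ : Finset (Modes N)) fun k _ =>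
      (hf k).const_mul (M ⟨n, hn⟩ k)
    simpa using this
  · simp only [blockOp, hn, dif_neg, not_false_eq_true]
    exact hf n

lemma hasDerivAt_blockOp {f : ℝ → Seq} {f' : Seq} {t : ℝ}
    (hf : ∀ n, HasDerivAt (fun s => f s n) (f' n) t) (n : ℤ) :
    HasDerivAt (fun s => blockOp N M (f s) n) (blockOp N M f' n) t := by
  by_cases hn : n ∈ Finset.Icc (-(N : ℤ)) (N : ℤ)
  · simp only [blockOp, hn, dif_pos]
    exact HasDerivAt.fun_sum fun k _ => (hf k).const_mul _
  · simp only [blockOp, hn, dif_neg, not_false_eq_true]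
    exact hf n

end blockcont

namespace Setup

variable {S : Setup} {hν : 1 ≤ S.ν}

/-- Continuity of γ into ℓ¹_ν is not needed: the Duhamel formula is scalar, and each component of
Q⁻¹γ(u) involves finitely many components of γ(u). -/
lemma continuous_Qinv_gam (n : ℤ) :
    Continuous fun u : WL (geomWeight S.ν hν) ℂ => S.Qinv (S.gam u) n := by
  refine continuous_blockOp _ (fun n => ?_) n
  simp only [gam, Pi.sub_apply, rhs_apply]
  refine Continuous.sub ?_ ?_
  · refine (continuous_const.mul (continuous_const.mul (WL.continuous_apply n))).add
      (continuous_finsetSum _ fun j _ => continuous_const.mul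
        ((WL.continuous_apply n).comp (continuous_papp _)))
  · refine continuous_blockOp (f := fun (u : WL (geomWeight S.ν hν) ℂ) n =>
      S.lam n * S.Qinv u n) S.QN (fun n => Continuous.mul continuous_const ?_) n
    exact continuous_blockOp (E := WL (geomWeight S.ν hν) ℂ) _
      (fun n => WL.continuous_apply n) n

end Setup

/-! ### Variation of constants around the steady state -/

namespace Setup

variable {S : Setup} {hν : 1 ≤ S.ν} {rstar : ℝ} {Z W : ℝ≥0}

/-- The nonlinear increment `Q⁻¹ (γ (us + w) - γ us)`, as a function of time. -/
def increment (us : WL (geomWeight S.ν hν) ℂ)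
    (w : WL (geomWeight S.ν hν) (BoundedContinuousFunction ℝ≥0 ℂ)) (t : ℝ) : Seq :=
  S.Qinv (S.gam (WL.at' t.toNNReal (WL.const ℝ≥0 us + w)) - S.gam us)

/-- The right-hand side of the variation of constants formula. -/
def mildRhs (us w0 : WL (geomWeight S.ν hν) ℂ)
    (w : WL (geomWeight S.ν hν) (BoundedContinuousFunction ℝ≥0 ℂ)) (t : ℝ) : Seq :=
  S.Q fun n => Complex.exp (S.lam n * t) * S.Qinv w0 n +
    duhamel (S.lam n) (fun s => increment us w s n) t

lemma continuous_increment (us : WL (geomWeight S.ν hν) ℂ)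
    (w : WL (geomWeight S.ν hν) (BoundedContinuousFunction ℝ≥0 ℂ)) (n : ℤ) :
    Continuous fun t => increment us w t n := by
  -- Clipping negative times to 0 makes the increment continuous on all of ℝ, as the scalar Duhamel
  -- lemmas require.
  have h1 : Continuous fun t : ℝ => S.Qinv (S.gam (WL.at' t.toNNReal (WL.const ℝ≥0 us + w))) n :=
    (continuous_Qinv_gam n).comp ((WL.continuous_at' _).comp continuous_real_toNNReal)
  have e : ∀ t, increment us w t n =
      S.Qinv (S.gam (WL.at' t.toNNReal (WL.const ℝ≥0 us + w))) n - S.Qinv (S.gam us) n := fun t =>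
    congrFun (map_sub S.QinvL _ _) n
  simp only [e]
  exact h1.sub continuous_const

lemma increment_eq (us : WL (geomWeight S.ν hν) ℂ)
    (w : WL (geomWeight S.ν hν) (BoundedContinuousFunction ℝ≥0 ℂ)) (t : ℝ) :
    increment us w t = S.Qinv (S.gam (WL.at' t.toNNReal (WL.const ℝ≥0 us + w)) -
      S.gam (WL.at' t.toNNReal (WL.const ℝ≥0 us + 0))) := by
  rw [increment, add_zero, WL.at'_const]

lemma increment_sub (us : WL (geomWeight S.ν hν) ℂ)
    (w w' : WL (geomWeight S.ν hν) (BoundedContinuousFunction ℝ≥0 ℂ)) (t : ℝ) (n : ℤ) :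
    increment us w t n - increment us w' t n =
      S.Qinv (S.gam (WL.at' t.toNNReal (WL.const ℝ≥0 us + w)) -
      S.gam (WL.at' t.toNNReal (WL.const ℝ≥0 us + w'))) n := by
  have := congrFun (map_sub S.QinvL (S.gam (WL.at' t.toNNReal (WL.const ℝ≥0 us + w)) - S.gam us)
    (S.gam (WL.at' t.toNNReal (WL.const ℝ≥0 us + w')) - S.gam us)) n
  rw [sub_sub_sub_cancel_right] at this
  exact this.symm

open scoped ComplexOrder in
lemma l1norm_absQ_Qinv_le {κ : ℝ≥0} (hκ : (κ : ℝ≥0∞) = S.condQ) (w0 : WL (geomWeight S.ν hν) ℂ) :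
    l1norm S.ν (S.absQ (absSeq (S.Qinv w0))) ≤ ENNReal.ofReal (κ * ‖w0‖) := by
  have h1 : l1norm S.ν (S.absQ (S.absQinv (modulus w0))) ≤ ENNReal.ofReal (κ * ‖w0‖) := by
    refine (l1norm_le_opNorm (T := fun a => S.absQ (S.absQinv a)) ?_ (zero_lt_one.trans_le hν)
      (memL1_coe _)).trans_eq ?_
    · have : S.absQinv 0 = 0 := map_zero (blockOpL _)
      rw [this]
      exact map_zero (blockOpL _)
    · rw [l1norm_coe, norm_modulus, ENNReal.ofReal_mul κ.coe_nonneg, ENNReal.ofReal_coe_nnreal, hκ, condQ]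
  refine (l1norm_mono (zero_le_one.trans hν) fun n => ?_).trans h1
  have h2 : ∀ n, ‖absSeq (S.Qinv w0) n‖ ≤ ‖S.absQinv (modulus w0) n‖ := fun n => by
    rw [absSeq, Complex.norm_real, norm_norm]
    exact norm_blockOp_le _ (fun n => le_rfl) n
  have h3 := norm_blockOp_le (absMat S.QN) h2 n
  have e1 : absMat (absMat S.QN) = absMat S.QN := by
    ext i j
    simp [absMat]
  have e2 : (fun n => ((‖S.absQinv (modulus w0) n‖ : ℝ) : ℂ)) = S.absQinv (modulus w0) :=
    absSeq_eq_self (blockOp_absMat_nonneg _ (modulus_nonneg w0))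
  rw [e1, e2] at h3
  exact h3

lemma norm_Q_duhamel_le {f : ℝ → Seq} {m : ℤ → ℝ} (hlam : ∀ n : ℤ, (S.lam n).re < 0)
    (hm : ∀ s n, ‖f s n‖ ≤ m n) {t : ℝ} (ht : 0 ≤ t) (n : ℤ) :
    ‖S.Q (fun n => duhamel (S.lam n) (fun s => f s n) t) n‖ ≤
      ‖S.B (fun n => (m n : ℂ)) n‖ := by
  have e : S.B (fun n => (m n : ℂ)) = S.absQ fun n => ((|((S.lam n).re)⁻¹| * m n : ℝ) : ℂ) := by
    rw [B]
    push_cast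
    rfl
  rw [e]
  exact norm_blockOp_le _ (fun k => norm_duhamel_le (hlam k) ht fun s _ => hm s k) n

lemma continuous_mildRhs (us w0 : WL (geomWeight S.ν hν) ℂ)
    (w : WL (geomWeight S.ν hν) (BoundedContinuousFunction ℝ≥0 ℂ)) (n : ℤ) :
    Continuous fun t => mildRhs us w0 w t n := by
  refine continuous_blockOp (f := fun (t : ℝ) n => Complex.exp (S.lam n * t) * S.Qinv w0 n +
    duhamel (S.lam n) (fun s => increment us w s n) t) S.QN (fun n => ?_) n
  exact Continuous.add (by fun_prop) (continuous_duhamel _ (continuous_increment us w n))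

lemma Bounds.norm_mildRhs_le (H : Bounds S hν rstar Z W) (us w0 : WL (geomWeight S.ν hν) ℂ)
    (w : WL (geomWeight S.ν hν) (BoundedContinuousFunction ℝ≥0 ℂ)) {m : ℤ → ℝ}
    (hm : ∀ s n, ‖increment us w s n‖ ≤ m n) {t : ℝ} (ht : 0 ≤ t) (n : ℤ) :
    ‖mildRhs us w0 w t n‖ ≤
      ‖S.absQ (absSeq (S.Qinv w0)) n‖ + ‖S.B (fun n => (m n : ℂ)) n‖ := by
  have e : mildRhs us w0 w t = S.Q (fun n => Complex.exp (S.lam n * t) * S.Qinv w0 n) +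
      S.Q (fun n => duhamel (S.lam n) (fun s => increment us w s n) t) :=
    map_add S.QL _ _
  rw [e, Pi.add_apply]
  refine (norm_add_le _ _).trans (add_le_add ?_ (norm_Q_duhamel_le H.hlam hm ht n))
  refine norm_blockOp_le _ (c := fun n => ‖S.Qinv w0 n‖) (fun k => ?_) n
  rw [norm_mul, Complex.norm_exp]
  refine mul_le_of_le_one_left (norm_nonneg _) (Real.exp_le_one_iff.2 ?_)
  have : (S.lam k * (t : ℂ)).re = (S.lam k).re * t := by simp
  rw [this]
  exact mul_nonpos_of_nonpos_of_nonneg (H.hlam k).le ht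

/-- The points us + w and us + w' lie within ρ + s and ρ + s' of ubar, and the Lipschitz constant
involves the mean of these radii. -/
lemma Bounds.exists_increment_majorant (H : Bounds S hν rstar Z W)
    {us : WL (geomWeight S.ν hν) ℂ} {ρ r : ℝ} (hus : ‖us - ofMem hν S.ubar H.hubar‖ ≤ ρ)
    (hR : ρ + r ≤ rstar ∨ W = 0)
    {w w' : WL (geomWeight S.ν hν) (BoundedContinuousFunction ℝ≥0 ℂ)} {s s' : ℝ}
    (hw : ‖w‖ ≤ s) (hw' : ‖w'‖ ≤ s') (hs : s ≤ r) (hs' : s' ≤ r) :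
    ∃ m : ℤ → ℝ, (∀ t n, ‖increment us w t n - increment us w' t n‖ ≤ m n) ∧
      l1norm S.ν (S.B fun n => (m n : ℂ)) ≤
        ENNReal.ofReal ((Z + W * ((2 * ρ + (s + s')) / 2)) * ‖w - w'‖) := by
  have hb : ∀ (x : WL (geomWeight S.ν hν) (BoundedContinuousFunction ℝ≥0 ℂ)) (q : ℝ), ‖x‖ ≤ q →
      ‖WL.const ℝ≥0 us + x - WL.const ℝ≥0 (ofMem hν S.ubar H.hubar)‖ ≤ ρ + q := by
    intro x q hx
    rw [add_sub_right_comm, WL.const_sub]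
    exact (norm_add_le _ _).trans (add_le_add ((WL.norm_const _).trans_le hus) hx)
  obtain ⟨m, hm, hB⟩ := H.exists_majorant _ _ (hb w s hw) (hb w' s' hw')
    (hR.imp (fun h => ⟨by linarith, by linarith⟩) id)
  refine ⟨m, fun t n => ?_, ?_⟩
  · rw [increment_sub]
    exact hm _ n
  · rw [add_sub_add_left_eq_sub] at hB
    convert hB using 6
    ring

/-- Solutions of the variation of constants formula that converge to zero. -/
lemma Bounds.exists_mild (H : Bounds S hν rstar Z W) {κ : ℝ≥0} (hκ : (κ : ℝ≥0∞) = S.condQ)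
    {us w0 : WL (geomWeight S.ν hν) ℂ} {ρ r : ℝ} (hr0 : 0 ≤ r)
    (hus : ‖us - ofMem hν S.ubar H.hubar‖ ≤ ρ) (hR : ρ + r ≤ rstar ∨ W = 0)
    (h1 : κ * ‖w0‖ + (Z + W * ((2 * ρ + r) / 2)) * r ≤ r) (h2 : (Z : ℝ) + W * (ρ + r) < 1) :
    ∃ w : WL (geomWeight S.ν hν) (BoundedContinuousFunction ℝ≥0 ℂ),
      (∀ n, Tendsto (w n) atTop (𝓝 0)) ∧ ∀ n (t : ℝ≥0), w n t = mildRhs us w0 w t n := by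
  classical
  have hν0 : 0 ≤ S.ν := zero_le_one.trans hν
  have hρ : 0 ≤ ρ := (norm_nonneg _).trans hus
  have hinc0 : ∀ t n, increment us (0 : WL (geomWeight S.ν hν) (BoundedContinuousFunction ℝ≥0 ℂ))
      t n = 0 := fun t n => by
    rw [increment_eq, sub_self]
    exact congrFun (map_zero S.QinvL) n
  have hex : ∀ w : WL (geomWeight S.ν hν) (BoundedContinuousFunction ℝ≥0 ℂ), ‖w‖ ≤ r →
      ∃ x : WL (geomWeight S.ν hν) (BoundedContinuousFunction ℝ≥0 ℂ),
        (∀ n t, x n t = mildRhs us w0 w (t : ℝ) n) ∧ ‖x‖ ≤ r := by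
    intro w hw
    -- Comparison with w' = 0, of radius s' = 0, gives the constant Z + W (2ρ + r) / 2 of `h1`.
    obtain ⟨m, hm, hB⟩ := H.exists_increment_majorant hus hR hw
      (w' := 0) (s' := 0) (by simp) le_rfl hr0
    simp only [hinc0, sub_zero] at hm hB
    set c : Seq := fun n => ((‖S.absQ (absSeq (S.Qinv w0)) n‖ +
      ‖S.B (fun n => (m n : ℂ)) n‖ : ℝ) : ℂ) with hc
    have hcn : ∀ n, ‖c n‖ = ‖S.absQ (absSeq (S.Qinv w0)) n‖ +
        ‖S.B (fun n => (m n : ℂ)) n‖ := fun n => by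
      rw [hc, Complex.norm_real, Real.norm_of_nonneg (by positivity)]
    have hcl : l1norm S.ν c ≤ ENNReal.ofReal r := by
      have e : c = absSeq (S.absQ (absSeq (S.Qinv w0))) + absSeq (S.B (fun n => (m n : ℂ))) := by
        funext n
        simp only [hc]
        push_cast
        rfl
      rw [e]
      refine (l1norm_add_le hν0 _ _).trans ?_
      rw [l1norm_absSeq, l1norm_absSeq]
      refine (add_le_add (l1norm_absQ_Qinv_le hκ w0) hB).trans ?_
      rw [← ENNReal.ofReal_add (by positivity) (by positivity)]
      refine ENNReal.ofReal_le_ofReal (le_trans ?_ h1)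
      rw [add_zero]
      gcongr
    obtain ⟨x, hx, -⟩ := WL.exists_of_bound (ω := geomWeight S.ν hν)
      (f := fun n (t : ℝ≥0) => mildRhs us w0 w (t : ℝ) n) (c := fun n => ‖c n‖)
      (fun n => (continuous_mildRhs us w0 w n).comp NNReal.continuous_coe)
      (fun n t => by rw [hcn]; exact H.norm_mildRhs_le us w0 w hm t.2 n)
      (fun n => norm_nonneg _)
      (MemL1.summable hν0 (hcl.trans_lt ENNReal.ofReal_lt_top))
    refine ⟨x, hx, norm_le_of_l1norm_le hr0 (fun n t => ?_) hcl⟩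
    rw [hx, hcn]
    exact H.norm_mildRhs_le us w0 w hm t.2 n
  let Φ : WL (geomWeight S.ν hν) (BoundedContinuousFunction ℝ≥0 ℂ) →
      WL (geomWeight S.ν hν) (BoundedContinuousFunction ℝ≥0 ℂ) := fun w =>
    if h : ‖w‖ ≤ r then (hex w h).choose else 0
  have hΦ : ∀ w, ‖w‖ ≤ r → (∀ n t, Φ w n t = mildRhs us w0 w (t : ℝ) n) ∧ ‖Φ w‖ ≤ r := by
    intro w hw
    simp only [Φ, hw, dif_pos]
    exact (hex w hw).choose_spec
  -- Decay is imposed component by component. It survives limits in norm, which are uniform in time,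
  -- and the Duhamel operator preserves it.
  set s : Set (WL (geomWeight S.ν hν) (BoundedContinuousFunction ℝ≥0 ℂ)) :=
    {w | ‖w‖ ≤ r ∧ ∀ n, Tendsto (w n) atTop (𝓝 0)} with hs
  have hsc : IsClosed s := by
    have e : s = {w | ‖w‖ ≤ r} ∩ ⋂ n, {w | Tendsto (w n) atTop (𝓝 0)} := by
      ext w
      simp [hs]
    rw [e]
    refine (isClosed_le continuous_norm continuous_const).inter (isClosed_iInter fun n => ?_)
    have hK : IsClosed {f : BoundedContinuousFunction ℝ≥0 ℂ | Tendsto f atTop (𝓝 0)} := by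
      refine isClosed_of_closure_subset fun f hf => ?_
      refine Metric.tendsto_nhds.2 ?_
      intro ε hε
      obtain ⟨g, hg, hfg⟩ := Metric.mem_closure_iff.1 hf (ε / 2) (half_pos hε)
      filter_upwards [Metric.tendsto_nhds.1 hg (ε / 2) (half_pos hε)] with t ht
      have := BoundedContinuousFunction.dist_coe_le_dist (f := f) (g := g) t
      linarith [dist_triangle (f t) (g t) 0]
    exact hK.preimage (WL.continuous_apply n)
  have hs0 : s.Nonempty := ⟨0, norm_zero.trans_le hr0, fun n =>
    (tendsto_const_nhds : Tendsto (fun _ : ℝ≥0 => (0 : ℂ)) atTop (𝓝 0))⟩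
  have hmaps : Set.MapsTo Φ s s := by
    refine fun w hw => ⟨(hΦ w hw.1).2, fun n => ?_⟩
    -- Decay of the components gives convergence in ℓ¹_ν by domination, so every component of the
    -- increment tends to zero.
    have hat : Tendsto (fun t : ℝ => WL.at' t.toNNReal (WL.const ℝ≥0 us + w)) atTop (𝓝 us) := by
      refine WL.tendsto_of_dominated (WL.const ℝ≥0 us + w).summable
        (Eventually.of_forall fun t n =>
          ((WL.const ℝ≥0 us + w) n).norm_coe_le_norm t.toNNReal)
        fun n => ?_
      simp only [WL.at'_apply, WL.add_apply, BoundedContinuousFunction.coe_add, Pi.add_apply,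
        WL.const_apply]
      simpa using ((hw.2 n).comp Real.tendsto_toNNReal_atTop).const_add (us n)
    have hinc : ∀ n, Tendsto (fun t => increment us w t n) atTop (𝓝 0) := fun n => by
      have e : ∀ t, increment us w t n =
          S.Qinv (S.gam (WL.at' t.toNNReal (WL.const ℝ≥0 us + w))) n - S.Qinv (S.gam us) n :=
        fun t => congrFun (map_sub S.QinvL _ _) n
      simp only [e]
      have := (((continuous_Qinv_gam (S := S) (hν := hν) n).tendsto us).comp hat).sub_const
        (S.Qinv (S.gam us) n)
      simpa using this
    have hlim : Tendsto (fun t : ℝ => mildRhs us w0 w t n) atTop (𝓝 0) := by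
      refine tendsto_blockOp_zero (f := fun (t : ℝ) n => Complex.exp (S.lam n * t) *
        S.Qinv w0 n + duhamel (S.lam n) (fun s => increment us w s n) t) S.QN (fun n => ?_) n
      simpa using ((tendsto_exp_mul (H.hlam n)).mul_const (S.Qinv w0 n)).add
        (tendsto_duhamel (H.hlam n) (continuous_increment us w n) (hinc n))
    exact (hlim.comp (NNReal.tendsto_coe_atTop.2 tendsto_id)).congr fun t => ((hΦ w hw.1).1 n t).symm
  have hcontr : ∀ x ∈ s, ∀ y ∈ s, dist (Φ x) (Φ y) ≤ (Z + W * (ρ + r)) * dist x y := by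
    intro x hx y hy
    obtain ⟨m, hm, hB⟩ := H.exists_increment_majorant hus hR hx.1 hy.1 le_rfl le_rfl
    rw [dist_eq_norm, dist_eq_norm]
    refine norm_le_of_l1norm_le (by positivity) (c := S.B fun n => (m n : ℂ)) (fun n t => ?_) ?_
    · have e : (Φ x - Φ y) n t = S.Q (fun k => duhamel (S.lam k)
          (fun s => increment us x s k - increment us y s k) (t : ℝ)) n := by
        change Φ x n t - Φ y n t = _
        rw [(hΦ x hx.1).1, (hΦ y hy.1).1]
        have := congrFun (map_sub S.QL (fun n => Complex.exp (S.lam n * (t : ℝ)) * S.Qinv w0 n +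
          duhamel (S.lam n) (fun s => increment us x s n) (t : ℝ))
          (fun n => Complex.exp (S.lam n * (t : ℝ)) * S.Qinv w0 n +
          duhamel (S.lam n) (fun s => increment us y s n) (t : ℝ))) n
        refine this.symm.trans ?_
        rw [QL_apply]
        congr 1
        funext k
        rw [Pi.sub_apply, add_sub_add_left_eq_sub,
          duhamel_sub (continuous_increment us x k) (continuous_increment us y k)]
      rw [e]
      exact norm_Q_duhamel_le (f := fun s k => increment us x s k - increment us y s k) H.hlam
        hm t.2 n
    · convert hB using 4
      ring
  obtain ⟨w, hw, hfix⟩ :=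
    exists_fixedPoint_of_dist_le hsc hs0 hmaps (by positivity) h2 hcontr
  refine ⟨w, hw.2, fun n t => ?_⟩
  rw [← (hΦ w hw.1).1, hfix]

/-- Solutions of the variation of constants formula solve the equation component by component. -/
lemma Bounds.hasDerivAt_mild (H : Bounds S hν rstar Z W) {us w0 : WL (geomWeight S.ν hν) ℂ}
    (hus : rhs S.J S.g us = 0)
    {w : WL (geomWeight S.ν hν) (BoundedContinuousFunction ℝ≥0 ℂ)}
    (hw : ∀ n (t : ℝ≥0), w n t = mildRhs us w0 w t n) {t : ℝ} (ht : 0 < t) (n : ℤ) :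
    HasDerivAt (fun s : ℝ => (WL.const ℝ≥0 us + w) n s.toNNReal)
      (rhs S.J S.g (WL.at' t.toNNReal (WL.const ℝ≥0 us + w)) n) t := by
  -- These are the coordinates Q⁻¹w, in which the linear part is diagonal and every mode satisfies a
  -- scalar equation.
  set z : ℝ → Seq := fun t n => Complex.exp (S.lam n * t) * S.Qinv w0 n +
    duhamel (S.lam n) (fun s => increment us w s n) t with hz
  have hzd : ∀ k, HasDerivAt (fun s => z s k) (S.lam k * z t k + increment us w t k) t := by
    intro k
    refine (((hasDerivAt_exp_mul (S.lam k) t).mul_const (S.Qinv w0 k)).fun_add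
      (hasDerivAt_duhamel (S.lam k) (continuous_increment us w k) t)).congr_deriv ?_
    simp only [hz]
    ring
  have hwt : ∀ s : ℝ, 0 ≤ s → (WL.at' s.toNNReal w : Seq) = S.Q (z s) := by
    intro s hs
    funext k
    rw [WL.at'_apply, hw, Real.coe_toNNReal s hs]
    rfl
  have hd := (hasDerivAt_blockOp S.QN hzd n).const_add (us n)
  have hev : (fun s : ℝ => (WL.const ℝ≥0 us + w) n s.toNNReal) =ᶠ[𝓝 t]
      fun s => us n + blockOp S.NL S.QN (z s) n := by
    filter_upwards [lt_mem_nhds ht] with s hs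
    have := congrFun (hwt s hs.le) n
    rw [WL.at'_apply] at this
    rw [WL.add_apply, BoundedContinuousFunction.add_apply, WL.const_apply, this]
    rfl
  refine (hd.congr_of_eventuallyEq hev).congr_deriv ?_
  have hv : WL.at' t.toNNReal (WL.const ℝ≥0 us + w) = us + WL.at' t.toNNReal w := by
    rw [map_add, WL.at'_const]
  -- Returning from the coordinates z, the derivative is L w + γ(us + w) - γ(us) = F(us + w) -
  -- F(us), and F(us) = 0.
  have e1 : blockOp S.NL S.QN (fun k => S.lam k * z t k + increment us w t k) =
      S.L (WL.at' t.toNNReal w) +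
        (S.gam (us + WL.at' t.toNNReal w : WL (geomWeight S.ν hν) ℂ) - S.gam us) := by
    rw [L, hwt t ht.le, Qinv_Q H.hQ, ← Q_Qinv H.hQ (S.gam _ - S.gam us), ← hv]
    exact map_add S.QL _ _
  have e2 : S.L (us + WL.at' t.toNNReal w : WL (geomWeight S.ν hν) ℂ) =
      S.L us + S.L (WL.at' t.toNNReal w) := map_add S.LL _ _
  rw [e1, hv, gam, gam, e2, hus]
  simp only [Pi.add_apply, Pi.sub_apply, Pi.zero_apply]
  ring

end Setup

/-! ### Domination in `ℓ¹_ν`, the converse Duhamel formula, polynomial weights -/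

lemma memL1_of_le {ν : ℝ} (hν : 0 ≤ ν) {a : Seq} {b : ℤ → ℝ}
    (hb : Summable fun n : ℤ => b n * ν ^ n.natAbs) (h : ∀ n, ‖a n‖ ≤ b n) : MemL1 ν a := by
  rw [MemL1, l1norm, ← ENNReal.ofReal_tsum_of_nonneg (fun n => by positivity)]
  · exact ENNReal.ofReal_lt_top
  · exact Summable.of_nonneg_of_le (fun n => by positivity)
      (fun n => mul_le_mul_of_nonneg_right (h n) (pow_nonneg hν _)) hb

lemma tendsto_l1norm_zero {ν : ℝ} (hν : 0 ≤ ν) {α : Type*} {l : Filter α} {f : α → Seq}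
    {b : ℤ → ℝ} (hb : Summable fun n : ℤ => b n * ν ^ n.natAbs)
    (hf : ∀ᶠ s in l, ∀ n, ‖f s n‖ ≤ b n) (h : ∀ n, Tendsto (fun s => f s n) l (𝓝 0)) :
    Tendsto (fun s => l1norm ν (f s)) l (𝓝 0) := by
  have h1 : Tendsto (fun s => ∑' n : ℤ, ‖f s n‖ * ν ^ n.natAbs) l
      (𝓝 (∑' n : ℤ, (0 : ℝ) * ν ^ n.natAbs)) := by
    refine tendsto_tsum_of_dominated_convergence hb (fun n => ?_) ?_
    · have := (h n).norm
      rw [norm_zero] at this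
      exact this.mul_const _
    · filter_upwards [hf] with s hs n
      rw [Real.norm_of_nonneg (by positivity)]
      exact mul_le_mul_of_nonneg_right (hs n) (pow_nonneg hν _)
  simp only [zero_mul, tsum_zero] at h1
  have h2 := ENNReal.tendsto_ofReal h1
  rw [ENNReal.ofReal_zero] at h2
  refine h2.congr' ?_
  filter_upwards [hf] with s hs
  rw [ENNReal.ofReal_tsum_of_nonneg (fun n => by positivity)
    (Summable.of_nonneg_of_le (fun n => by positivity)
      (fun n => mul_le_mul_of_nonneg_right (hs n) (pow_nonneg hν _)) hb)]
  rfl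

/-- Integrating factor e^{-lt}. At the endpoints only continuity is assumed, since a solution need
not be differentiable at the initial time. -/
lemma eq_duhamel {l : ℂ} {y f : ℝ → ℂ} {T : ℝ} (hT : 0 ≤ T) (hy : ContinuousOn y (Set.Icc 0 T))
    (hf : Continuous f) (hd : ∀ t ∈ Set.Ioo 0 T, HasDerivAt y (l * y t + f t) t) :
    y T = Complex.exp (l * T) * y 0 + duhamel l f T := by
  have hexp : ∀ t : ℝ, HasDerivAt (fun t : ℝ => Complex.exp (-(l * t)))
      (-l * Complex.exp (-(l * t))) t := fun t => by
    have := hasDerivAt_exp_mul (-l) t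
    simpa only [neg_mul] using this
  have h := intervalIntegral.integral_eq_sub_of_hasDerivAt_of_le hT
    (f := fun t => Complex.exp (-(l * t)) * y t) (f' := fun t => Complex.exp (-(l * t)) * f t)
    (ContinuousOn.mul (Continuous.continuousOn (by fun_prop)) hy)
    (fun t ht => ((hexp t).mul (hd t ht)).congr_deriv (by ring))
    ((continuous_exp_mul l hf).intervalIntegrable _ _)
  rw [duhamel, h]
  have h3 : Complex.exp (l * T) * Complex.exp (-(l * T)) = 1 := by
    rw [← Complex.exp_add, add_neg_cancel, Complex.exp_zero]
  simp only [Complex.ofReal_zero, mul_zero, neg_zero, Complex.exp_zero, one_mul]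
  linear_combination -(y T) * h3

/-- The weight `(1 + |n|) ^ k ω n`. -/
def polyWeight (ω : Weight) (k : ℕ) : Weight where
  w n := (1 + (n.natAbs : ℝ)) ^ k * ω.w n
  one_le n := by
    have h1 : (1 : ℝ) ≤ (1 + (n.natAbs : ℝ)) ^ k := one_le_pow₀ (by simp)
    nlinarith [ω.one_le n]
  zero := by simp [ω.zero]
  add_le m n := by
    have h1 : 1 + ((m + n).natAbs : ℝ) ≤ (1 + (m.natAbs : ℝ)) * (1 + (n.natAbs : ℝ)) := by
      have h : ((m + n).natAbs : ℝ) ≤ m.natAbs + n.natAbs := by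
        exact_mod_cast Int.natAbs_add_le m n
      have : (0 : ℝ) ≤ (m.natAbs : ℝ) * n.natAbs := by positivity
      linarith
    calc _ ≤ ((1 + (m.natAbs : ℝ)) * (1 + (n.natAbs : ℝ))) ^ k * (ω.w m * ω.w n) :=
          mul_le_mul (pow_le_pow_left₀ (by positivity) h1 k) (ω.add_le m n) (ω.nonneg _)
            (by positivity)
      _ = _ := by rw [mul_pow]; ring

lemma polyWeight_w (ω : Weight) (k : ℕ) (n : ℤ) :
    (polyWeight ω k).w n = (1 + (n.natAbs : ℝ)) ^ k * ω.w n := rfl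

/-! ### Parabolic regularity, component by component -/

section regularity

variable {ω : Weight} {J : ℕ} {g : ℕ → Polynomial ℝ}
  {v : WL ω (BoundedContinuousFunction ℝ≥0 ℂ)}

/-- `v` solves the equation component by component at positive times. -/
def SolvesComponents (J : ℕ) (g : ℕ → Polynomial ℝ)
    (v : WL ω (BoundedContinuousFunction ℝ≥0 ℂ)) : Prop :=
  ∀ (n : ℤ) (t : ℝ), 0 < t →
    HasDerivAt (fun s : ℝ => v n s.toNNReal) (rhs J g (WL.at' t.toNNReal v) n) t

/-- The components of `v` are dominated by a sequence with weight `(1 + |n|) ^ k`, uniformly on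
`[t, ∞)` for each `t > 0`. -/
def RegularOfOrder (k : ℕ) (v : WL ω (BoundedContinuousFunction ℝ≥0 ℂ)) : Prop :=
  ∀ t₀ : ℝ≥0, 0 < t₀ → ∃ x : WL (polyWeight ω k) (BoundedContinuousFunction ℝ≥0 ℂ),
    ∀ n t, x n t = v n (t + t₀)

lemma regularOfOrder_zero (v : WL ω (BoundedContinuousFunction ℝ≥0 ℂ)) :
    RegularOfOrder 0 v := fun t₀ _ => by
  obtain ⟨x, hx, -⟩ := WL.exists_of_bound (ω := polyWeight ω 0)
    (f := fun n (t : ℝ≥0) => v n (t + t₀)) (c := fun n => ‖v n‖)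
    (fun n => (v n).continuous.comp (by fun_prop)) (fun n t => (v n).norm_coe_le_norm _)
    (fun n => norm_nonneg _) (by simpa [polyWeight_w] using v.summable)
  exact ⟨x, hx⟩

/-- From e^{-x} ≤ 1/x; the factor 2 comes from 1/N ≤ 2/(1 + N) for N ≥ 1. -/
lemma exp_decay_le {a s N : ℝ} (hN : 1 ≤ N) (ha : N ≤ a) (hs : 0 < s) :
    Real.exp (-(a * s)) ≤ 2 / s / (1 + N) := by
  have ha0 : 0 < a * s := mul_pos (by linarith) hs
  have h1 : a * s ≤ Real.exp (a * s) := by linarith [Real.add_one_le_exp (a * s)]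
  rw [Real.exp_neg, div_div]
  calc (Real.exp (a * s))⁻¹ ≤ (a * s)⁻¹ := inv_anti₀ ha0 h1
    _ ≤ 2 / (s * (1 + N)) := by
        rw [inv_eq_one_div, div_le_div_iff₀ ha0 (by positivity)]
        nlinarith

lemma pow_div_pow_le {N : ℝ} (hN : 1 ≤ N) {j m : ℕ} (hj : j < m) :
    N ^ j / N ^ m ≤ 2 / (1 + N) := by
  have hN0 : 0 < N := by linarith
  rw [div_le_div_iff₀ (by positivity) (by positivity)]
  have h1 : N ^ j * N ≤ N ^ m := by
    rw [← pow_succ]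
    exact pow_le_pow_right₀ hN hj
  have h2 : N ^ j ≤ N ^ m := pow_le_pow_right₀ hN hj.le
  nlinarith

lemma norm_I_mul_pow (n : ℤ) (j : ℕ) : ‖(Complex.I * (n : ℂ)) ^ j‖ = (n.natAbs : ℝ) ^ j := by
  rw [norm_pow, norm_mul, Complex.norm_I, one_mul, Complex.norm_intCast, Nat.cast_natAbs,
    Int.cast_abs]

lemma natAbs_pow_two_mul (n : ℤ) (J : ℕ) : (n : ℝ) ^ (2 * J) = (n.natAbs : ℝ) ^ (2 * J) := by
  rw [Nat.cast_natAbs, Int.cast_abs, pow_mul, pow_mul, sq_abs]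

lemma rhs_eq_leading_add (a : WL ω ℂ) (n : ℤ) :
    rhs J g a n = (-((n : ℝ) ^ (2 * J) : ℝ) : ℂ) * a n +
      ∑ j ∈ Finset.range (2 * J), (Complex.I * n) ^ j * papp (g j) a n := by
  rw [rhs_apply, ← mul_assoc, leading_coeff]
  push_cast
  rfl

/-- The polynomials preserve order k because the polynomially weighted space is again an algebra.
Duhamel's formula divides ∂ₓ^j g_j by n^(2J) with j < 2J, which gains a factor 1/(1 + |n|), and
after a positive time the heat factor gains as much on the initial value. -/
lemma RegularOfOrder.succ (hJ : 1 ≤ J) (hode : SolvesComponents J g v) {k : ℕ}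
    (h : RegularOfOrder k v) : RegularOfOrder (k + 1) v := by
  intro t₀ ht₀
  -- Half of the waiting time supplies order k, the other half the decay of the heat factor.
  set t₁ : ℝ≥0 := t₀ / 2 with ht₁
  have ht₁0 : 0 < t₁ := half_pos ht₀
  have ht₁0' : (0 : ℝ) < t₁ := ht₁0
  obtain ⟨x, hx⟩ := h t₁ ht₁0
  have hxv : ∀ t, (WL.at' t x : Seq) = WL.at' (t + t₁) v := fun t => by
    funext n
    exact hx n t
  let G : ℕ → WL (polyWeight ω k) (BoundedContinuousFunction ℝ≥0 ℂ) := fun j => papp (g j) x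
  have hG : ∀ j n t, papp (g j) (WL.at' t x) n = G j n t := fun j n t => by
    rw [← map_papp]
    rfl
  let c : ℤ → ℝ := fun n => (2 / t₁ + 1) * ‖x n‖ / (1 + n.natAbs) +
    ∑ j ∈ Finset.range (2 * J), 2 / (1 + n.natAbs) * ‖G j n‖
  have hc0 : ∀ n, 0 ≤ c n := fun n => by positivity
  have hcs : Summable fun n => c n * (polyWeight ω (k + 1)).w n := by
    have h1 : Summable fun n => (2 / t₁ + 1) * (‖x n‖ * (polyWeight ω k).w n) +
        ∑ j ∈ Finset.range (2 * J), 2 * (‖G j n‖ * (polyWeight ω k).w n) :=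
      (x.summable.mul_left _).add (summable_sum fun j _ => (G j).summable.mul_left _)
    refine h1.congr fun n => ?_
    have h2 : (1 + (n.natAbs : ℝ)) ≠ 0 := by positivity
    simp only [c, polyWeight_w, add_mul, Finset.sum_mul]
    congr 1
    · field_simp
      ring
    · refine Finset.sum_congr rfl fun j _ => ?_
      field_simp
      ring
  have key : ∀ n (t : ℝ≥0), ‖v n (t + t₀)‖ ≤ c n := by
    intro n t
    have hts : t + t₀ = (t + t₁) + t₁ := by rw [add_assoc, ht₁, add_halves]
    rw [hts, ← hx]
    -- The mode 0 is not damped, but there 1 + |n| = 1 and nothing has to be gained.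
    by_cases hn : n = 0
    · have h1 : ‖x n‖ ≤ (2 / t₁ + 1) * ‖x n‖ / (1 + n.natAbs) := by
        subst hn
        simp only [Int.natAbs_zero, Nat.cast_zero, add_zero, div_one]
        have : (0 : ℝ) ≤ 2 / t₁ := by positivity
        nlinarith [norm_nonneg (x 0)]
      refine ((x n).norm_coe_le_norm _).trans (h1.trans ?_)
      simp only [c]
      have : 0 ≤ ∑ j ∈ Finset.range (2 * J), 2 / (1 + (n.natAbs : ℝ)) * ‖G j n‖ := by
        positivity
      linarith
    · have hN : (1 : ℝ) ≤ n.natAbs := by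
        exact_mod_cast Int.natAbs_pos.2 hn
      have hN2 : (n.natAbs : ℝ) ≤ (n.natAbs : ℝ) ^ (2 * J) :=
        le_self_pow₀ hN (by omega)
      set a : ℝ := (n : ℝ) ^ (2 * J) with ha
      have haN : a = (n.natAbs : ℝ) ^ (2 * J) := natAbs_pow_two_mul n J
      have ha0 : 0 < a := by rw [haN]; linarith
      let f : ℝ → ℂ := fun s => ∑ j ∈ Finset.range (2 * J),
        (Complex.I * n) ^ j * G j n s.toNNReal
      have hfc : Continuous f := continuous_finsetSum _ fun j _ =>
        continuous_const.mul ((G j n).continuous.comp continuous_real_toNNReal)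
      have hyc : Continuous fun s : ℝ => x n s.toNNReal :=
        (x n).continuous.comp continuous_real_toNNReal
      have hd : ∀ s ∈ Set.Ioo (0 : ℝ) ((t + t₁ : ℝ≥0) : ℝ), HasDerivAt
          (fun s : ℝ => x n s.toNNReal) ((-a : ℝ) * x n s.toNNReal + f s) s := by
        intro s hs
        have h1 := (hode n (s + t₁) (by linarith [hs.1])).comp_add_const s t₁
        have hst : (s + (t₁ : ℝ)).toNNReal = s.toNNReal + t₁ := by
          rw [Real.toNNReal_add hs.1.le t₁.coe_nonneg, Real.toNNReal_coe]
        have h2 : (fun s : ℝ => x n s.toNNReal) =ᶠ[𝓝 s]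
            fun s => v n (s + (t₁ : ℝ)).toNNReal := by
          filter_upwards [lt_mem_nhds hs.1] with r hr
          rw [hx, Real.toNNReal_add hr.le t₁.coe_nonneg, Real.toNNReal_coe]
        refine (h1.congr_of_eventuallyEq h2).congr_deriv ?_
        rw [hst, ← hxv, rhs_eq_leading_add]
        simp only [hG, WL.at'_apply, f, ha]
        push_cast
        rfl
      have hy := eq_duhamel (t + t₁).2 hyc.continuousOn hfc hd
      simp only [NNReal.val_eq_coe, Real.toNNReal_coe, Real.toNNReal_zero] at hy
      rw [hy]
      have hfM : ∀ s : ℝ, 0 ≤ s → ‖f s‖ ≤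
          ∑ j ∈ Finset.range (2 * J), (n.natAbs : ℝ) ^ j * ‖G j n‖ := fun s _ => by
        refine (norm_sum_le _ _).trans (Finset.sum_le_sum fun j _ => ?_)
        rw [norm_mul, norm_I_mul_pow]
        exact mul_le_mul_of_nonneg_left ((G j n).norm_coe_le_norm _) (by positivity)
      have hdu := norm_duhamel_le (l := ((-a : ℝ) : ℂ)) (by simpa using ha0) (t + t₁).2 hfM
      refine (norm_add_le _ _).trans (add_le_add ?_ (hdu.trans ?_))
      · rw [norm_mul, Complex.norm_exp]
        have e : (((-a : ℝ) : ℂ) * (((t + t₁ : ℝ≥0) : ℝ) : ℂ)).re = -(a * ((t + t₁ : ℝ≥0) : ℝ)) := by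
          rw [← Complex.ofReal_mul, Complex.ofReal_re]
          ring
        rw [e]
        have h3 : Real.exp (-(a * ((t + t₁ : ℝ≥0) : ℝ))) ≤ 2 / t₁ / (1 + n.natAbs) := by
          refine le_trans (Real.exp_le_exp.2 ?_) (exp_decay_le hN (hN2.trans_eq haN.symm) ht₁0')
          rw [NNReal.coe_add]
          have : 0 ≤ a * (t : ℝ) := by positivity
          nlinarith
        calc _ ≤ 2 / t₁ / (1 + n.natAbs) * ‖x n‖ :=
              mul_le_mul h3 ((x n).norm_coe_le_norm _) (norm_nonneg _) (by positivity)
          _ ≤ _ := by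
              rw [div_mul_eq_mul_div]
              gcongr
              linarith
      · rw [Complex.ofReal_re, Finset.mul_sum]
        refine Finset.sum_le_sum fun j hj => ?_
        have h4 := pow_div_pow_le hN (Finset.mem_range.1 hj)
        rw [← haN] at h4
        rw [← mul_assoc]
        refine mul_le_mul_of_nonneg_right ?_ (norm_nonneg _)
        rw [abs_inv, abs_neg, abs_of_pos ha0, inv_mul_eq_div]
        exact h4
  obtain ⟨x', hx', -⟩ := WL.exists_of_bound (ω := polyWeight ω (k + 1))
    (f := fun n (t : ℝ≥0) => v n (t + t₀)) (c := c)
    (fun n => (v n).continuous.comp (by fun_prop)) key hc0 hcs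
  exact ⟨x', hx'⟩

lemma regularOfOrder (hJ : 1 ≤ J) (hode : SolvesComponents J g v) (k : ℕ) :
    RegularOfOrder k v := by
  induction k with
  | zero => exact regularOfOrder_zero v
  | succ k ih => exact ih.succ hJ hode

/-- Regularity of order 2J pays for 𝒟^(2J). The bound is uniform on [t₀, ∞), so it can dominate
difference quotients. -/
lemma exists_rhs_bound (hJ : 1 ≤ J) (hode : SolvesComponents J g v) {t₀ : ℝ≥0} (ht₀ : 0 < t₀) :
    ∃ M : ℤ → ℝ, (Summable fun n => M n * ω.w n) ∧ ∀ n t, t₀ ≤ t →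
      ‖Dpow (2 * J) (WL.at' t v) n‖ ≤ M n ∧ ‖rhs J g (WL.at' t v) n‖ ≤ M n := by
  obtain ⟨x, hx⟩ := regularOfOrder hJ hode (2 * J) t₀ ht₀
  let G : ℕ → WL (polyWeight ω (2 * J)) (BoundedContinuousFunction ℝ≥0 ℂ) := fun j => papp (g j) x
  have hG : ∀ j n t, papp (g j) (WL.at' t x) n = G j n t := fun j n t => by
    rw [← map_papp]
    rfl
  have hxv : ∀ t, (WL.at' t x : Seq) = WL.at' (t + t₀) v := fun t => by
    funext n
    exact hx n t
  have hs : Summable fun n => ‖x n‖ * (polyWeight ω (2 * J)).w n +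
      ∑ j ∈ Finset.range (2 * J), ‖G j n‖ * (polyWeight ω (2 * J)).w n :=
    x.summable.add (summable_sum fun j _ => (G j).summable)
  let M : ℤ → ℝ := fun n => (1 + (n.natAbs : ℝ)) ^ (2 * J) *
    (‖x n‖ + ∑ j ∈ Finset.range (2 * J), ‖G j n‖)
  refine ⟨M, hs.congr fun n => ?_, fun n t ht => ?_⟩
  · simp only [M, polyWeight_w, ← Finset.sum_mul]
    ring
  · obtain ⟨r, rfl⟩ := exists_add_of_le ht
    rw [add_comm t₀ r, ← hxv]
    have hle : ∀ j ≤ 2 * J, (n.natAbs : ℝ) ^ j ≤ (1 + (n.natAbs : ℝ)) ^ (2 * J) := fun j hj =>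
      (pow_le_pow_left₀ (by positivity) (by linarith) j).trans
        (pow_le_pow_right₀ (by linarith [(Nat.cast_nonneg n.natAbs : (0 : ℝ) ≤ n.natAbs)]) hj)
    have h1 : ‖Dpow (2 * J) (WL.at' r x) n‖ ≤ (1 + (n.natAbs : ℝ)) ^ (2 * J) * ‖x n‖ := by
      rw [Dpow, norm_mul, norm_I_mul_pow]
      exact mul_le_mul (hle _ le_rfl) ((x n).norm_coe_le_norm r) (norm_nonneg _) (by positivity)
    refine ⟨h1.trans ?_, ?_⟩
    · simp only [M]
      gcongr
      have : 0 ≤ ∑ j ∈ Finset.range (2 * J), ‖G j n‖ := by positivity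
      linarith
    · rw [rhs_apply]
      simp only [M, mul_add, Finset.mul_sum]
      refine (norm_add_le _ _).trans (add_le_add ?_ ((norm_sum_le _ _).trans
        (Finset.sum_le_sum fun j hj => ?_)))
      · rw [norm_mul, norm_pow, norm_neg, norm_one, one_pow, one_mul]
        exact h1
      · rw [norm_mul, norm_I_mul_pow, hG]
        exact mul_le_mul (hle j (Finset.mem_range.1 hj).le) ((G j n).norm_coe_le_norm r)
          (norm_nonneg _) (by positivity)

end regularity

/-- Solutions component by component are classical solutions. -/
lemma isSolutionOn_of_solvesComponents {ν : ℝ} {hν : 1 ≤ ν} {J : ℕ} {g : ℕ → Polynomial ℝ}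
    {v : WL (geomWeight ν hν) (BoundedContinuousFunction ℝ≥0 ℂ)} (hJ : 1 ≤ J)
    (hode : SolvesComponents J g v) (τ : ℝ) :
    IsSolutionOn J g ν τ (Set.Ici τ) (WL.at' 0 v) fun t => WL.at' (t - τ).toNNReal v := by
  have hν0 : 0 ≤ ν := zero_le_one.trans hν
  refine ⟨by simp, fun t _ => memL1_coe _, fun t _ => ?_, fun t _ ht => ?_, fun t _ ht => ?_⟩
  · have hc : Continuous fun s : ℝ => WL.at' (s - τ).toNNReal v :=
      (WL.continuous_at' v).comp (continuous_real_toNNReal.comp (by fun_prop))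
    have h1 := tendsto_iff_norm_sub_tendsto_zero.1 (hc.tendsto t)
    have h2 := ENNReal.tendsto_ofReal h1
    rw [ENNReal.ofReal_zero] at h2
    refine (h2.mono_left nhdsWithin_le_nhds).congr fun s => ?_
    exact (l1norm_coe _).symm
  · have ht0 : 0 < (t - τ).toNNReal := Real.toNNReal_pos.2 (by linarith)
    obtain ⟨M, hM, hb⟩ := exists_rhs_bound hJ hode ht0
    exact memL1_of_le hν0 hM fun n => (hb n _ le_rfl).1
  · set t₀ : ℝ := (t - τ) / 2 with ht₀
    have ht₀' : 0 < t₀ := by linarith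
    obtain ⟨M, hM, hb⟩ := exists_rhs_bound hJ hode (Real.toNNReal_pos.2 ht₀')
    have hder : ∀ n, ∀ s : ℝ, τ < s → HasDerivAt (fun s : ℝ => v n (s - τ).toNNReal)
        (rhs J g (WL.at' (s - τ).toNNReal v) n) s := fun n s hs =>
      (hode n (s - τ) (by linarith)).comp_sub_const s τ
    have hrb : ∀ n, ∀ s : ℝ, τ + t₀ ≤ s → ‖rhs J g (WL.at' (s - τ).toNNReal v) n‖ ≤ M n :=
      fun n s hs => (hb n _ (Real.toNNReal_le_toNNReal (by linarith))).2
    have hle : 𝓝[Set.Ici τ \ {t}] t ≤ 𝓝[≠] t := nhdsWithin_mono _ fun s hs => hs.2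
    refine Tendsto.mono_left ?_ hle
    -- One M n bounds the difference quotient, by the mean value inequality, and the other bounds
    -- the derivative.
    refine tendsto_l1norm_zero hν0 (b := fun n => M n + M n)
      ((hM.add hM).congr fun n => (add_mul _ _ _).symm) ?_ fun n => ?_
    · have hmem : ∀ᶠ s in 𝓝[≠] t, τ + t₀ ≤ s ∧ s ≠ t :=
        ((eventually_ge_nhds (by linarith : τ + t₀ < t)).filter_mono nhdsWithin_le_nhds).and
          self_mem_nhdsWithin
      filter_upwards [hmem] with s hs n
      have hMn : 0 ≤ M n := (norm_nonneg _).trans (hrb n t (by linarith))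
      refine (norm_sub_le _ _).trans (add_le_add ?_ (hrb n t (by linarith)))
      have hmv := (convex_Ici (τ + t₀)).norm_image_sub_le_of_norm_hasDerivWithin_le
        (f := fun s : ℝ => v n (s - τ).toNNReal)
        (fun s hs => (hder n s (by linarith [Set.mem_Ici.1 hs])).hasDerivWithinAt)
        (hrb n) (Set.mem_Ici.2 (by linarith : τ + t₀ ≤ t)) (Set.mem_Ici.2 hs.1)
      have hst : 0 < ‖s - t‖ := norm_pos_iff.2 (sub_ne_zero.2 hs.2)
      rw [Pi.smul_apply, norm_smul, Complex.norm_real, norm_inv, inv_mul_le_iff₀ hst, mul_comm]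
      exact hmv
    · have h1 := (hasDerivAt_iff_tendsto_slope.1 (hder n t ht)).sub_const
        (rhs J g (WL.at' (t - τ).toNNReal v) n)
      rw [sub_self] at h1
      refine h1.congr fun s => ?_
      simp only [slope_def_module, Pi.sub_apply, Pi.smul_apply, WL.at'_apply, Complex.real_smul,
        smul_eq_mul]

/-! ### Uniqueness of solutions -/

/-- With M = max(1, 1/δ) and μ = M^(m+1), N^j M is at most N^m when N ≥ M and at most μ when N < M.
-/
lemma exists_pow_div_le (m : ℕ) {δ : ℝ} (hδ : 0 < δ) :
    ∃ μ : ℝ, 0 < μ ∧ ∀ j < m, ∀ N : ℕ, (N : ℝ) ^ j / (μ + (N : ℝ) ^ m) ≤ δ := by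
  set M : ℝ := max 1 δ⁻¹ with hM
  have hM1 : 1 ≤ M := le_max_left _ _
  have hMδ : 1 ≤ δ * M := by
    have : δ⁻¹ ≤ M := le_max_right _ _
    calc (1 : ℝ) = δ * δ⁻¹ := (mul_inv_cancel₀ hδ.ne').symm
      _ ≤ δ * M := mul_le_mul_of_nonneg_left this hδ.le
  refine ⟨M ^ (m + 1), by positivity, fun j hj N => ?_⟩
  rw [div_le_iff₀ (by positivity)]
  have hNm : (0 : ℝ) ≤ (N : ℝ) ^ m := by positivity
  have hMm : 0 ≤ M ^ (m + 1) := by positivity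
  have key : (N : ℝ) ^ j * M ≤ M ^ (m + 1) + (N : ℝ) ^ m := by
    by_cases h : M ≤ N
    · have h1 : (N : ℝ) ^ j * M ≤ (N : ℝ) ^ j * N := by gcongr
      rw [← pow_succ] at h1
      have h2 : (N : ℝ) ^ (j + 1) ≤ (N : ℝ) ^ m := pow_le_pow_right₀ (hM1.trans h) hj
      linarith
    · push Not at h
      have h1 : (N : ℝ) ^ j ≤ M ^ m :=
        (pow_le_pow_left₀ (by positivity) h.le j).trans (pow_le_pow_right₀ hM1 hj.le)
      have h2 : (N : ℝ) ^ j * M ≤ M ^ m * M := by gcongr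
      rw [← pow_succ] at h2
      linarith
  have hNj : (0 : ℝ) ≤ (N : ℝ) ^ j := by positivity
  calc (N : ℝ) ^ j ≤ (N : ℝ) ^ j * (δ * M) := le_mul_of_one_le_right hNj hMδ
    _ = δ * ((N : ℝ) ^ j * M) := by ring
    _ ≤ _ := mul_le_mul_of_nonneg_left key hδ.le

/-- Smoothing of the Duhamel integral, in time-integrated form. -/
lemma integral_norm_duhamel_le {f : ℝ → ℂ} (hf : Continuous f) {a μ T : ℝ} (ha : 0 ≤ a)
    (hμ : 0 < μ) (hT : 0 ≤ T) :
    ∫ t in (0 : ℝ)..T, Real.exp (-(μ * t)) * ‖duhamel ((-a : ℝ) : ℂ) f t‖ ≤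
      (μ + a)⁻¹ * ∫ t in (0 : ℝ)..T, Real.exp (-(μ * t)) * ‖f t‖ := by
  set p : ℝ → ℝ := fun t => ∫ s in (0 : ℝ)..t, Real.exp (a * s) * ‖f s‖ with hp
  have hpc : Continuous fun s => Real.exp (a * s) * ‖f s‖ := by fun_prop
  -- E dominates the weighted Duhamel term and satisfies E' = -(μ + a) E + e^{-μt} ‖f‖; integrating
  -- this and dropping E(T) ≥ 0 gives the factor 1/(μ + a).
  set E : ℝ → ℝ := fun t => Real.exp (-((μ + a) * t)) * p t with hE
  have hEd : ∀ t, HasDerivAt E (-((μ + a) * E t) + Real.exp (-(μ * t)) * ‖f t‖) t := by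
    intro t
    have h1 : HasDerivAt (fun t : ℝ => Real.exp (-((μ + a) * t)))
        (Real.exp (-((μ + a) * t)) * -(μ + a)) t := by
      have : HasDerivAt (fun t : ℝ => -((μ + a) * t)) (-(μ + a)) t := by
        simpa using ((hasDerivAt_id t).const_mul (μ + a)).fun_neg
      exact this.exp
    refine (h1.mul (hpc.integral_hasStrictDerivAt 0 t).hasDerivAt).congr_deriv ?_
    rw [← mul_assoc (Real.exp (-((μ + a) * t))), ← Real.exp_add,
      show -((μ + a) * t) + a * t = -(μ * t) by ring]
    simp only [hE, hp]
    ring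
  have hEc : Continuous E := continuous_iff_continuousAt.2 fun t => (hEd t).continuousAt
  have hfc : Continuous fun t => Real.exp (-(μ * t)) * ‖f t‖ := by fun_prop
  have hdc := continuous_duhamel ((-a : ℝ) : ℂ) hf
  have hftc := intervalIntegral.integral_eq_sub_of_hasDerivAt (a := 0) (b := T)
    (fun t _ => hEd t) (Continuous.intervalIntegrable (by fun_prop) _ _)
  rw [intervalIntegral.integral_add (Continuous.intervalIntegrable (by fun_prop) _ _)
    (hfc.intervalIntegrable _ _), intervalIntegral.integral_neg,
    intervalIntegral.integral_const_mul] at hftc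
  have hE0 : E 0 = 0 := by simp [hE, hp]
  have hET : 0 ≤ E T := mul_nonneg (Real.exp_nonneg _)
    (intervalIntegral.integral_nonneg hT fun s _ => by positivity)
  have hle : ∫ t in (0 : ℝ)..T, Real.exp (-(μ * t)) * ‖duhamel ((-a : ℝ) : ℂ) f t‖ ≤
      ∫ t in (0 : ℝ)..T, E t := by
    refine intervalIntegral.integral_mono_on hT
      (Continuous.intervalIntegrable (by fun_prop) _ _) (hEc.intervalIntegrable _ _) fun t ht => ?_
    have h1 : ‖∫ s in (0 : ℝ)..t, Complex.exp (-(((-a : ℝ) : ℂ) * s)) * f s‖ ≤ p t := by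
      refine intervalIntegral.norm_integral_le_of_norm_le ht.1
        (Eventually.of_forall fun s _ => ?_) (hpc.intervalIntegrable _ _)
      rw [norm_mul, Complex.norm_exp, ← Complex.ofReal_mul, ← Complex.ofReal_neg,
        Complex.ofReal_re]
      simp
    have h2 : Real.exp (-((μ + a) * t)) = Real.exp (-(μ * t)) * Real.exp (-a * t) := by
      rw [← Real.exp_add]
      ring_nf
    rw [duhamel, norm_mul, Complex.norm_exp, ← Complex.ofReal_mul, Complex.ofReal_re]
    simp only [hE]
    rw [h2, mul_assoc]
    gcongr
  rw [inv_mul_eq_div, le_div_iff₀ (by positivity)]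
  have h3 : 0 < μ + a := by positivity
  nlinarith

section weighted

variable {ω : Weight}

/-- Two continuous curves in a weighted `ℓ¹` space that solve the equation component by component
and start from the same point coincide. -/
lemma eq_of_solve_components {J : ℕ} {g : ℕ → Polynomial ℝ} {U₁ U₂ : ℝ → WL ω ℂ}
    (h₁ : Continuous U₁) (h₂ : Continuous U₂) {T : ℝ} (hT : 0 < T) (h0 : U₁ 0 = U₂ 0)
    (hd₁ : ∀ t ∈ Set.Ioo 0 T, ∀ n, HasDerivAt (fun s => U₁ s n) (rhs J g (U₁ t) n) t)
    (hd₂ : ∀ t ∈ Set.Ioo 0 T, ∀ n, HasDerivAt (fun s => U₂ s n) (rhs J g (U₂ t) n) t) :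
    ∀ t ∈ Set.Icc 0 T, U₁ t = U₂ t := by
  set D : ℝ → WL ω ℂ := fun t => U₁ t - U₂ t with hD
  have hDc : Continuous D := h₁.sub h₂
  have hDn : ∀ n, Continuous fun t => D t n := fun n => (WL.continuous_apply n).comp hDc
  let Δ : ℕ → ℝ → WL ω ℂ := fun j t => papp (g j) (U₁ t) - papp (g j) (U₂ t)
  have hΔc : ∀ j, Continuous (Δ j) := fun j =>
    ((continuous_papp _).comp h₁).sub ((continuous_papp _).comp h₂)
  have hΔn : ∀ j n, Continuous fun t => Δ j t n := fun j n =>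
    (WL.continuous_apply n).comp (hΔc j)
  -- The Lipschitz factor is a continuous function of time, hence bounded on the compact interval.
  have hLip : ∀ j, ∃ C : ℝ, 0 ≤ C ∧ ∀ t ∈ Set.Icc 0 T, ‖Δ j t‖ ≤ C * ‖D t‖ := by
    intro j
    have hF : Continuous fun t => papp (Polynomial.derivative (g j)) (U₂ t) +
        taylorFactor (g j) (U₁ t) (U₂ t) (U₂ t) := by
      refine ((continuous_papp _).comp h₂).add ?_
      unfold taylorFactor
      fun_prop
    obtain ⟨C, hC⟩ := isCompact_Icc.exists_bound_of_continuousOn (s := Set.Icc 0 T)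
      hF.continuousOn
    refine ⟨C, (norm_nonneg _).trans (hC 0 ⟨le_rfl, hT.le⟩), fun t ht => ?_⟩
    simp only [Δ]
    rw [papp_sub_papp (g j) (U₁ t) (U₂ t) (U₂ t), ← add_mul]
    exact (norm_mul_le _ _).trans (mul_le_mul_of_nonneg_right (hC t ht) (norm_nonneg _))
  choose C hC0 hC using hLip
  set K : ℝ := ∑ j ∈ Finset.range (2 * J), C j with hK
  have hK0 : 0 ≤ K := Finset.sum_nonneg fun j _ => hC0 j
  -- This δ makes δ K ≤ 1/2, so that Φ ≤ Φ / 2 and therefore Φ = 0.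
  obtain ⟨μ, hμ, hδ⟩ := exists_pow_div_le (2 * J) (δ := 1 / (2 * (K + 1))) (by positivity)
  set δ : ℝ := 1 / (2 * (K + 1)) with hδdef
  let f : ℤ → ℝ → ℂ := fun n t => ∑ j ∈ Finset.range (2 * J), (Complex.I * n) ^ j * Δ j t n
  have hfc : ∀ n, Continuous (f n) := fun n =>
    continuous_finsetSum _ fun j _ => continuous_const.mul (hΔn j n)
  have hduh : ∀ n, ∀ t ∈ Set.Icc 0 T,
      D t n = duhamel ((-((n : ℝ) ^ (2 * J)) : ℝ) : ℂ) (f n) t := by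
    intro n t ht
    have h := eq_duhamel (l := ((-((n : ℝ) ^ (2 * J)) : ℝ) : ℂ)) ht.1 (hDn n).continuousOn (hfc n)
      fun s hs => by
        have hs' : s ∈ Set.Ioo 0 T := ⟨hs.1, hs.2.trans_le ht.2⟩
        refine ((hd₁ s hs' n).fun_sub (hd₂ s hs' n)).congr_deriv ?_
        rw [rhs_eq_leading_add, rhs_eq_leading_add]
        simp only [f, Δ, hD, WL.sub_apply, mul_sub, Finset.sum_sub_distrib]
        push_cast
        ring
    have hz : D 0 n = 0 := by simp [hD, h0]
    rw [h, hz, mul_zero, zero_add]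
  have hec : Continuous fun t : ℝ => Real.exp (-(μ * t)) := by fun_prop
  -- For curves that are merely continuous into the space, time suprema of the modes need not be
  -- summable; integration in time, unlike the supremum, commutes with the sum over modes.
  set Φ : ℝ := ∫ t in (0 : ℝ)..T, Real.exp (-(μ * t)) * ‖D t‖ with hΦ
  have hsum : HasSum (fun n => ∫ t in (0 : ℝ)..T, Real.exp (-(μ * t)) * (‖D t n‖ * ω.w n)) Φ := by
    refine intervalIntegral.hasSum_integral_of_dominated_convergence
      (fun n t => Real.exp (-(μ * t)) * (‖D t n‖ * ω.w n)) (fun n => ?_) (fun n => ?_) ?_ ?_ ?_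
    · exact (hec.mul ((hDn n).norm.mul continuous_const)).aestronglyMeasurable
    · refine Eventually.of_forall fun t _ => ?_
      rw [Real.norm_of_nonneg (mul_nonneg (Real.exp_nonneg _) (WL.term_nonneg _ _))]
    · exact Eventually.of_forall fun t _ => (D t).summable.mul_left _
    · have e : (fun t => ∑' n, Real.exp (-(μ * t)) * (‖D t n‖ * ω.w n)) =
          fun t => Real.exp (-(μ * t)) * ‖D t‖ := by
        funext t
        rw [tsum_mul_left, WL.norm_def]
      rw [e]
      exact (hec.mul hDc.norm).intervalIntegrable _ _
    · exact Eventually.of_forall fun t _ => (D t).summable.hasSum.mul_left _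
  have hterm : ∀ n, ∫ t in (0 : ℝ)..T, Real.exp (-(μ * t)) * (‖D t n‖ * ω.w n) ≤
      δ * ∑ j ∈ Finset.range (2 * J),
        ∫ t in (0 : ℝ)..T, Real.exp (-(μ * t)) * (‖Δ j t n‖ * ω.w n) := by
    intro n
    have hω := ω.nonneg n
    set a : ℝ := (n : ℝ) ^ (2 * J) with ha
    have haN : a = (n.natAbs : ℝ) ^ (2 * J) := natAbs_pow_two_mul n J
    have ha0 : 0 ≤ a := by rw [haN]; positivity
    have e1 : ∀ h : ℝ → ℂ, ∫ t in (0 : ℝ)..T, Real.exp (-(μ * t)) * (‖h t‖ * ω.w n) =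
        (∫ t in (0 : ℝ)..T, Real.exp (-(μ * t)) * ‖h t‖) * ω.w n := fun h => by
      rw [← intervalIntegral.integral_mul_const]
      simp only [mul_assoc]
    have e2 : ∫ t in (0 : ℝ)..T, Real.exp (-(μ * t)) * ‖D t n‖ =
        ∫ t in (0 : ℝ)..T, Real.exp (-(μ * t)) * ‖duhamel ((-a : ℝ) : ℂ) (f n) t‖ := by
      refine intervalIntegral.integral_congr fun t ht => ?_
      rw [Set.uIcc_of_le hT.le] at ht
      simp only [hduh n t ht, ha]
    have e3 : ∫ t in (0 : ℝ)..T, Real.exp (-(μ * t)) * ‖f n t‖ ≤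
        ∑ j ∈ Finset.range (2 * J), (n.natAbs : ℝ) ^ j *
          ∫ t in (0 : ℝ)..T, Real.exp (-(μ * t)) * ‖Δ j t n‖ := by
      have hi : ∀ j, IntervalIntegrable (fun t => (n.natAbs : ℝ) ^ j *
          (Real.exp (-(μ * t)) * ‖Δ j t n‖)) MeasureTheory.volume 0 T := fun j =>
        (continuous_const.mul (hec.mul (hΔn j n).norm)).intervalIntegrable _ _
      simp only [← intervalIntegral.integral_const_mul]
      rw [← intervalIntegral.integral_finsetSum fun j _ => hi j]
      refine intervalIntegral.integral_mono_on hT.le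
        ((hec.mul (hfc n).norm).intervalIntegrable _ _)
        ((continuous_finsetSum _ fun j _ =>
          continuous_const.mul (hec.mul (hΔn j n).norm)).intervalIntegrable _ _) fun t _ => ?_
      calc _ ≤ Real.exp (-(μ * t)) * ∑ j ∈ Finset.range (2 * J),
            (n.natAbs : ℝ) ^ j * ‖Δ j t n‖ := by
            refine mul_le_mul_of_nonneg_left ?_ (Real.exp_nonneg _)
            refine (norm_sum_le _ _).trans_eq (Finset.sum_congr rfl fun j _ => ?_)
            rw [norm_mul, norm_I_mul_pow]
        _ = _ := by
            rw [Finset.mul_sum]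
            exact Finset.sum_congr rfl fun _ _ => by ring
    rw [e1, e2, Finset.mul_sum]
    calc _ ≤ ((μ + a)⁻¹ * ∑ j ∈ Finset.range (2 * J), (n.natAbs : ℝ) ^ j *
          ∫ t in (0 : ℝ)..T, Real.exp (-(μ * t)) * ‖Δ j t n‖) * ω.w n := by
          refine mul_le_mul_of_nonneg_right ?_ hω
          exact (integral_norm_duhamel_le (hfc n) ha0 hμ hT.le).trans
            (mul_le_mul_of_nonneg_left e3 (by positivity))
      _ ≤ _ := by
          rw [Finset.mul_sum, Finset.sum_mul]
          refine Finset.sum_le_sum fun j hj => ?_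
          rw [e1, ← mul_assoc, ← mul_assoc]
          refine mul_le_mul_of_nonneg_right (mul_le_mul_of_nonneg_right ?_ ?_) hω
          · have := hδ j (Finset.mem_range.1 hj) n.natAbs
            rwa [← haN, ← inv_mul_eq_div] at this
          · exact intervalIntegral.integral_nonneg hT.le fun t _ => by positivity
  have hfin : ∀ s : Finset ℤ, ∑ n ∈ s,
      ∫ t in (0 : ℝ)..T, Real.exp (-(μ * t)) * (‖D t n‖ * ω.w n) ≤ δ * (K * Φ) := by
    intro s
    refine (Finset.sum_le_sum fun n _ => hterm n).trans ?_
    rw [← Finset.mul_sum, Finset.sum_comm, hK, Finset.sum_mul]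
    refine mul_le_mul_of_nonneg_left (Finset.sum_le_sum fun j _ => ?_) (by positivity)
    have hi : ∀ n, IntervalIntegrable (fun t => Real.exp (-(μ * t)) * (‖Δ j t n‖ * ω.w n))
        MeasureTheory.volume 0 T := fun n =>
      (hec.mul ((hΔn j n).norm.mul continuous_const)).intervalIntegrable _ _
    rw [← intervalIntegral.integral_finsetSum fun n _ => hi n, hΦ,
      ← intervalIntegral.integral_const_mul]
    refine intervalIntegral.integral_mono_on hT.le
      ((continuous_finsetSum _ fun n _ =>
        hec.mul ((hΔn j n).norm.mul continuous_const)).intervalIntegrable _ _)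
      ((continuous_const.mul (hec.mul hDc.norm)).intervalIntegrable _ _) fun t ht => ?_
    rw [← Finset.mul_sum, mul_left_comm]
    refine mul_le_mul_of_nonneg_left (le_trans ?_ (hC j t ht)) (Real.exp_nonneg _)
    exact (Δ j t).summable.sum_le_tsum s fun n _ => WL.term_nonneg _ _
  have hΦ0 : 0 ≤ Φ :=
    intervalIntegral.integral_nonneg hT.le fun t _ => by positivity
  have hΦle : Φ ≤ δ * (K * Φ) := hasSum_le_of_sum_le hsum hfin
  have hδK : δ * K ≤ 1 / 2 := by
    rw [hδdef, div_mul_eq_mul_div, div_le_div_iff₀ (by positivity) (by norm_num)]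
    linarith
  have hΦz : Φ = 0 := by
    have : δ * (K * Φ) ≤ 1 / 2 * Φ := by
      rw [← mul_assoc]
      exact mul_le_mul_of_nonneg_right hδK hΦ0
    linarith
  intro t ht
  by_contra hne
  have hpos : 0 < Φ := by
    refine intervalIntegral.integral_pos hT (hec.mul hDc.norm).continuousOn
      (fun s _ => by positivity) ⟨t, ht, ?_⟩
    have : 0 < ‖D t‖ := norm_pos_iff.2 (sub_ne_zero.2 hne)
    positivity
  exact hpos.ne' hΦz

end weighted

section solutions

variable {J : ℕ} {g : ℕ → Polynomial ℝ} {ν τ T : ℝ} {uin : Seq} {u u₁ u₂ : ℝ → Seq}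

lemma ofReal_norm_le_l1norm (hν : 1 ≤ ν) (a : Seq) (n : ℤ) :
    ENNReal.ofReal ‖a n‖ ≤ l1norm ν a :=
  (ENNReal.ofReal_le_ofReal (le_mul_of_one_le_right (norm_nonneg _) (one_le_pow₀ hν))).trans
    (ENNReal.le_tsum n)

lemma tendsto_apply_of_l1norm (hν : 1 ≤ ν) {α : Type*} {l : Filter α} {f : α → Seq}
    (h : Tendsto (fun s => l1norm ν (f s)) l (𝓝 0)) (n : ℤ) :
    Tendsto (fun s => f s n) l (𝓝 0) := by
  rw [tendsto_zero_iff_norm_tendsto_zero]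
  have h1 : Tendsto (fun s => ENNReal.ofReal ‖f s n‖) l (𝓝 0) :=
    tendsto_of_tendsto_of_tendsto_of_le_of_le tendsto_const_nhds h (fun _ => zero_le)
      fun s => ofReal_norm_le_l1norm hν _ n
  have h2 := (ENNReal.tendsto_toReal ENNReal.zero_ne_top).comp h1
  simpa [Function.comp_def] using h2

lemma IsSolutionOn.mono {I I' : Set ℝ} (h : IsSolutionOn J g ν τ I uin u) (hI : I' ⊆ I) :
    IsSolutionOn J g ν τ I' uin u where
  initial := h.initial
  mem t ht := h.mem t (hI ht)
  cont t ht := (h.cont t (hI ht)).mono_left (nhdsWithin_mono _ hI)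
  reg t ht := h.reg t (hI ht)
  deriv t ht hτ := (h.deriv t (hI ht) hτ).mono_left
    (nhdsWithin_mono _ (Set.sdiff_subset_sdiff_left hI))

lemma IsSolutionOn.hasDerivAt (hν : 1 ≤ ν) (h : IsSolutionOn J g ν τ (Set.Ico τ T) uin u)
    {t : ℝ} (ht : t ∈ Set.Ioo τ T) (n : ℤ) :
    HasDerivAt (fun s => u s n) (rhs J g (u t) n) t := by
  have h1 := tendsto_apply_of_l1norm hν (h.deriv t ⟨ht.1.le, ht.2⟩ ht.1) n
  have hn : 𝓝[Set.Ico τ T \ {t}] t = 𝓝[≠] t := by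
    rw [Set.sdiff_eq, Set.inter_comm]
    exact nhdsWithin_inter_of_mem' (mem_nhdsWithin_of_mem_nhds (Ico_mem_nhds ht.1 ht.2))
  rw [hn] at h1
  rw [hasDerivAt_iff_tendsto_slope]
  have h2 := h1.add_const (rhs J g (u t) n)
  rw [zero_add] at h2
  refine h2.congr fun s => ?_
  simp only [slope_def_module, Pi.sub_apply, Pi.smul_apply, Complex.real_smul, smul_eq_mul,
    sub_add_cancel]

/-- A solution on `[τ, T)`, frozen after the time `τ + r < T`, as a curve in the Banach algebra. -/
lemma IsSolutionOn.exists_curve (hν : 1 ≤ ν) (h : IsSolutionOn J g ν τ (Set.Ico τ T) uin u)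
    {r : ℝ} (hr : 0 ≤ r) (hrT : τ + r < T) :
    ∃ U : ℝ → WL (geomWeight ν hν) ℂ, Continuous U ∧
      ∀ s ∈ Set.Icc 0 r, (U s : Seq) = u (τ + s) := by
  -- Clamping to [0, r] gives a curve defined on all of ℝ that never reaches T.
  let p : ℝ → ℝ := fun s => τ + max 0 (min s r)
  have hp : Continuous p := by fun_prop
  have hpm : ∀ s, p s ∈ Set.Ico τ T := fun s => by
    have h1 : 0 ≤ max 0 (min s r) := le_max_left _ _
    have h2 : max 0 (min s r) ≤ r := max_le hr (min_le_right _ _)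
    exact ⟨by simp only [p]; linarith, by simp only [p]; linarith⟩
  refine ⟨fun s => ofMem hν (u (p s)) (h.mem _ (hpm s)), ?_, fun s hs => ?_⟩
  · refine continuous_iff_continuousAt.2 fun s => ?_
    have h1 : Tendsto p (𝓝 s) (𝓝[Set.Ico τ T] (p s)) :=
      tendsto_nhdsWithin_iff.2 ⟨hp.tendsto s, Eventually.of_forall hpm⟩
    have h2 := (ENNReal.tendsto_toReal ENNReal.zero_ne_top).comp ((h.cont _ (hpm s)).comp h1)
    refine tendsto_iff_norm_sub_tendsto_zero.2 (h2.congr fun s' => ?_)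
    have e := l1norm_coe (ofMem hν (u (p s')) (h.mem _ (hpm s')) -
      ofMem hν (u (p s)) (h.mem _ (hpm s)))
    have e' := congrArg ENNReal.toReal e
    rw [ENNReal.toReal_ofReal (norm_nonneg _)] at e'
    exact e'
  · simp only [coe_ofMem, p, min_eq_left hs.2, max_eq_right hs.1]

/-- Every t < T is the end of a compact interval on which both solutions are continuous curves, so
`eq_of_solve_components` applies there. -/
lemma IsSolutionOn.eq (hν : 1 ≤ ν) (h₁ : IsSolutionOn J g ν τ (Set.Ico τ T) uin u₁)
    (h₂ : IsSolutionOn J g ν τ (Set.Ico τ T) uin u₂) : ∀ t ∈ Set.Ico τ T, u₁ t = u₂ t := by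
  intro t ht
  rcases eq_or_lt_of_le ht.1 with rfl | hlt
  · rw [h₁.initial, h₂.initial]
  have hr : 0 < t - τ := by linarith
  have hrT : τ + (t - τ) < T := by linarith [ht.2]
  obtain ⟨U₁, hU₁, he₁⟩ := h₁.exists_curve hν hr.le hrT
  obtain ⟨U₂, hU₂, he₂⟩ := h₂.exists_curve hν hr.le hrT
  have hd : ∀ (u : ℝ → Seq) (U : ℝ → WL (geomWeight ν hν) ℂ),
      IsSolutionOn J g ν τ (Set.Ico τ T) uin u →
      (∀ s ∈ Set.Icc 0 (t - τ), (U s : Seq) = u (τ + s)) → ∀ s ∈ Set.Ioo 0 (t - τ), ∀ n,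
        HasDerivAt (fun s => U s n) (rhs J g (U s) n) s := by
    intro u U h he s hs n
    have h1 := (h.hasDerivAt hν (t := τ + s) ⟨by linarith [hs.1], by linarith [hs.2, ht.2]⟩
      n).comp_const_add τ s
    rw [he s ⟨hs.1.le, hs.2.le⟩]
    refine h1.congr_of_eventuallyEq ?_
    filter_upwards [Ioo_mem_nhds hs.1 hs.2] with q hq
    rw [he q ⟨hq.1.le, hq.2.le⟩]
  have h0 : U₁ 0 = U₂ 0 := by
    refine Subtype.ext ?_
    have a1 := he₁ 0 ⟨le_rfl, hr.le⟩
    have a2 := he₂ 0 ⟨le_rfl, hr.le⟩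
    rw [add_zero, h₁.initial] at a1
    rw [add_zero, h₂.initial] at a2
    exact a1.trans a2.symm
  have hfin := eq_of_solve_components hU₁ hU₂ hr h0 (hd u₁ U₁ h₁ he₁) (hd u₂ U₂ h₂ he₂)
    (t - τ) ⟨hr.le, le_rfl⟩
  have b1 := he₁ (t - τ) ⟨hr.le, le_rfl⟩
  have b2 := he₂ (t - τ) ⟨hr.le, le_rfl⟩
  rw [add_sub_cancel] at b1 b2
  rw [← b1, ← b2, hfin]

end solutions

/-! ### From the trapping radius to global convergence -/

/-- The radius of the ball that traps the perturbation of the steady state. -/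
lemma exists_trapping_radius {Z W κ ε rmin rmax : ℝ} (hW : 0 ≤ W) (hκ : 0 ≤ κ) (hε : 0 < ε)
    (hmin : Z + W * rmin < 1)
    (hε₁ : 0 < (1 - (Z + W * rmin)) ^ 2 - 4 * W * κ * ε)
    (hε₂ : (1 - (Z + W * rmin) - Real.sqrt ((1 - (Z + W * rmin)) ^ 2 - 4 * W * κ * ε)) / (2 * W)
      ≤ rmax - rmin) :
    ∃ r : ℝ, 0 ≤ r ∧ (rmin + r ≤ rmax ∨ W = 0) ∧ κ * ε + (Z + W * rmin) * r + W * r ^ 2 ≤ r := by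
  set b := 1 - (Z + W * rmin) with hb
  have hb0 : 0 < b := by linarith
  -- For W = 0 the quotient in `hε₂` is 0 by convention and puts no bound on r, which then solves a
  -- linear equation and may exceed rmax - rmin; hence the alternative `W = 0` in the conclusion.
  rcases hW.eq_or_lt with h0 | hpos
  · refine ⟨κ * ε / b, by positivity, Or.inr h0.symm, ?_⟩
    have h1 : b * (κ * ε / b) = κ * ε := mul_div_cancel₀ _ hb0.ne'
    rw [← h0] at hb ⊢
    have h2 : b * (κ * ε / b) = (1 - Z) * (κ * ε / b) := by rw [hb]; ring
    linarith
  · set D := b ^ 2 - 4 * W * κ * ε with hD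
    have hsq : Real.sqrt D ^ 2 = D := Real.sq_sqrt hε₁.le
    have hle : Real.sqrt D ≤ b := by
      rw [Real.sqrt_le_left hb0.le, hD]
      have : 0 ≤ 4 * W * κ * ε := by positivity
      linarith
    -- The smaller root of W r² - b r + κ ε = 0; `hε₂` says precisely that it fits into rmax - rmin.
    refine ⟨(b - Real.sqrt D) / (2 * W), div_nonneg (by linarith) (by positivity),
      Or.inl (by linarith), le_of_eq ?_⟩
    have h1 : (Z + W * rmin) = 1 - b := by rw [hb]; ring
    rw [h1]
    have h2 : κ * ε = (b ^ 2 - Real.sqrt D ^ 2) / (4 * W) := by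
      rw [hsq, hD]
      field_simp
      ring
    rw [h2]
    field_simp
    ring

namespace Setup

variable {S : Setup} {hν : 1 ≤ S.ν} {rstar : ℝ} {Z W : ℝ≥0}

lemma Bounds.exists_solution (H : Bounds S hν rstar Z W) (hJ : 1 ≤ S.J) {κ : ℝ≥0}
    (hκ : (κ : ℝ≥0∞) = S.condQ) {us w0 : WL (geomWeight S.ν hν) ℂ} {ρ r : ℝ} (hr0 : 0 ≤ r)
    (hus : ‖us - ofMem hν S.ubar H.hubar‖ ≤ ρ) (hss : rhs S.J S.g us = 0)
    (hR : ρ + r ≤ rstar ∨ W = 0)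
    (h1 : κ * ‖w0‖ + (Z + W * ((2 * ρ + r) / 2)) * r ≤ r) (h2 : (Z : ℝ) + W * (ρ + r) < 1)
    (τ : ℝ) :
    ∃ v : ℝ → Seq, IsSolutionOn S.J S.g S.ν τ (Set.Ici τ) ((us : Seq) + w0) v ∧
      Tendsto (fun t => l1norm S.ν (v t - us)) atTop (𝓝 0) := by
  obtain ⟨w, hw0, hw⟩ := H.exists_mild hκ hr0 hus hR h1 h2
  have hode : SolvesComponents S.J S.g (WL.const ℝ≥0 us + w) := fun n t ht =>
    H.hasDerivAt_mild hss hw ht n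
  have hinit : (WL.at' 0 (WL.const ℝ≥0 us + w) : Seq) = (us : Seq) + w0 := by
    funext n
    rw [map_add, WL.at'_const, WL.add_apply, WL.at'_apply, hw, Pi.add_apply]
    congr 1
    have e : mildRhs us w0 w ((0 : ℝ≥0) : ℝ) = S.Q (S.Qinv w0) := by
      rw [mildRhs]
      congr 1
      funext k
      simp
    rw [e, Q_Qinv H.hQ]
  refine ⟨fun t => WL.at' (t - τ).toNNReal (WL.const ℝ≥0 us + w), ?_, ?_⟩
  · rw [← hinit]
    exact isSolutionOn_of_solvesComponents hJ hode τ
  · have hto : Tendsto (fun t : ℝ => (t - τ).toNNReal) atTop atTop :=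
      Real.tendsto_toNNReal_atTop.comp (tendsto_atTop_add_const_right _ (-τ) tendsto_id)
    have hlim : Tendsto (fun t : ℝ => WL.at' (t - τ).toNNReal w) atTop (𝓝 0) :=
      WL.tendsto_of_dominated w.summable
        (Eventually.of_forall fun t n => (w n).norm_coe_le_norm _) fun n => (hw0 n).comp hto
    have h3 := ENNReal.tendsto_ofReal hlim.norm
    rw [norm_zero, ENNReal.ofReal_zero] at h3
    refine h3.congr fun t => ?_
    rw [← l1norm_coe]
    congr 1
    funext n
    change w n _ = WL.const ℝ≥0 us n _ + w n _ - us n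
    rw [WL.const_apply, add_sub_cancel_left]

end Setup

end FourierPDE

end

/-! ### The main theorem -/

theorem mainTheorem4 (S : FourierPDE.Setup)
    (hJ : 1 ≤ S.J) (hν : 1 ≤ S.ν)
    (hubar : FourierPDE.MemL1 S.ν S.ubar)
    (hQ : IsUnit S.QN)
    (hNbar : ∀ j < 2 * S.J, ∀ n : ℤ, S.Nbar < n.natAbs → S.beta j n = 0)
    (hG : S.GamDominates)
    (hlam : ∀ n : ℤ, (S.lam n).re < 0)
    (τ : ℝ) (uin : FourierPDE.Seq) (huin : FourierPDE.MemL1 S.ν uin)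
    (rstar rmin rmax ε : ℝ) (Y Z W κ : ℝ≥0)
    (hY : (Y : ℝ≥0∞) = S.Ybound uin) (hZ : (Z : ℝ≥0∞) = S.Zbound)
    (hW : (W : ℝ≥0∞) = S.Wbound rstar) (hκ : (κ : ℝ≥0∞) = S.condQ)
    (hrmin : rmin ∈ Set.Ioo 0 rstar)
    (hmin₁ : (Y : ℝ) + Z * rmin + 1 / 2 * W * rmin ^ 2 < rmin)
    (hmin₂ : (Z : ℝ) + W * rmin < 1)
    (hrmax : rmax ∈ Set.Ioc rmin rstar)
    (hmax₁ : (Y : ℝ) + Z * rmax + 1 / 2 * W * rmax ^ 2 ≤ rmax)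
    (hmax₂ : (Z : ℝ) + W * rmax < 1)
    (hε : 0 < ε)
    (hε₁ : 0 < (1 - ((Z : ℝ) + W * rmin)) ^ 2 - 4 * W * κ * ε)
    (hε₂ : (1 - ((Z : ℝ) + W * rmin)
        - Real.sqrt ((1 - ((Z : ℝ) + W * rmin)) ^ 2 - 4 * W * κ * ε)) / (2 * W) ≤ rmax - rmin) :
    ∃ ustat : FourierPDE.Seq,
      -- the steady state: it lies in the small ball and is the only one in the large ball
      FourierPDE.IsSteadyState S.J S.g S.ν ustat ∧
      FourierPDE.l1norm S.ν (ustat - S.ubar) ≤ ENNReal.ofReal rmin ∧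
      (∀ w : FourierPDE.Seq, FourierPDE.IsSteadyState S.J S.g S.ν w →
        FourierPDE.l1norm S.ν (w - S.ubar) ≤ ENNReal.ofReal rmax → w = ustat) ∧
      -- the solution from any point of the `ε`-ball is global and converges to it
      ∀ vin : FourierPDE.Seq, FourierPDE.l1norm S.ν (vin - ustat) ≤ ENNReal.ofReal ε →
        ∃ v : ℝ → FourierPDE.Seq,
          FourierPDE.IsSolutionOn S.J S.g S.ν τ (Set.Ici τ) vin v ∧
          (∀ T : ℝ, τ < T → ∀ w : ℝ → FourierPDE.Seq,
            FourierPDE.IsSolutionOn S.J S.g S.ν τ (Set.Ico τ T) vin w →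
              ∀ t ∈ Set.Ico τ T, w t = v t) ∧
          Tendsto (fun t => FourierPDE.l1norm S.ν (v t - ustat)) atTop (𝓝 0) := by
  open FourierPDE in
  have H : Setup.Bounds S hν rstar Z W :=
    ⟨hubar, hQ, hNbar, hG, hlam, hrmin.1.trans hrmin.2, hZ, hW⟩
  have hball : ∀ (a : WL (geomWeight S.ν hν) ℂ) (r : ℝ), 0 ≤ r →
      (l1norm S.ν ((a : Seq) - S.ubar) ≤ ENNReal.ofReal r ↔ ‖a - ofMem hν S.ubar hubar‖ ≤ r) := by
    intro a r hr
    have e : (a : Seq) - S.ubar = (a - ofMem hν S.ubar hubar : WL (geomWeight S.ν hν) ℂ).1 := rfl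
    rw [e, l1norm_coe, ENNReal.ofReal_le_ofReal_iff hr]
  have hmax0 : 0 ≤ rmax := (hrmin.1.trans hrmax.1).le
  obtain ⟨us, hus, hss⟩ := H.exists_steadyState hY hrmin.1 hrmin.2.le hmin₁ hmin₂
  refine ⟨us, ⟨memL1_coe us, hss⟩, (hball us rmin hrmin.1.le).2 hus, fun w hw hwb => ?_,
    fun vin hvin => ?_⟩
  · have hwb' := (hball (ofMem hν w hw.1) rmax hmax0).1 hwb
    exact congrArg Subtype.val (H.eq_of_steadyState hrmax.2 hmax₂ hwb' (hus.trans hrmax.1.le)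
      (a := ofMem hν w hw.1) hw.2 hss)
  · obtain ⟨r, hr0, hr, hineq⟩ :=
      exists_trapping_radius W.coe_nonneg κ.coe_nonneg hε hmin₂ hε₁ hε₂
    set w0 : WL (geomWeight S.ν hν) ℂ := ofMem hν (vin - us) (hvin.trans_lt ENNReal.ofReal_lt_top)
    have hw0 : ‖w0‖ ≤ ε := by
      rwa [← ENNReal.ofReal_le_ofReal_iff hε.le, ← l1norm_coe]
    have hr' : rmin + r ≤ rmax ∨ W = 0 := hr.imp id fun h => by exact_mod_cast h
    have hvin' : (us : Seq) + w0 = vin := add_sub_cancel (us : Seq) vin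
    -- Invariance needs only W r² / 2, while the trapping inequality provides W r². The contraction
    -- constant Z + W (rmin + r) is at most Z + W rmax, or equals Z if W = 0.
    obtain ⟨v, hv, hlim⟩ := H.exists_solution hJ hκ (w0 := w0) hr0 hus hss
      (hr'.imp (fun h => h.trans hrmax.2) id) (by
        have h3 : (κ : ℝ) * ‖w0‖ ≤ κ * ε := mul_le_mul_of_nonneg_left hw0 κ.coe_nonneg
        have h4 : 0 ≤ (W : ℝ) * r ^ 2 := by positivity
        nlinarith) (by
        rcases hr with h | h
        · exact (add_le_add le_rfl (mul_le_mul_of_nonneg_left h W.coe_nonneg)).trans_lt hmax₂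
        · rw [h] at hmin₂ ⊢
          simpa using hmin₂) τ
    rw [hvin'] at hv
    exact ⟨v, hv, fun T _ w hw => hw.eq hν (hv.mono Set.Ico_subset_Ici_self), hlim⟩
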